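/- Let $1\le S<K$ and $N$ be integers, and let $\Phi=(\varphi_1,\dots,\varphi_K)$ be a unit norm frame of $\mathbb R^d$ ($K\ge d$, $\|\varphi_i\|_2=1$) with frame constants $0<A\le B$, that is, $A\|v\|_2^2\le\sum_i|\langle\varphi_i,v\rangle|^2\le B\|v\|_2^2$ for all $v$, and coherence $\mu=\max_{i\ne j}|\langle\varphi_i,\varphi_j\rangle|$. Let $\mathcal D$ be the set of all $K$-tuples $\Psi=(\psi_1,\dots,\psi_K)$ of unit vectors of $\mathbb R^d$, and $d(\Psi,\Phi)=\max_i\|\psi_i-\varphi_i\|_2$. Let $\nu$ be a probability measure on the unit sphere of $\mathbb R^K$ that is invariant under sign changes and permutations of the coordinates, and let $\eta$ be the law of a random vector $r=(r(1),\dots,r(d))$ with independent centred entries that satisfy $\mathbb E\,e^{t r(i)}\le e^{t^2\rho^2/2}$ for all $t\in\mathbb R$, where $\rho\ge 0$. Let $(x_n,r_n)$, $1\le n\le N$, be i.i.d. pairs, with $x_n\sim\nu$ and $r_n\sim\eta$ independent, and $$y_n=\frac{\Phi x_n+r_n}{\sqrt{1+\|r_n\|_2^2}}.$$ Let $c_1(x)\ge\dots\ge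 c_K(x)\ge 0$ be the non-increasing rearrangement of the absolute values of the components of $x$, $\gamma=\mathbb E\,c_1(x_n)+\dots+\mathbb E\,c_S(x_n)$ and $C_r=\mathbb E\big((1+\|r_n\|_2^2)^{-1/2}\big)$. Suppose that $\beta>0$ is such that $c_S(x_n)-c_{S+1}(x_n)\ge\beta$ almost surely, and that $\tilde\varepsilon>0$, $\mu$ and $\rho$ satisfy $$\tilde\varepsilon\le\frac{\beta}{\frac94+9\sqrt{\log a}},\qquad \max\{\mu,\rho\}\le\frac{\beta}{\sqrt{72(\log a+\log\log a)}},\qquad\text{where } a=\frac{150\,K^2S(\sqrt B+1)}{C_r\,\beta\,\gamma}.$$ Put $$\tilde\varepsilon_{\mu,\rho}=\max\Big\{\tilde\varepsilon,\ \frac{16\,SK^2(\sqrt B+1)}{C_r\,\gamma}\exp\Big(-\frac{\beta^2}{72\max\{\mu^2,\rho^2\}}\Big)\Big\},$$ where the exponential is read as $0$ if $\mu=\rho=0$. Then, except with probability at most $$2\exp\Big(-\frac{N\,\tilde\varepsilon_{\mu,\rho}^2\,\gamma^2}{513\,C_r^2S^2K^2(\sqrt B+1)^2}+Kd\log\Big(\frac{49\,SK(\sqrt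 B+1)}{\tilde\varepsilon_{\mu,\rho}\,\gamma}\Big)\Big),$$ there is $\tilde\Psi\in\mathcal D$ with $$d(\tilde\Psi,\Phi)\le\tilde\varepsilon_{\mu,\rho}+\frac{\tilde\varepsilon_{\mu,\rho}^2}{16K}$$ that is a local maximum over $\Psi\in\mathcal D$ of $\frac1N\sum_{n=1}^N\max_{|I|=S}\|\Psi_I^\star y_n\|_1$ (equivalently, of the sum without the factor $\frac1N$), where $\|\Psi_I^\star y\|_1=\sum_{i\in I}|\langle\psi_i,y\rangle|$. -/

import Mathlib

open MeasureTheory ProbabilityTheory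
open scoped NNReal ENNReal

noncomputable section

namespace DictId

/-- The set of all dictionaries: `K`-tuples of unit norm vectors in `ℝ^d`. -/
def dictionaries (d K : ℕ) : Set (Fin K → EuclideanSpace ℝ (Fin d)) :=
  {Ψ | ∀ i, ‖Ψ i‖ = 1}

/-- The distance of two dictionaries: the maximal distance of corresponding atoms. -/
def dictDist {d K : ℕ} (Φ Ψ : Fin K → EuclideanSpace ℝ (Fin d)) : ℝ :=
  ⨆ i, ‖Φ i - Ψ i‖

/-- The coherence: the maximal absolute inner product of two different atoms. -/
def coherence {d K : ℕ} (Φ : Fin K → EuclideanSpace ℝ (Fin d)) : ℝ :=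
  ⨆ p : {p : Fin K × Fin K // p.1 ≠ p.2}, |inner ℝ (Φ p.1.1) (Φ p.1.2)|

/-- `Φ` is a frame of `ℝ^d` with (not necessarily optimal) frame constants `A ≤ B`. -/
structure IsFrame {d K : ℕ} (Φ : Fin K → EuclideanSpace ℝ (Fin d)) (A B : ℝ) : Prop where
  card_le : d ≤ K
  lower_pos : 0 < A
  le : A ≤ B
  lower : ∀ v, A * ‖v‖ ^ 2 ≤ ∑ i, |inner ℝ (Φ i) v| ^ 2
  upper : ∀ v, ∑ i, |inner ℝ (Φ i) v| ^ 2 ≤ B * ‖v‖ ^ 2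

/-- A symmetric probability distribution on the unit sphere of `ℝ^K`: it is carried by the
sphere and invariant under sign changes and permutations of the coordinates. -/
structure IsSymmetricOnSphere {K : ℕ} (ν : Measure (EuclideanSpace ℝ (Fin K))) : Prop where
  prob : IsProbabilityMeasure ν
  sphere : ν (Metric.sphere 0 1) = 1
  sign : ∀ X : Set (EuclideanSpace ℝ (Fin K)), MeasurableSet X → X ⊆ Metric.sphere 0 1 →
    ∀ σ : Fin K → ℝ, (∀ i, σ i = 1 ∨ σ i = -1) →
      ν ((fun x => WithLp.toLp 2 fun i => σ i * x i) '' X) = ν X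
  perm : ∀ X : Set (EuclideanSpace ℝ (Fin K)), MeasurableSet X → X ⊆ Metric.sphere 0 1 →
    ∀ p : Equiv.Perm (Fin K), ν ((fun x => WithLp.toLp 2 fun i => x (p i)) '' X) = ν X

/-- The law of a centred subgaussian random vector with parameter `ρ`: the entries are
independent and centred, and `E exp (t * r i) ≤ exp (t ^ 2 * ρ ^ 2 / 2)` for all real `t`. -/
structure IsSubgaussianNoise {d : ℕ} (η : Measure (EuclideanSpace ℝ (Fin d))) (ρ : ℝ≥0) :
    Prop where
  prob : IsProbabilityMeasure η
  indep : iIndepFun (fun (i : Fin d) (v : EuclideanSpace ℝ (Fin d)) => v i) η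
  centred : ∀ i, ∫ v, v i ∂η = 0
  subgaussian : ∀ i, HasSubgaussianMGF (fun v : EuclideanSpace ℝ (Fin d) => v i) (ρ ^ 2) η

/-- The non-increasing rearrangement of the absolute values of the components of `x`,
indexed from `0`. -/
def rearr {K : ℕ} (x : EuclideanSpace ℝ (Fin K)) (j : Fin K) : ℝ :=
  |x (Tuple.sort (fun i => -|x i|) j)|

theorem rearr_antitone {K : ℕ} (x : EuclideanSpace ℝ (Fin K)) : Antitone (rearr x) := by
  intro i j hij
  have h := Tuple.monotone_sort (fun i => -|x i|) hij
  simpa [rearr] using h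

/-- `amp x s` is `c_s(x)`, the `s`-th largest absolute value of the components of `x`, for
`1 ≤ s ≤ K` (indexed from `1`). -/
def amp {K : ℕ} (x : EuclideanSpace ℝ (Fin K)) (s : ℕ) : ℝ :=
  if h : 1 ≤ s ∧ s ≤ K then rearr x ⟨s - 1, by omega⟩ else 0

/-- The sum `E c_1(x) + ... + E c_S(x)` for `x` distributed according to `ν`. -/
def ampSum {K : ℕ} (ν : Measure (EuclideanSpace ℝ (Fin K))) (S : ℕ) : ℝ :=
  ∑ s ∈ Finset.Icc 1 S, ∫ x, amp x s ∂ν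

/-- The constant `C_r = E (1 + ‖r‖ ^ 2) ^ (-1 / 2)` for noise `r` distributed according
to `η`. -/
def noiseConst {d : ℕ} (η : Measure (EuclideanSpace ℝ (Fin d))) : ℝ :=
  ∫ v, 1 / √(1 + ‖v‖ ^ 2) ∂η

/-- The noisy signal `(Φ x + r) / √(1 + ‖r‖ ^ 2)`. -/
def signal {d K : ℕ} (Φ : Fin K → EuclideanSpace ℝ (Fin d)) (x : EuclideanSpace ℝ (Fin K))
    (r : EuclideanSpace ℝ (Fin d)) : EuclideanSpace ℝ (Fin d) :=
  (1 / √(1 + ‖r‖ ^ 2)) • (∑ i, x i • Φ i + r)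

/-- The `S`-response `max_{|I| = S} ‖Ψ_I^* y‖_1`. -/
def response {d K : ℕ} (S : ℕ) (Ψ : Fin K → EuclideanSpace ℝ (Fin d))
    (y : EuclideanSpace ℝ (Fin d)) : ℝ :=
  ⨆ I : {I : Finset (Fin K) // I.card = S}, ∑ i ∈ I.1, |inner ℝ (Ψ i) y|

/-- The response criterion `∑ n, max_{|I| = S} ‖Ψ_I^* y_n‖_1`. -/
def criterion {d K N : ℕ} (S : ℕ) (y : Fin N → EuclideanSpace ℝ (Fin d))
    (Ψ : Fin K → EuclideanSpace ℝ (Fin d)) : ℝ :=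
  ∑ n, response S Ψ (y n)

/-- The normalised response criterion `1 / N * ∑ n, max_{|I| = S} ‖Ψ_I^* y_n‖_1`. -/
def meanCriterion {d K N : ℕ} (S : ℕ) (y : Fin N → EuclideanSpace ℝ (Fin d))
    (Ψ : Fin K → EuclideanSpace ℝ (Fin d)) : ℝ :=
  1 / (N : ℝ) * ∑ n, response S Ψ (y n)

/-- The quantity `a = 150 K ^ 2 S (√B + 1) / (C β γ)`, where `C` is the noise constant and
`γ` the sum of the `S` largest mean amplitudes. -/
def logArg (K S : ℕ) (B C β γ : ℝ) : ℝ :=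
  150 * (K : ℝ) ^ 2 * S * (√B + 1) / (C * β * γ)

/-- `exp (- β ^ 2 / (72 max (μ ^ 2) (ρ ^ 2)))`, read as `0` when `μ = ρ = 0`. -/
def expTerm (β μ ρ : ℝ) : ℝ :=
  if max (μ ^ 2) (ρ ^ 2) = 0 then 0 else Real.exp (-(β ^ 2 / (72 * max (μ ^ 2) (ρ ^ 2))))

/-- The achievable precision: the larger of the target precision `ε` and
`16 S K ^ 2 (√B + 1) / (C γ) * exp (- β ^ 2 / (72 max (μ ^ 2) (ρ ^ 2)))`. -/
def precision (K S : ℕ) (B C β γ μ ρ ε : ℝ) : ℝ :=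
  max ε (16 * S * (K : ℝ) ^ 2 * (√B + 1) / (C * γ) * expTerm β μ ρ)

/-- The exceptional probability, where `e` is the achievable precision. -/
def failureProb (d K S N : ℕ) (B C γ e : ℝ) : ℝ :=
  2 * Real.exp (-(N * e ^ 2 * γ ^ 2 / (513 * C ^ 2 * (S : ℝ) ^ 2 * (K : ℝ) ^ 2 * (√B + 1) ^ 2))
    + K * d * Real.log (49 * S * K * (√B + 1) / (e * γ)))

end DictId

end

open DictId

namespace DictId

/-! ### The response as a finite maximum: stability, separation, continuity. -/

section Response

variable {d K S : ℕ}

/-! Write `C` for the noise constant, `γ` for the amplitude sum, `M = √B + 1` and `e` for the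
achievable precision. The criterion is continuous and the set of dictionaries is closed, so a local
maximum near `Φ` exists as soon as the criterion is strictly smaller at every dictionary of the
sphere `∑ ‖ψ_i - φ_i‖² = e²` than at `Φ` itself (`exists_isLocalMaxOn_dictionaries`). This `ℓ²`
sphere is the right one because the expected loss depends on `Ψ` only through `∑ ‖ψ_i - φ_i‖²`.

Drift. Fix `Ψ` on the sphere and let `D` be the change of the response of one signal when `Φ` is
replaced by `Ψ`. The inner product of `ψ_i` with the signal is a multiple of `x_i` plus a cross
term, which is subgaussian by the sign symmetry of the coefficients and the subgaussianity of the
noise. If no cross term reaches about `β / 2`, the gap forces the maximising index set and the signs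
to be those of the `S` largest coefficients, for `Ψ` and for `Φ`. Then `D` is a linear form, and the
symmetries give its mean `-(C γ / (2 K)) e²` exactly (`integral_linearResponse`). The exceptional
event changes the mean of `D` by at most `1 / 128` of `C γ e² / K`; the definition of the precision
is what guarantees this (`precision_spec`).

Concentration. The claimed exponent has `C²` in the denominator, so for strong noise a bounded-range
inequality is not enough: the second moment of `D` must be of order `C⁴`. Two of these powers come
from the normalisation factor, which rarely exceeds `8 C`. The other two come from averaging over
which `S` of the `K` atoms are active: this yields a factor `1 / K`, and `C² K ≥ 64` whenever `C < 1
/ 2`, because the dimension is at most `K` and the noise level is small. A Bernstein type bound then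
controls the Laplace transform of `D` (`integral_exp_responseChange_le_of_sum_eq`).

Uniformity. Chernoff's bound is applied on a net of the sphere, and a perturbation of `δ` costs each
signal at most `S δ M`. The union bound over the net is compared with the stated probability in
`le_failureProb`. -/

lemma sum_le_response (Ψ : Fin K → EuclideanSpace ℝ (Fin d)) (y : EuclideanSpace ℝ (Fin d))
    {I : Finset (Fin K)} (hI : I.card = S) :
    ∑ i ∈ I, |inner ℝ (Ψ i) y| ≤ response S Ψ y :=
  le_ciSup (f := fun I : {I : Finset (Fin K) // I.card = S} => ∑ i ∈ I.1, |inner ℝ (Ψ i) y|)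
    (Set.finite_range _).bddAbove ⟨I, hI⟩

lemma response_le (hSK : S ≤ K) {Ψ : Fin K → EuclideanSpace ℝ (Fin d)}
    {y : EuclideanSpace ℝ (Fin d)} {b : ℝ}
    (h : ∀ I : Finset (Fin K), I.card = S → ∑ i ∈ I, |inner ℝ (Ψ i) y| ≤ b) :
    response S Ψ y ≤ b := by
  obtain ⟨I, -, hI⟩ := Finset.exists_subset_card_eq (s := (Finset.univ : Finset (Fin K)))
    (n := S) (by simpa using hSK)
  have : Nonempty {I : Finset (Fin K) // I.card = S} := ⟨⟨I, hI⟩⟩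
  exact ciSup_le fun I => h I.1 I.2

lemma response_le_add (hSK : S ≤ K) {Ψ Ψ' : Fin K → EuclideanSpace ℝ (Fin d)}
    {y : EuclideanSpace ℝ (Fin d)} {b : ℝ} (h : ∀ i, |inner ℝ (Ψ i - Ψ' i) y| ≤ b) :
    response S Ψ y ≤ response S Ψ' y + S * b := by
  refine response_le hSK fun I hI => ?_
  calc ∑ i ∈ I, |inner ℝ (Ψ i) y| ≤ ∑ i ∈ I, (|inner ℝ (Ψ' i) y| + b) := by
        refine Finset.sum_le_sum fun i _ => ?_
        have h1 := h i
        rw [inner_sub_left] at h1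
        have := abs_sub_abs_le_abs_sub (inner ℝ (Ψ i) y) (inner ℝ (Ψ' i) y)
        linarith
    _ = ∑ i ∈ I, |inner ℝ (Ψ' i) y| + S * b := by
        rw [Finset.sum_add_distrib, Finset.sum_const, hI, nsmul_eq_mul]
    _ ≤ _ := by gcongr; exact sum_le_response Ψ' y hI

lemma abs_response_sub_le (hSK : S ≤ K) {Ψ Ψ' : Fin K → EuclideanSpace ℝ (Fin d)}
    {y : EuclideanSpace ℝ (Fin d)} {b : ℝ} (h : ∀ i, |inner ℝ (Ψ i - Ψ' i) y| ≤ b) :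
    |response S Ψ y - response S Ψ' y| ≤ S * b := by
  rw [abs_le]
  have h1 := response_le_add hSK h
  have h2 := response_le_add (Ψ := Ψ') (Ψ' := Ψ) (y := y) (b := b) hSK fun i => by
    rw [← neg_sub, inner_neg_left, abs_neg]; exact h i
  constructor <;> linarith

/-- Subtract the smallest value on `I`: the shifted terms are nonnegative on `I` and nonpositive off
`I`, and equal cardinality makes the shift cancel. -/
lemma sum_le_sum_of_separated {ι : Type*} {I J : Finset ι} (hcard : J.card = I.card)
    {b : ι → ℝ} (hb : ∀ i ∈ I, ∀ j ∉ I, b j ≤ b i) : ∑ j ∈ J, b j ≤ ∑ i ∈ I, b i := by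
  classical
  rcases I.eq_empty_or_nonempty with rfl | hI
  · rw [Finset.card_empty, Finset.card_eq_zero] at hcard
    simp [hcard]
  obtain ⟨i₀, hi₀, hmin⟩ := I.exists_min_image b hI
  have key : ∑ j ∈ J, (b j - b i₀) ≤ ∑ i ∈ I, (b i - b i₀) := by
    calc ∑ j ∈ J, (b j - b i₀) = ∑ j ∈ J ∩ I, (b j - b i₀) + ∑ j ∈ J \ I, (b j - b i₀) := by
          rw [add_comm, ← Finset.sdiff_inter_self_left J I,
            Finset.sum_sdiff Finset.inter_subset_left]
      _ ≤ ∑ j ∈ J ∩ I, (b j - b i₀) + 0 := by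
          gcongr
          refine Finset.sum_nonpos fun j hj => ?_
          rw [Finset.mem_sdiff] at hj
          linarith [hb i₀ hi₀ j hj.2]
      _ ≤ _ := by
          rw [add_zero]
          exact Finset.sum_le_sum_of_subset_of_nonneg Finset.inter_subset_right
            fun i hi _ => by linarith [hmin i hi]
  simp only [Finset.sum_sub_distrib, Finset.sum_const, hcard] at key
  linarith

lemma response_eq_sum (hSK : S ≤ K) {Ψ : Fin K → EuclideanSpace ℝ (Fin d)}
    {y : EuclideanSpace ℝ (Fin d)} {I : Finset (Fin K)} (hI : I.card = S)
    (h : ∀ i ∈ I, ∀ j ∉ I, |inner ℝ (Ψ j) y| ≤ |inner ℝ (Ψ i) y|) :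
    response S Ψ y = ∑ i ∈ I, |inner ℝ (Ψ i) y| :=
  le_antisymm (response_le hSK fun J hJ => sum_le_sum_of_separated (by rw [hI, hJ])
    (b := fun i => |inner ℝ (Ψ i) y|) h)
    (sum_le_response Ψ y hI)

lemma continuous_response (hSK : S ≤ K) {X : Type*} [TopologicalSpace X]
    {Ψ : X → Fin K → EuclideanSpace ℝ (Fin d)} {y : X → EuclideanSpace ℝ (Fin d)}
    (hΨ : Continuous Ψ) (hy : Continuous y) : Continuous fun z => response S (Ψ z) (y z) := by
  obtain ⟨I, -, hI⟩ := Finset.exists_subset_card_eq (s := (Finset.univ : Finset (Fin K)))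
    (n := S) (by simpa using hSK)
  have : Nonempty {I : Finset (Fin K) // I.card = S} := ⟨⟨I, hI⟩⟩
  have : (fun z => response S (Ψ z) (y z)) = fun z =>
      (Finset.univ : Finset {I : Finset (Fin K) // I.card = S}).sup' Finset.univ_nonempty
        fun I => ∑ i ∈ I.1, |inner ℝ (Ψ z i) (y z)| := by
    funext z
    rw [Finset.sup'_univ_eq_ciSup]
    rfl
  rw [this]
  refine Continuous.finset_sup'_apply _ fun I _ => ?_
  exact continuous_finsetSum _ fun i _ =>
    (Continuous.inner ((continuous_apply i).comp hΨ) hy).abs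

end Response

/-! ### The set of the `S` largest coefficients and its signs. -/

section TopSet

variable {K : ℕ}

/-- The indices of the `S` largest components in absolute value. -/
noncomputable def topSet (S : ℕ) (x : EuclideanSpace ℝ (Fin K)) : Finset (Fin K) :=
  Finset.univ.filter fun i => (Finset.univ.filter fun j => |x i| < |x j|).card < S

/-- The signs of the `S` largest components, and `0` for the other ones. -/
noncomputable def topSign (S : ℕ) (x : EuclideanSpace ℝ (Fin K)) (i : Fin K) : ℝ :=
  if i ∈ topSet S x then Real.sign (x i) else 0

lemma amp_of_lt {S : ℕ} (x : EuclideanSpace ℝ (Fin K)) (h : S < K) :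
    amp x (S + 1) = rearr x ⟨S, h⟩ := by
  rw [amp, dif_pos ⟨by omega, by omega⟩]; rfl

/-- Without the gap, ties could give `topSet` more than `S` elements. With it, a sorted position
below `S` has at most that many strictly larger entries, while a position from `S` on has at least
`S` of them. -/
lemma mem_topSet_sort {S : ℕ} (hS : 1 ≤ S) (hSK : S < K) {x : EuclideanSpace ℝ (Fin K)}
    (hgap : amp x (S + 1) < amp x S) (j : Fin K) :
    Tuple.sort (fun i => -|x i|) j ∈ topSet S x ↔ (j : ℕ) < S := by
  set σ := Tuple.sort (fun i => -|x i|) with hσ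
  have hr : ∀ j, rearr x j = |x (σ j)| := fun j => rfl
  obtain ⟨S', rfl⟩ : ∃ S', S = S' + 1 := ⟨S - 1, by omega⟩
  rw [amp_of_lt x hSK, amp_of_lt x (by omega)] at hgap
  have hcard : (Finset.univ.filter fun i => |x (σ j)| < |x i|).card =
      (Finset.univ.filter fun i => rearr x j < rearr x i).card := by
    symm
    refine Finset.card_bij (fun i _ => σ i) ?_ ?_ ?_
    · intro i hi; simpa [hr] using hi
    · intro a _ b _ h; exact σ.injective h
    · intro b hb
      exact ⟨σ.symm b, by simpa [hr] using hb, by simp⟩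
  simp only [topSet, Finset.mem_filter, Finset.mem_univ, true_and]
  rw [hcard]
  constructor
  · intro h
    by_contra hj
    rw [not_lt] at hj
    have hsub : (Finset.univ.filter fun i : Fin K => (i : ℕ) < S' + 1) ⊆
        Finset.univ.filter fun i : Fin K => rearr x j < rearr x i := by
      intro i hi
      simp only [Finset.mem_filter, Finset.mem_univ, true_and] at hi ⊢
      have h1 : rearr x j ≤ rearr x ⟨S' + 1, hSK⟩ := rearr_antitone x (by simpa [Fin.le_def] using hj)
      have h2 : rearr x ⟨S', by omega⟩ ≤ rearr x i :=
        rearr_antitone x (by simp [Fin.le_def]; omega)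
      linarith
    have h3 := Finset.card_le_card hsub
    rw [Fin.card_filter_val_lt] at h3
    have : min K (S' + 1) = S' + 1 := by omega
    omega
  · intro h
    have hsub : (Finset.univ.filter fun i : Fin K => rearr x j < rearr x i) ⊆
        Finset.univ.filter fun i : Fin K => (i : ℕ) < (j : ℕ) := by
      intro i hi
      simp only [Finset.mem_filter, Finset.mem_univ, true_and] at hi ⊢
      by_contra hji
      have : rearr x i ≤ rearr x j := rearr_antitone x (Fin.le_def.2 (not_lt.1 hji))
      linarith
    have h3 := Finset.card_le_card hsub
    rw [Fin.card_filter_val_lt] at h3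
    omega

lemma topSet_eq_map {S : ℕ} (hS : 1 ≤ S) (hSK : S < K) {x : EuclideanSpace ℝ (Fin K)}
    (hgap : amp x (S + 1) < amp x S) :
    topSet S x = (Finset.univ.filter fun i : Fin K => (i : ℕ) < S).map
      (Tuple.sort fun i => -|x i|).toEmbedding := by
  ext i
  rw [Finset.mem_map_equiv]
  have := mem_topSet_sort hS hSK hgap ((Tuple.sort fun i => -|x i|).symm i)
  rw [Equiv.apply_symm_apply] at this
  simpa using this

lemma card_topSet {S : ℕ} (hS : 1 ≤ S) (hSK : S < K) {x : EuclideanSpace ℝ (Fin K)}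
    (hgap : amp x (S + 1) < amp x S) : (topSet S x).card = S := by
  rw [topSet_eq_map hS hSK hgap, Finset.card_map, Fin.card_filter_val_lt]
  omega

lemma sum_topSet {S : ℕ} (hS : 1 ≤ S) (hSK : S < K) {x : EuclideanSpace ℝ (Fin K)}
    (hgap : amp x (S + 1) < amp x S) :
    ∑ i ∈ topSet S x, |x i| = ∑ s ∈ Finset.Icc 1 S, amp x s := by
  rw [topSet_eq_map hS hSK hgap, Finset.sum_map]
  refine Finset.sum_bij (fun i _ => (i : ℕ) + 1) ?_ ?_ ?_ ?_
  · intro i hi; simp at hi ⊢; omega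
  · intro a _ b _ h; ext; simpa using h
  · intro s hs
    rw [Finset.mem_Icc] at hs
    exact ⟨⟨s - 1, by omega⟩, by simp; omega, by simp; omega⟩
  · intro i _
    rw [amp_of_lt x i.2]; rfl

lemma amp_le_of_mem_topSet {S : ℕ} (hS : 1 ≤ S) (hSK : S < K) {x : EuclideanSpace ℝ (Fin K)}
    (hgap : amp x (S + 1) < amp x S) {i : Fin K} (hi : i ∈ topSet S x) : amp x S ≤ |x i| := by
  set j := (Tuple.sort fun i => -|x i|).symm i with hj
  have h := mem_topSet_sort hS hSK hgap j
  rw [hj, Equiv.apply_symm_apply, ← hj] at h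
  have hjS := h.1 hi
  obtain ⟨S', rfl⟩ : ∃ S', S = S' + 1 := ⟨S - 1, by omega⟩
  rw [amp_of_lt x (by omega)]
  have h2 : rearr x ⟨S', by omega⟩ ≤ rearr x j :=
    rearr_antitone x (by simp [Fin.le_def]; omega)
  rwa [rearr, rearr, hj, Equiv.apply_symm_apply] at h2

lemma le_amp_of_notMem_topSet {S : ℕ} (hS : 1 ≤ S) (hSK : S < K) {x : EuclideanSpace ℝ (Fin K)}
    (hgap : amp x (S + 1) < amp x S) {i : Fin K} (hi : i ∉ topSet S x) :
    |x i| ≤ amp x (S + 1) := by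
  set j := (Tuple.sort fun i => -|x i|).symm i with hj
  have h := mem_topSet_sort hS hSK hgap j
  rw [hj, Equiv.apply_symm_apply, ← hj] at h
  have hjS := mt h.2 hi
  rw [amp_of_lt x hSK]
  have h2 : rearr x j ≤ rearr x ⟨S, hSK⟩ :=
    rearr_antitone x (by simp [Fin.le_def]; omega)
  rwa [rearr, hj, Equiv.apply_symm_apply] at h2

/-- The hypothesis is needed since `Real.sign 0 = 0`; the gap supplies it later. -/
lemma abs_topSign {S : ℕ} {x : EuclideanSpace ℝ (Fin K)} {i : Fin K}
    (h : i ∈ topSet S x → x i ≠ 0) : |topSign S x i| = if i ∈ topSet S x then 1 else 0 := by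
  rw [topSign]
  split_ifs with hi
  · rcases (h hi).lt_or_gt with h | h
    · simp [Real.sign_of_neg h]
    · simp [Real.sign_of_pos h]
  · simp

lemma abs_topSign_le (S : ℕ) (x : EuclideanSpace ℝ (Fin K)) (i : Fin K) : |topSign S x i| ≤ 1 := by
  rw [topSign]
  split_ifs
  · rcases Real.sign_apply_eq (x i) with h | h | h <;> simp [h]
  · simp

end TopSet

/-! ### Nets of bounded sets in finite dimension. -/

section Net

open Metric Module

variable {E : Type*} [NormedAddCommGroup E] [NormedSpace ℝ E] [FiniteDimensional ℝ E]

open scoped Function in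
-- Volume comparison: the balls of radius `δ / 2` around the points are disjoint and lie in a ball
-- of radius `R + δ / 2`.
lemma card_le_of_separated_of_subset_closedBall {x : E} {R δ : ℝ} (hR : 0 ≤ R) (hδ : 0 < δ)
    (s : Finset E) (hs : ∀ c ∈ s, ‖c - x‖ ≤ R) (h : ∀ c ∈ s, ∀ c' ∈ s, c ≠ c' → δ ≤ ‖c - c'‖) :
    (s.card : ℝ) ≤ (1 + 2 * R / δ) ^ finrank ℝ E := by
  borelize E
  let μ : Measure E := Measure.addHaar
  set ρ : ℝ := R + δ / 2 with hρ
  have hδ2 : 0 < δ / 2 := by positivity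
  have ρpos : 0 < ρ := by positivity
  set A := ⋃ c ∈ s, ball (c : E) (δ / 2) with hA
  have D : Set.Pairwise (s : Set E) (Disjoint on fun c => ball (c : E) (δ / 2)) := by
    rintro c hc c' hc' hcd
    apply ball_disjoint_ball
    rw [dist_eq_norm]
    linarith [h c hc c' hc' hcd]
  have A_subset : A ⊆ ball x ρ := by
    refine Set.iUnion₂_subset fun c hc => ball_subset_ball' ?_
    rw [dist_eq_norm]
    linarith [hs c hc]
  have I : (s.card : ℝ≥0∞) * ENNReal.ofReal ((δ / 2) ^ finrank ℝ E) * μ (ball 0 1) ≤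
      ENNReal.ofReal (ρ ^ finrank ℝ E) * μ (ball 0 1) :=
    calc
      (s.card : ℝ≥0∞) * ENNReal.ofReal ((δ / 2) ^ finrank ℝ E) * μ (ball 0 1) = μ A := by
        rw [hA, measure_biUnion_finset D fun c _ => measurableSet_ball]
        simp only [μ.addHaar_ball_of_pos _ hδ2]
        simp only [Finset.sum_const, nsmul_eq_mul, mul_assoc]
      _ ≤ μ (ball x ρ) := measure_mono A_subset
      _ = ENNReal.ofReal (ρ ^ finrank ℝ E) * μ (ball 0 1) := by
        simp only [μ.addHaar_ball_of_pos _ ρpos]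
  have J : (s.card : ℝ≥0∞) * ENNReal.ofReal ((δ / 2) ^ finrank ℝ E) ≤
      ENNReal.ofReal (ρ ^ finrank ℝ E) :=
    (ENNReal.mul_le_mul_iff_left (measure_ball_pos _ _ zero_lt_one).ne' measure_ball_lt_top.ne).1 I
  have := ENNReal.toReal_le_of_le_ofReal (pow_nonneg ρpos.le _) J
  rw [ENNReal.toReal_mul, ENNReal.toReal_natCast, ENNReal.toReal_ofReal (by positivity)] at this
  have h2 : (1 + 2 * R / δ) = ρ / (δ / 2) := by rw [hρ]; field_simp; ring
  rw [h2, div_pow, le_div_iff₀ (by positivity)]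
  exact this

/-- A separated subset of maximal cardinality is a net. Its points lie in `T` itself, which matters
because the probabilistic estimate holds only for dictionaries on the sphere. -/
lemma exists_finset_net {x : E} {R δ : ℝ} (hR : 0 ≤ R) (hδ : 0 < δ) {T : Set E}
    (hT : ∀ c ∈ T, ‖c - x‖ ≤ R) :
    ∃ s : Finset E, (∀ c ∈ s, c ∈ T) ∧ (s.card : ℝ) ≤ (1 + 2 * R / δ) ^ finrank ℝ E ∧
      ∀ c ∈ T, ∃ c' ∈ s, ‖c - c'‖ < δ := by
  classical
  let N : Set ℕ := {n | ∃ s : Finset E, s.card = n ∧ (∀ c ∈ s, c ∈ T) ∧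
    ∀ c ∈ s, ∀ c' ∈ s, c ≠ c' → δ ≤ ‖c - c'‖}
  have hne : N.Nonempty := ⟨0, ∅, by simp⟩
  have hbdd : BddAbove N := by
    refine ⟨⌊(1 + 2 * R / δ) ^ finrank ℝ E⌋₊, ?_⟩
    rintro _ ⟨s, rfl, h1, h2⟩
    exact Nat.le_floor (card_le_of_separated_of_subset_closedBall hR hδ s
      (fun c hc => hT c (h1 c hc)) h2)
  obtain ⟨s, hs, h1, h2⟩ := Nat.sSup_mem hne hbdd
  refine ⟨s, h1, card_le_of_separated_of_subset_closedBall hR hδ s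
    (fun c hc => hT c (h1 c hc)) h2, fun c hc => ?_⟩
  by_contra! hcon
  have hcs : c ∉ s := fun h => by simpa using (hcon c h).trans_lt' hδ
  have hmem : (insert c s).card ∈ N := by
    refine ⟨insert c s, rfl, ?_, ?_⟩
    · simp only [Finset.mem_insert]
      rintro z (rfl | hz)
      exacts [hc, h1 z hz]
    · simp only [Finset.mem_insert]
      rintro z (rfl | hz) w (rfl | hw) hzw
      · exact absurd rfl hzw
      · exact hcon w hw
      · rw [← neg_sub, norm_neg]; exact hcon z hz
      · exact h2 z hz w hw hzw
  have := le_csSup hbdd hmem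
  rw [Finset.card_insert_of_notMem hcs] at this
  omega

end Net

/-! ### Elementary inequalities for exponentials. -/

section RealBounds

/-- The Taylor bound behind the Bernstein estimate: it charges only the exponentially weighted
second moment, not the range of the variable. -/
lemma exp_le_one_add_add_sq (u : ℝ) : Real.exp u ≤ 1 + u + u ^ 2 / 2 * Real.exp |u| := by
  rcases le_total 0 u with hu | hu
  · have hmono : Monotone fun u : ℝ => u ^ 2 / 2 + (1 + u) * Real.exp (-u) := by
      refine monotone_of_deriv_nonneg (by fun_prop) fun v => ?_
      have hd : HasDerivAt (fun u : ℝ => u ^ 2 / 2 + (1 + u) * Real.exp (-u))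
          (v * (1 - Real.exp (-v))) v := by
        have h1 := ((hasDerivAt_id v).pow 2).div_const 2
        have h2 := ((hasDerivAt_id v).const_add 1).mul (hasDerivAt_id v).neg.exp
        refine (h1.add h2).congr_deriv ?_
        simp only [id_eq, Pi.neg_apply]
        ring
      rw [hd.deriv]
      rcases le_total 0 v with h | h
      · exact mul_nonneg h (by simpa using h)
      · exact mul_nonneg_of_nonpos_of_nonpos h (by simpa using h)
    have h := hmono hu
    simp only [ne_eq, OfNat.ofNat_ne_zero, not_false_eq_true, zero_pow, zero_div, add_zero,
      neg_zero, Real.exp_zero, mul_one, zero_add] at h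
    rw [abs_of_nonneg hu]
    have h2 := mul_le_mul_of_nonneg_right h (Real.exp_pos u).le
    rw [add_mul, mul_assoc (1 + u), ← Real.exp_add, neg_add_cancel, Real.exp_zero] at h2
    linarith
  · have hmono : Monotone fun v : ℝ => 1 - v + v ^ 2 / 2 - Real.exp (-v) := by
      refine monotone_of_deriv_nonneg (by fun_prop) fun v => ?_
      have hd : HasDerivAt (fun v : ℝ => 1 - v + v ^ 2 / 2 - Real.exp (-v))
          (-1 + v + Real.exp (-v)) v := by
        have h1 := ((hasDerivAt_id v).const_sub 1).add (((hasDerivAt_id v).pow 2).div_const 2)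
        refine (h1.sub (hasDerivAt_id v).neg.exp).congr_deriv ?_
        simp only [id_eq, Pi.neg_apply]
        ring
      rw [hd.deriv]
      linarith [Real.add_one_le_exp (-v)]
    have h := hmono (neg_nonneg.2 hu)
    simp only [neg_zero, sub_zero, ne_eq, OfNat.ofNat_ne_zero, not_false_eq_true, zero_pow,
      zero_div, add_zero, Real.exp_zero, sub_self, neg_neg] at h
    have h3 : u ^ 2 / 2 * 1 ≤ u ^ 2 / 2 * Real.exp |u| := by
      gcongr; simp
    nlinarith

lemma sq_div_two_le_cosh_sub_one (x : ℝ) : x ^ 2 / 2 ≤ Real.cosh x - 1 := by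
  rw [← Real.cosh_abs, ← sq_abs]
  have h := Real.cosh_sq (|x| / 2)
  have h1 := Real.cosh_two_mul (|x| / 2)
  have h2 : |x| / 2 ≤ Real.sinh (|x| / 2) := Real.self_le_sinh_iff.2 (by positivity)
  have h3 : (|x| / 2) ^ 2 ≤ Real.sinh (|x| / 2) ^ 2 := by gcongr
  rw [mul_div_cancel₀ _ two_ne_zero] at h1
  linarith

lemma exp_abs_le_two_mul_cosh (x : ℝ) : Real.exp |x| ≤ 2 * Real.cosh x := by
  rw [← Real.cosh_abs, Real.cosh_eq]
  linarith [Real.exp_pos (-|x|)]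

/-- A quadratic Laplace transform bound with an error that charges only large values. -/
lemma exp_neg_four_mul_sq_le {κ : ℝ} (hκ : 1 ≤ κ) (x : ℝ) :
    Real.exp (-(4 * x ^ 2)) ≤
      1 - 3 * x ^ 2 + 12 * Real.exp (-((κ - 1) / 3)) * Real.cosh (κ * x) := by
  have hpos : 0 ≤ 12 * Real.exp (-((κ - 1) / 3)) * Real.cosh (κ * x) := by
    have := (Real.cosh_pos (κ * x)).le
    positivity
  -- Near zero the quadratic bound holds without the error term. Otherwise `|x| ≥ 1 / 3`, so `exp
  -- |x|` is at most `exp (-(κ - 1) / 3) * exp (κ |x|)`, and the error term absorbs everything.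
  rcases le_total (x ^ 2) (1 / 8) with hx | hx
  · have h := exp_le_one_add_add_sq (4 * x ^ 2)
    have h1 : Real.exp (-(4 * x ^ 2)) ≤ 1 - 3 * x ^ 2 := by
      rw [Real.exp_neg]
      refine inv_le_of_inv_le₀ (by nlinarith) ?_
      have h2 := Real.quadratic_le_exp_of_nonneg (x := 4 * x ^ 2) (by positivity)
      refine le_trans ?_ h2
      rw [inv_le_iff_one_le_mul₀ (by nlinarith)]
      nlinarith [sq_nonneg x, mul_nonneg (sq_nonneg x) (sub_nonneg.2 hx)]
    linarith
  · have h1 : Real.exp (-(4 * x ^ 2)) ≤ 1 := by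
      rw [Real.exp_le_one_iff]; nlinarith
    have hax : 1 / 3 ≤ |x| := by
      by_contra! hcon
      have : x ^ 2 < (1 / 3) ^ 2 := sq_lt_sq' (by linarith [neg_abs_le x]) (by linarith [le_abs_self x])
      norm_num at this
      linarith
    have h2 : 3 * x ^ 2 ≤ 6 * Real.exp |x| := by
      have := Real.quadratic_le_exp_of_nonneg (abs_nonneg x)
      rw [sq_abs] at this
      linarith [abs_nonneg x]
    have h3 : Real.exp |κ * x| ≤ 2 * Real.cosh (κ * x) := exp_abs_le_two_mul_cosh _
    have h4 : Real.exp |x| ≤ Real.exp (-((κ - 1) / 3)) * Real.exp |κ * x| := by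
      rw [← Real.exp_add, Real.exp_le_exp, abs_mul, abs_of_nonneg (by linarith : (0:ℝ) ≤ κ)]
      nlinarith
    have h5 : Real.exp (-((κ - 1) / 3)) * Real.exp |κ * x| ≤
        Real.exp (-((κ - 1) / 3)) * (2 * Real.cosh (κ * x)) := by gcongr
    nlinarith

/-- For `|z| ≥ 1` the left side is at most `2 exp (2 |z|)`; raising the rate from `2` to `κ` gains
the factor `exp (3 - κ)`, which is tiny for large `κ`. -/
lemma sq_mul_exp_le_of_one_le {κ z : ℝ} (hκ : 3 ≤ κ) (hz : 1 ≤ |z|) :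
    z ^ 2 * Real.exp |z| ≤ 4 * Real.exp (3 - κ) * Real.cosh (κ * z) := by
  have h1 : z ^ 2 ≤ 2 * Real.exp (|z|) := by
    have := Real.quadratic_le_exp_of_nonneg (abs_nonneg z)
    rw [sq_abs] at this
    linarith [abs_nonneg z]
  have h3 : Real.exp |κ * z| ≤ 2 * Real.cosh (κ * z) := exp_abs_le_two_mul_cosh _
  calc z ^ 2 * Real.exp |z| ≤ 2 * Real.exp |z| * Real.exp |z| := by gcongr
    _ = 2 * Real.exp (|z| + |z|) := by rw [Real.exp_add]; ring
    _ ≤ 2 * Real.exp ((3 - κ) + |κ * z|) := by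
        refine mul_le_mul_of_nonneg_left (Real.exp_le_exp.2 ?_) (by norm_num)
        rw [abs_mul, abs_of_nonneg (by linarith : (0:ℝ) ≤ κ)]
        nlinarith
    _ = 2 * Real.exp (3 - κ) * Real.exp |κ * z| := by rw [Real.exp_add]; ring
    _ ≤ 2 * Real.exp (3 - κ) * (2 * Real.cosh (κ * z)) := by gcongr
    _ = _ := by ring

/-- The tangent line of `z ↦ 1 / √z` lies below the graph. -/
lemma one_div_sqrt_tangent_le {a b : ℝ} (ha : 0 < a) (hb : 0 < b) :
    1 / √a * (3 / 2 - b / (2 * a)) ≤ 1 / √b := by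
  obtain ⟨p, hp, rfl⟩ : ∃ p, 0 < p ∧ p ^ 2 = a := ⟨√a, Real.sqrt_pos.2 ha, Real.sq_sqrt ha.le⟩
  obtain ⟨q, hq, rfl⟩ : ∃ q, 0 < q ∧ q ^ 2 = b := ⟨√b, Real.sqrt_pos.2 hb, Real.sq_sqrt hb.le⟩
  rw [Real.sqrt_sq hp.le, Real.sqrt_sq hq.le]
  have h : 1 / q - 1 / p * (3 / 2 - q ^ 2 / (2 * p ^ 2)) =
      (p - q) ^ 2 * (2 * p + q) / (2 * p ^ 3 * q) := by
    field_simp; ring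
  have h2 : 0 ≤ (p - q) ^ 2 * (2 * p + q) / (2 * p ^ 3 * q) := by positivity
  linarith

end RealBounds

/-! ### Consequences of sign and permutation symmetry of the coefficients. -/

section Coefficients

variable {K S : ℕ} {ν : Measure (EuclideanSpace ℝ (Fin K))}

lemma IsSymmetricOnSphere.ae_norm_eq_one (hν : IsSymmetricOnSphere ν) : ∀ᵐ x ∂ν, ‖x‖ = 1 := by
  have := hν.prob
  have h := (prob_compl_eq_zero_iff (μ := ν) Metric.isClosed_sphere.measurableSet).2 hν.sphere
  refine measure_mono_null (fun x hx => ?_) h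
  simpa using hx

lemma abs_apply_le_norm (x : EuclideanSpace ℝ (Fin K)) (i : Fin K) : |x i| ≤ ‖x‖ :=
  PiLp.norm_apply_le x i

/-- Turns the symmetry assumptions, stated for images of measurable subsets of the sphere, into
measure preservation: the preimage under `f` is the image under its inverse `g`, and the complement
of `s` is null. -/
lemma measurePreserving_of_image {X : Type*} [MeasurableSpace X] {μ : Measure X} {s : Set X}
    (hs : MeasurableSet s) (hμ : μ sᶜ = 0) {f g : X → X} (hf : Measurable f)
    (hgf : ∀ x, g (f x) = x) (hfg : ∀ x, f (g x) = x) (hgs : ∀ x ∈ s, g x ∈ s)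
    (h : ∀ A, MeasurableSet A → A ⊆ s → μ (g '' A) = μ A) (hfs : ∀ x ∈ s, f x ∈ s) :
    MeasurePreserving f μ μ := by
  refine ⟨hf, ?_⟩
  ext A hA
  rw [Measure.map_apply hf hA]
  have hinter : ∀ B : Set X, μ B = μ (B ∩ s) := fun B =>
    le_antisymm (by
      calc μ B ≤ μ ((B ∩ s) ∪ sᶜ) := measure_mono fun x hx => by
            by_cases hxs : x ∈ s
            exacts [Or.inl ⟨hx, hxs⟩, Or.inr hxs]
        _ ≤ μ (B ∩ s) + μ sᶜ := measure_union_le _ _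
        _ = μ (B ∩ s) := by rw [hμ, add_zero]) (measure_mono Set.inter_subset_left)
  rw [hinter A, ← h _ (hA.inter hs) Set.inter_subset_right, hinter (f ⁻¹' A)]
  congr 1
  ext x
  constructor
  · rintro ⟨hx, hxs⟩
    exact ⟨f x, ⟨hx, hfs x hxs⟩, hgf x⟩
  · rintro ⟨y, ⟨hy, hys⟩, rfl⟩
    exact ⟨by simpa [hfg] using hy, hgs y hys⟩

/-- Multiplication of the coordinates by given factors. -/
def signFlip (σ : Fin K → ℝ) (x : EuclideanSpace ℝ (Fin K)) : EuclideanSpace ℝ (Fin K) :=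
  WithLp.toLp 2 fun i => σ i * x i

/-- Permutation of the coordinates. -/
def permute (p : Equiv.Perm (Fin K)) (x : EuclideanSpace ℝ (Fin K)) :
    EuclideanSpace ℝ (Fin K) :=
  WithLp.toLp 2 fun i => x (p i)

@[simp] lemma signFlip_apply (σ : Fin K → ℝ) (x : EuclideanSpace ℝ (Fin K)) (i : Fin K) :
    signFlip σ x i = σ i * x i := rfl

@[simp] lemma permute_apply (p : Equiv.Perm (Fin K)) (x : EuclideanSpace ℝ (Fin K)) (i : Fin K) :
    permute p x i = x (p i) := rfl

lemma measurable_signFlip (σ : Fin K → ℝ) : Measurable (signFlip σ) := by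
  unfold signFlip; fun_prop

lemma measurable_permute (p : Equiv.Perm (Fin K)) : Measurable (permute p) := by
  unfold permute; fun_prop

lemma norm_signFlip {σ : Fin K → ℝ} (hσ : ∀ i, σ i = 1 ∨ σ i = -1)
    (x : EuclideanSpace ℝ (Fin K)) : ‖signFlip σ x‖ = ‖x‖ := by
  rw [EuclideanSpace.norm_eq, EuclideanSpace.norm_eq]
  congr 1
  refine Finset.sum_congr rfl fun i _ => ?_
  rcases hσ i with h | h <;> simp [h]

lemma norm_permute (p : Equiv.Perm (Fin K)) (x : EuclideanSpace ℝ (Fin K)) :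
    ‖permute p x‖ = ‖x‖ := by
  rw [EuclideanSpace.norm_eq, EuclideanSpace.norm_eq]
  congr 1
  exact Equiv.sum_comp p fun i => ‖x i‖ ^ 2

lemma IsSymmetricOnSphere.measurePreserving_signFlip (hν : IsSymmetricOnSphere ν)
    {σ : Fin K → ℝ} (hσ : ∀ i, σ i = 1 ∨ σ i = -1) : MeasurePreserving (signFlip σ) ν ν := by
  have := hν.prob
  have hinv : ∀ x, signFlip σ (signFlip σ x) = x := fun x => by
    ext i; rcases hσ i with h | h <;> simp [h]
  have hs : ∀ x ∈ Metric.sphere (0 : EuclideanSpace ℝ (Fin K)) 1,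
      signFlip σ x ∈ Metric.sphere (0 : EuclideanSpace ℝ (Fin K)) 1 := fun x hx => by
    simpa [norm_signFlip hσ] using hx
  exact measurePreserving_of_image Metric.isClosed_sphere.measurableSet
    ((prob_compl_eq_zero_iff Metric.isClosed_sphere.measurableSet).2 hν.sphere)
    (measurable_signFlip σ) hinv hinv hs (fun A hA hAs => hν.sign A hA hAs σ hσ) hs

lemma IsSymmetricOnSphere.measurePreserving_permute (hν : IsSymmetricOnSphere ν)
    (p : Equiv.Perm (Fin K)) : MeasurePreserving (permute p) ν ν := by
  have := hν.prob
  have hs : ∀ p : Equiv.Perm (Fin K), ∀ x ∈ Metric.sphere (0 : EuclideanSpace ℝ (Fin K)) 1,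
      permute p x ∈ Metric.sphere (0 : EuclideanSpace ℝ (Fin K)) 1 := fun p x hx => by
    simpa [norm_permute] using hx
  exact measurePreserving_of_image Metric.isClosed_sphere.measurableSet
    ((prob_compl_eq_zero_iff Metric.isClosed_sphere.measurableSet).2 hν.sphere)
    (measurable_permute p) (g := permute p.symm) (fun x => by ext i; simp)
    (fun x => by ext i; simp) (hs _) (fun A hA hAs => hν.perm A hA hAs p.symm) (hs _)

lemma integral_comp_of_measurePreserving {X : Type*} [MeasurableSpace X] {μ : Measure X}
    {φ : X → X} (h : MeasurePreserving φ μ μ) {f : X → ℝ} (hf : AEStronglyMeasurable f μ) :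
    ∫ x, f (φ x) ∂μ = ∫ x, f x ∂μ := by
  conv_rhs => rw [← h.map_eq]
  rw [integral_map h.measurable.aemeasurable (by rwa [h.map_eq])]

lemma mem_topSet {x : EuclideanSpace ℝ (Fin K)} {i : Fin K} :
    i ∈ topSet S x ↔ (Finset.univ.filter fun j => |x i| < |x j|).card < S := by
  simp [topSet]

lemma measurableSet_mem_topSet (i : Fin K) : MeasurableSet {x | i ∈ topSet S x} := by
  have h : {x | i ∈ topSet S x} = {x : EuclideanSpace ℝ (Fin K) |
      (∑ j, if |x i| < |x j| then 1 else 0) < S} := by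
    ext x
    simp only [Set.mem_ofPred_eq, mem_topSet]
    rw [Finset.card_filter]
  rw [h]
  refine measurableSet_lt ?_ measurable_const
  refine Finset.measurable_sum _ fun j _ => ?_
  refine Measurable.ite (measurableSet_lt ?_ ?_) measurable_const measurable_const <;> fun_prop

lemma measurable_real_sign : Measurable Real.sign := by
  have : Real.sign = fun r : ℝ => if r < 0 then -1 else if 0 < r then 1 else 0 := by
    funext r; rfl
  rw [this]
  exact Measurable.ite measurableSet_Iio measurable_const
    (Measurable.ite measurableSet_Ioi measurable_const measurable_const)

lemma measurable_topSign (i : Fin K) : Measurable fun x => topSign S x i := by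
  unfold topSign
  refine Measurable.ite (measurableSet_mem_topSet i) ?_ measurable_const
  exact measurable_real_sign.comp (by fun_prop)

lemma topSet_signFlip {σ : Fin K → ℝ} (hσ : ∀ i, σ i = 1 ∨ σ i = -1)
    (x : EuclideanSpace ℝ (Fin K)) : topSet S (signFlip σ x) = topSet S x := by
  have h : ∀ i, |σ i| = 1 := fun i => by rcases hσ i with h | h <;> simp [h]
  simp [topSet, abs_mul, h]

/-- Counting strictly larger entries commutes with permutations, whereas the sorting permutation
breaks ties by index and would not. -/
lemma mem_topSet_permute (p : Equiv.Perm (Fin K)) (x : EuclideanSpace ℝ (Fin K)) (i : Fin K) :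
    i ∈ topSet S (permute p x) ↔ p i ∈ topSet S x := by
  rw [mem_topSet, mem_topSet]
  have : (Finset.univ.filter fun j => |permute p x i| < |permute p x j|).card =
      (Finset.univ.filter fun j => |x (p i)| < |x j|).card := by
    refine Finset.card_bij (fun j _ => p j) ?_ ?_ ?_
    · intro j hj
      exact Finset.mem_filter.2 ⟨Finset.mem_univ _, (Finset.mem_filter.1 hj).2⟩
    · intro a _ b _ h; exact p.injective h
    · intro b hb
      refine ⟨p.symm b, Finset.mem_filter.2 ⟨Finset.mem_univ _, ?_⟩, by simp⟩
      simpa using (Finset.mem_filter.1 hb).2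
  rw [this]

lemma topSign_permute (p : Equiv.Perm (Fin K)) (x : EuclideanSpace ℝ (Fin K)) (i : Fin K) :
    topSign S (permute p x) i = topSign S x (p i) := by
  simp [topSign, mem_topSet_permute]

lemma real_sign_mul (a b : ℝ) (ha : a = 1 ∨ a = -1) : Real.sign (a * b) = a * Real.sign b := by
  rcases ha with rfl | rfl
  · simp
  · simp [Real.sign_neg]

lemma topSign_signFlip {σ : Fin K → ℝ} (hσ : ∀ i, σ i = 1 ∨ σ i = -1)
    (x : EuclideanSpace ℝ (Fin K)) (i : Fin K) :
    topSign S (signFlip σ x) i = σ i * topSign S x i := by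
  simp only [topSign, topSet_signFlip hσ, signFlip_apply, real_sign_mul _ _ (hσ i)]
  split_ifs <;> simp

lemma topSign_mul_self (x : EuclideanSpace ℝ (Fin K)) (i : Fin K) :
    topSign S x i * x i = if i ∈ topSet S x then |x i| else 0 := by
  rw [topSign]
  split_ifs
  · rcases lt_trichotomy (x i) 0 with h | h | h
    · simp [Real.sign_of_neg h, abs_of_neg h]
    · simp [h]
    · simp [Real.sign_of_pos h, abs_of_pos h]
  · simp

lemma integrable_topSign [IsFiniteMeasure ν] (i : Fin K) :
    Integrable (fun x => topSign S x i) ν :=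
  Integrable.of_bound (measurable_topSign i).aestronglyMeasurable 1
    (.of_forall fun x => abs_topSign_le S x i)

lemma IsSymmetricOnSphere.integrable_topSign_mul (hν : IsSymmetricOnSphere ν) (i k : Fin K) :
    Integrable (fun x => topSign S x i * x k) ν := by
  have := hν.prob
  refine Integrable.of_bound (((measurable_topSign i).mul (by fun_prop)).aestronglyMeasurable) 1 ?_
  filter_upwards [hν.ae_norm_eq_one] with x hx
  rw [Real.norm_eq_abs, abs_mul]
  have h1 := abs_topSign_le S x i
  have h2 := abs_apply_le_norm x k
  rw [hx] at h2
  nlinarith [abs_nonneg (topSign S x i), abs_nonneg (x k)]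

/-- Flipping all signs negates the integrand. -/
lemma IsSymmetricOnSphere.integral_topSign (hν : IsSymmetricOnSphere ν) (i : Fin K) :
    ∫ x, topSign S x i ∂ν = 0 := by
  have hσ : ∀ j : Fin K, (fun _ => (-1 : ℝ)) j = 1 ∨ (fun _ : Fin K => (-1 : ℝ)) j = -1 :=
    fun j => Or.inr rfl
  have h := integral_comp_of_measurePreserving (hν.measurePreserving_signFlip hσ)
    (f := fun x => topSign S x i) (measurable_topSign i).aestronglyMeasurable
  simp only [topSign_signFlip hσ, integral_const_mul] at h
  linarith

/-- Flipping the `i`-th sign alone negates the integrand, since `x k` is unaffected. -/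
lemma IsSymmetricOnSphere.integral_topSign_mul_of_ne (hν : IsSymmetricOnSphere ν) {i k : Fin K}
    (hik : k ≠ i) : ∫ x, topSign S x i * x k ∂ν = 0 := by
  have hσ : ∀ j : Fin K, (fun j => if j = i then (-1 : ℝ) else 1) j = 1 ∨
      (fun j => if j = i then (-1 : ℝ) else 1) j = -1 := fun j => by
    by_cases h : j = i <;> simp [h]
  have h := integral_comp_of_measurePreserving (hν.measurePreserving_signFlip hσ)
    (f := fun x => topSign S x i * x k)
    (((measurable_topSign i).mul (by fun_prop)).aestronglyMeasurable)
  simp only [topSign_signFlip hσ, signFlip_apply, if_neg hik, if_true, one_mul, neg_mul,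
    integral_neg] at h
  linarith

lemma measurable_amp (s : ℕ) : Measurable fun x : EuclideanSpace ℝ (Fin K) => amp x s := by
  unfold amp
  split_ifs with h
  -- The sorting permutation takes finitely many values, so the rearrangement is a finite sum over
  -- permutations of measurable pieces.
  · have hr : (fun x : EuclideanSpace ℝ (Fin K) => rearr x ⟨s - 1, by omega⟩) = fun x =>
        ∑ p : Equiv.Perm (Fin K), if p = Tuple.sort (fun i => -|x i|) then
          |x (p ⟨s - 1, by omega⟩)| else 0 := by
      funext x
      simp [rearr]
    rw [hr]
    refine Finset.measurable_sum _ fun p _ => Measurable.ite ?_ (by fun_prop) measurable_const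
    simp only [Tuple.eq_sort_iff]
    have h1 : MeasurableSet {x : EuclideanSpace ℝ (Fin K) |
        Monotone ((fun i => -|x i|) ∘ p)} := by
      simp only [Monotone, Set.ofPred_forall, Function.comp]
      refine MeasurableSet.iInter fun i => MeasurableSet.iInter fun j =>
        MeasurableSet.iInter fun _ => measurableSet_le ?_ ?_ <;> fun_prop
    have h2 : MeasurableSet {x : EuclideanSpace ℝ (Fin K) |
        ∀ i j, i < j → ((fun i => -|x i|) (p i) = (fun i => -|x i|) (p j)) → p i < p j} := by
      simp only [Set.ofPred_forall]
      refine MeasurableSet.iInter fun i => MeasurableSet.iInter fun j =>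
        MeasurableSet.iInter fun _ => ?_
      have : MeasurableSet {x : EuclideanSpace ℝ (Fin K) | -|x (p i)| = -|x (p j)|} :=
        measurableSet_eq_fun (by fun_prop) (by fun_prop)
      exact this.imp (MeasurableSet.const _)
    exact h1.inter h2
  · exact measurable_const

lemma rearr_le_norm (x : EuclideanSpace ℝ (Fin K)) (j : Fin K) : rearr x j ≤ ‖x‖ :=
  abs_apply_le_norm x _

lemma amp_nonneg (x : EuclideanSpace ℝ (Fin K)) (s : ℕ) : 0 ≤ amp x s := by
  unfold amp; split_ifs
  exacts [abs_nonneg _, le_rfl]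

lemma amp_le_norm (x : EuclideanSpace ℝ (Fin K)) (s : ℕ) : amp x s ≤ ‖x‖ := by
  unfold amp; split_ifs
  exacts [rearr_le_norm _ _, norm_nonneg _]

lemma amp_antitone_of_le {x : EuclideanSpace ℝ (Fin K)} {s t : ℕ} (hs : 1 ≤ s) (hst : s ≤ t) :
    amp x t ≤ amp x s := by
  unfold amp
  split_ifs with h1 h2 h2
  · exact rearr_antitone x (by simp [Fin.le_def]; omega)
  · omega
  · exact abs_nonneg _
  · exact le_rfl

lemma IsSymmetricOnSphere.integrable_amp (hν : IsSymmetricOnSphere ν) (s : ℕ) :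
    Integrable (fun x => amp x s) ν := by
  have := hν.prob
  refine Integrable.of_bound (measurable_amp s).aestronglyMeasurable 1 ?_
  filter_upwards [hν.ae_norm_eq_one] with x hx
  rw [Real.norm_of_nonneg (amp_nonneg x s), ← hx]
  exact amp_le_norm x s

lemma IsSymmetricOnSphere.ampSum_le (hν : IsSymmetricOnSphere ν) : ampSum ν S ≤ S := by
  have := hν.prob
  calc ampSum ν S ≤ ∑ s ∈ Finset.Icc 1 S, (1 : ℝ) := by
        refine Finset.sum_le_sum fun s _ => ?_
        calc ∫ x, amp x s ∂ν ≤ ∫ _, (1 : ℝ) ∂ν := by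
              refine integral_mono_ae (hν.integrable_amp s) (integrable_const _) ?_
              filter_upwards [hν.ae_norm_eq_one] with x hx
              rw [← hx]; exact amp_le_norm x s
          _ = 1 := by simp
    _ = S := by simp

variable {β : ℝ}

lemma IsSymmetricOnSphere.mul_le_ampSum (hν : IsSymmetricOnSphere ν)
    (hgap : ∀ᵐ z ∂ν, β ≤ amp z S - amp z (S + 1)) : S * β ≤ ampSum ν S := by
  have := hν.prob
  calc S * β = ∑ s ∈ Finset.Icc 1 S, β := by simp
    _ ≤ ampSum ν S := by
        refine Finset.sum_le_sum fun s hs => ?_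
        rw [Finset.mem_Icc] at hs
        calc β = ∫ _, β ∂ν := by simp
          _ ≤ ∫ x, amp x s ∂ν := by
              refine integral_mono_ae (integrable_const _) (hν.integrable_amp s) ?_
              filter_upwards [hgap] with x hx
              have h1 := amp_nonneg x (S + 1)
              have h2 := amp_antitone_of_le (x := x) hs.1 hs.2
              linarith

lemma IsSymmetricOnSphere.gap_le_one (hν : IsSymmetricOnSphere ν)
    (hgap : ∀ᵐ z ∂ν, β ≤ amp z S - amp z (S + 1)) : β ≤ 1 := by
  have := hν.prob
  obtain ⟨x, hx, h⟩ := (hν.ae_norm_eq_one.and hgap).exists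
  have h1 := amp_nonneg x (S + 1)
  have h2 := amp_le_norm x S
  linarith

/-- By exchangeability all `K` integrals agree, and their sum is the mean of the sum of the `S`
largest amplitudes. The same argument gives the activity probability `S / K` in the next lemma. -/
lemma IsSymmetricOnSphere.integral_topSign_mul_self (hS : 1 ≤ S) (hSK : S < K) (hβ : 0 < β)
    (hν : IsSymmetricOnSphere ν)
    (hgap : ∀ᵐ z ∂ν, β ≤ amp z S - amp z (S + 1)) (i : Fin K) :
    ∫ x, topSign S x i * x i ∂ν = ampSum ν S / K := by
  have hconst : ∀ j : Fin K, ∫ x, topSign S x j * x j ∂ν = ∫ x, topSign S x i * x i ∂ν := by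
    intro j
    have h := integral_comp_of_measurePreserving
      (hν.measurePreserving_permute (Equiv.swap i j)) (f := fun x => topSign S x i * x i)
      (hν.integrable_topSign_mul i i).aestronglyMeasurable
    simpa [topSign_permute] using h
  have hsum : ∑ j : Fin K, ∫ x, topSign S x j * x j ∂ν = ampSum ν S := by
    rw [← integral_finsetSum _ fun j _ => hν.integrable_topSign_mul j j, ampSum,
      ← integral_finsetSum _ fun s _ => hν.integrable_amp s]
    refine integral_congr_ae ?_
    filter_upwards [hgap] with x hx
    rw [← sum_topSet hS hSK (by linarith)]
    simp [topSign_mul_self]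
  rw [Finset.sum_congr rfl fun j _ => hconst j] at hsum
  have hK : (K : ℝ) ≠ 0 := by
    have : 0 < K := by omega
    positivity
  rw [eq_div_iff hK, ← hsum]
  simp [mul_comm]

lemma IsSymmetricOnSphere.integral_abs_topSign (hS : 1 ≤ S) (hSK : S < K) (hβ : 0 < β)
    (hν : IsSymmetricOnSphere ν)
    (hgap : ∀ᵐ z ∂ν, β ≤ amp z S - amp z (S + 1)) (i : Fin K) :
    ∫ x, |topSign S x i| ∂ν = S / K := by
  have := hν.prob
  have hconst : ∀ j : Fin K, ∫ x, |topSign S x j| ∂ν = ∫ x, |topSign S x i| ∂ν := by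
    intro j
    have h := integral_comp_of_measurePreserving
      (hν.measurePreserving_permute (Equiv.swap i j)) (f := fun x => |topSign S x i|)
      (integrable_topSign i).abs.aestronglyMeasurable
    simpa [topSign_permute] using h
  have hsum : ∑ j : Fin K, ∫ x, |topSign S x j| ∂ν = S := by
    rw [← integral_finsetSum _ fun j _ => (integrable_topSign j).abs]
    have : (fun x => ∑ j : Fin K, |topSign S x j|) =ᵐ[ν] fun _ => (S : ℝ) := by
      filter_upwards [hgap] with x hx
      have hlt : amp x (S + 1) < amp x S := by linarith
      have h1 : ∀ j ∈ topSet S x, x j ≠ 0 := fun j hj => by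
        have h1 := amp_le_of_mem_topSet hS hSK hlt hj
        have h2 := amp_nonneg x (S + 1)
        exact abs_pos.1 (by linarith)
      simp_rw [fun j => abs_topSign (h1 j)]
      simp [card_topSet hS hSK hlt]
    rw [integral_congr_ae this]
    simp
  rw [Finset.sum_congr rfl fun j _ => hconst j] at hsum
  have hK : (K : ℝ) ≠ 0 := by
    have : 0 < K := by omega
    positivity
  rw [eq_div_iff hK, ← hsum]
  simp [mul_comm]

lemma IsSymmetricOnSphere.integrable_exp_sum (hν : IsSymmetricOnSphere ν) (a : Fin K → ℝ) :
    Integrable (fun x => Real.exp (∑ k, a k * x k)) ν := by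
  have := hν.prob
  refine Integrable.of_bound (Measurable.aestronglyMeasurable (by fun_prop))
    (Real.exp (∑ k, |a k|)) ?_
  filter_upwards [hν.ae_norm_eq_one] with x hx
  rw [Real.norm_of_nonneg (Real.exp_pos _).le, Real.exp_le_exp]
  refine Finset.sum_le_sum fun k _ => ?_
  calc a k * x k ≤ |a k * x k| := le_abs_self _
    _ = |a k| * |x k| := abs_mul _ _
    _ ≤ |a k| * 1 := by
        gcongr
        rw [← hx]; exact abs_apply_le_norm x k
    _ = |a k| := mul_one _

/-- Linear forms of the coefficients are subgaussian. -/
lemma IsSymmetricOnSphere.integral_exp_sum_le (hν : IsSymmetricOnSphere ν) {a : Fin K → ℝ} {b : ℝ}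
    (ha : ∀ k, |a k| ≤ b) : ∫ x, Real.exp (∑ k, a k * x k) ∂ν ≤ Real.exp (b ^ 2 / 2) := by
  classical
  have := hν.prob
  -- Average over all `2 ^ K` sign patterns: expanding the product of two-term sums gives `2 ^ K`
  -- integrals that agree by symmetry. Each factor is a `cosh`, and `∑ x_k² = 1` makes the exponent
  -- depend only on the largest `|a k|`, which is where coherence enters.
  set T := Fintype.piFinset fun _ : Fin K => ({1, -1} : Finset ℝ) with hT
  have hcard : (T.card : ℝ) = 2 ^ K := by
    rw [hT, Fintype.card_piFinset]
    have : ({1, -1} : Finset ℝ).card = 2 := Finset.card_pair (by norm_num)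
    simp [this]
  have hflip : ∀ σ ∈ T, ∫ x, Real.exp (∑ k, a k * (σ k * x k)) ∂ν =
      ∫ x, Real.exp (∑ k, a k * x k) ∂ν := fun σ hσ => by
    have hσ' : ∀ i, σ i = 1 ∨ σ i = -1 := fun i => by
      simpa using Fintype.mem_piFinset.1 hσ i
    exact integral_comp_of_measurePreserving (hν.measurePreserving_signFlip hσ')
      (hν.integrable_exp_sum a).aestronglyMeasurable
  have hint : ∀ σ : Fin K → ℝ, Integrable (fun x => Real.exp (∑ k, a k * (σ k * x k))) ν :=
    fun σ => by simpa only [mul_assoc] using hν.integrable_exp_sum fun k => a k * σ k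
  have hsum : 2 ^ K * ∫ x, Real.exp (∑ k, a k * x k) ∂ν =
      ∫ x, ∏ k, ∑ s ∈ ({1, -1} : Finset ℝ), Real.exp (a k * (s * x k)) ∂ν := by
    simp_rw [Finset.prod_univ_sum, ← Real.exp_sum]
    rw [integral_finsetSum _ fun σ _ => hint σ, Finset.sum_congr rfl hflip, Finset.sum_const,
      nsmul_eq_mul, hcard]
  have hle : ∀ᵐ x ∂ν, ∏ k, ∑ s ∈ ({1, -1} : Finset ℝ), Real.exp (a k * (s * x k)) ≤
      2 ^ K * Real.exp (b ^ 2 / 2) := by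
    filter_upwards [hν.ae_norm_eq_one] with x hx
    calc ∏ k, ∑ s ∈ ({1, -1} : Finset ℝ), Real.exp (a k * (s * x k))
        ≤ ∏ k, 2 * Real.exp (b ^ 2 * x k ^ 2 / 2) := by
          refine Finset.prod_le_prod (fun k _ => Finset.sum_nonneg fun s _ => (Real.exp_pos _).le)
            fun k _ => ?_
          rw [Finset.sum_pair (by norm_num)]
          have h1 : Real.exp (a k * (1 * x k)) + Real.exp (a k * (-1 * x k)) =
              2 * Real.cosh (a k * x k) := by
            rw [Real.cosh_eq]; ring_nf
          rw [h1]
          gcongr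
          refine (Real.cosh_le_exp_half_sq _).trans (Real.exp_le_exp.2 ?_)
          rw [mul_pow]
          have h4 : a k ^ 2 ≤ b ^ 2 := sq_le_sq' (by linarith [neg_abs_le (a k), ha k])
            ((le_abs_self _).trans (ha k))
          gcongr
      _ = 2 ^ K * Real.exp (b ^ 2 / 2) := by
          rw [Finset.prod_mul_distrib, ← Real.exp_sum]
          have h2 : ∑ k, b ^ 2 * x k ^ 2 / 2 = b ^ 2 / 2 := by
            have h3 : ∑ k, x k ^ 2 = 1 := by
              have := EuclideanSpace.norm_sq_eq x
              rw [hx] at this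
              simpa using this.symm
            rw [← Finset.sum_div, ← Finset.mul_sum, h3, mul_one]
          rw [h2]
          simp
  have hmono : ∫ x, ∏ k, ∑ s ∈ ({1, -1} : Finset ℝ), Real.exp (a k * (s * x k)) ∂ν ≤
      2 ^ K * Real.exp (b ^ 2 / 2) := by
    calc _ ≤ ∫ _, 2 ^ K * Real.exp (b ^ 2 / 2) ∂ν := by
          refine integral_mono_ae ?_ (integrable_const _) hle
          simp_rw [Finset.prod_univ_sum, ← Real.exp_sum]
          exact integrable_finsetSum _ fun σ _ => hint σ
      _ = _ := by simp
  rw [← hsum] at hmono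
  exact le_of_mul_le_mul_left hmono (by positivity)

end Coefficients

/-! ### Subgaussian noise and its normalisation factor. -/

section Noise

variable {d : ℕ} {η : Measure (EuclideanSpace ℝ (Fin d))} {ρ : ℝ≥0}

/-- The normalisation factor of a noisy signal. -/
noncomputable def noiseScale (v : EuclideanSpace ℝ (Fin d)) : ℝ := 1 / √(1 + ‖v‖ ^ 2)

lemma noiseScale_pos (v : EuclideanSpace ℝ (Fin d)) : 0 < noiseScale v := by
  unfold noiseScale; positivity

lemma noiseScale_le_one (v : EuclideanSpace ℝ (Fin d)) : noiseScale v ≤ 1 := by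
  unfold noiseScale
  rw [div_le_one (by positivity)]
  exact Real.one_le_sqrt.2 (by nlinarith [sq_nonneg ‖v‖])

lemma noiseScale_mul_norm_le_one (v : EuclideanSpace ℝ (Fin d)) : noiseScale v * ‖v‖ ≤ 1 := by
  unfold noiseScale
  rw [one_div, ← div_eq_inv_mul, div_le_one (by positivity)]
  exact Real.le_sqrt_of_sq_le (by linarith)

lemma continuous_noiseScale : Continuous (noiseScale (d := d)) := by
  unfold noiseScale
  refine continuous_const.div (by fun_prop) fun v => ?_
  positivity

lemma integrable_noiseScale [IsFiniteMeasure η] : Integrable noiseScale η :=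
  Integrable.of_bound continuous_noiseScale.aestronglyMeasurable 1
    (.of_forall fun v => by
      rw [Real.norm_of_nonneg (noiseScale_pos v).le]; exact noiseScale_le_one v)

lemma noiseConst_eq : noiseConst η = ∫ v, noiseScale v ∂η := rfl

lemma noiseConst_le_one [IsProbabilityMeasure η] : noiseConst η ≤ 1 := by
  rw [noiseConst_eq]
  calc ∫ v, noiseScale v ∂η ≤ ∫ _, (1 : ℝ) ∂η :=
        integral_mono integrable_noiseScale (integrable_const _) noiseScale_le_one
    _ = 1 := by simp

lemma integrable_noiseScale_mul_inner [IsFiniteMeasure η] (u : EuclideanSpace ℝ (Fin d)) :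
    Integrable (fun v => noiseScale v * inner ℝ u v) η := by
  refine Integrable.of_bound (Continuous.aestronglyMeasurable
    (continuous_noiseScale.mul (by fun_prop))) ‖u‖ (.of_forall fun v => ?_)
  rw [norm_mul, Real.norm_of_nonneg (noiseScale_pos v).le]
  calc noiseScale v * ‖inner ℝ u v‖ ≤ noiseScale v * (‖u‖ * ‖v‖) := by
        gcongr
        exacts [(noiseScale_pos v).le, norm_inner_le_norm u v]
    _ = ‖u‖ * (noiseScale v * ‖v‖) := by ring
    _ ≤ ‖u‖ * 1 := by gcongr; exact noiseScale_mul_norm_le_one v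
    _ = ‖u‖ := mul_one _

lemma IsSubgaussianNoise.hasSubgaussianMGF_inner (hη : IsSubgaussianNoise η ρ)
    (u : EuclideanSpace ℝ (Fin d)) :
    HasSubgaussianMGF (fun v => inner ℝ u v) (ρ ^ 2 * ‖u‖₊ ^ 2) η := by
  have hsub : ∀ i, HasSubgaussianMGF (fun v : EuclideanSpace ℝ (Fin d) => u i * v i)
      (‖u i‖₊ ^ 2 * ρ ^ 2) η := fun i => by
    refine ⟨fun t => ?_, fun t => ?_⟩
    · simpa only [mul_assoc] using (hη.subgaussian i).integrable_exp_mul (t * u i)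
    · have h := (hη.subgaussian i).mgf_le (t * u i)
      simp only [mgf, ← mul_assoc] at h ⊢
      refine h.trans (Real.exp_le_exp.2 (le_of_eq ?_))
      push_cast
      rw [Real.norm_eq_abs, sq_abs]
      ring
  have h := HasSubgaussianMGF.sum_of_iIndepFun (s := Finset.univ)
    (hη.indep.comp (fun i z => u i * z) fun i => by fun_prop)
    (c := fun i => ‖u i‖₊ ^ 2 * ρ ^ 2) fun i _ => hsub i
  have hc : ∑ i, ‖u i‖₊ ^ 2 * ρ ^ 2 = ρ ^ 2 * ‖u‖₊ ^ 2 := by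
    rw [← Finset.sum_mul, mul_comm]
    congr 1
    apply NNReal.eq
    push_cast
    rw [EuclideanSpace.norm_sq_eq]
  rw [hc] at h
  refine h.congr (.of_forall fun v => ?_)
  simp [PiLp.inner_apply, mul_comm]

lemma IsSubgaussianNoise.integrable_exp_inner (hη : IsSubgaussianNoise η ρ) (t : ℝ)
    (u : EuclideanSpace ℝ (Fin d)) : Integrable (fun v => Real.exp (t * inner ℝ u v)) η :=
  (hη.hasSubgaussianMGF_inner u).integrable_exp_mul t

lemma IsSubgaussianNoise.integral_exp_inner_le (hη : IsSubgaussianNoise η ρ) (t : ℝ)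
    (u : EuclideanSpace ℝ (Fin d)) :
    ∫ v, Real.exp (t * inner ℝ u v) ∂η ≤ Real.exp (ρ ^ 2 * ‖u‖ ^ 2 * t ^ 2 / 2) := by
  have := (hη.hasSubgaussianMGF_inner u).mgf_le t
  simpa [mgf] using this

lemma IsSubgaussianNoise.integrable_cosh_inner (hη : IsSubgaussianNoise η ρ) (t : ℝ)
    (u : EuclideanSpace ℝ (Fin d)) : Integrable (fun v => Real.cosh (t * inner ℝ u v)) η := by
  simp_rw [Real.cosh_eq, ← neg_mul]
  exact ((hη.integrable_exp_inner t u).add (hη.integrable_exp_inner (-t) u)).div_const 2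

lemma IsSubgaussianNoise.integral_cosh_inner_le (hη : IsSubgaussianNoise η ρ) (t : ℝ)
    (u : EuclideanSpace ℝ (Fin d)) :
    ∫ v, Real.cosh (t * inner ℝ u v) ∂η ≤ Real.exp (ρ ^ 2 * ‖u‖ ^ 2 * t ^ 2 / 2) := by
  have h1 := hη.integral_exp_inner_le t u
  have h2 := hη.integral_exp_inner_le (-t) u
  rw [neg_sq] at h2
  simp_rw [Real.cosh_eq, ← neg_mul]
  rw [integral_div, integral_add (hη.integrable_exp_inner t u) (hη.integrable_exp_inner (-t) u)]
  linarith

lemma IsSubgaussianNoise.integrable_inner_sq (hη : IsSubgaussianNoise η ρ)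
    (u : EuclideanSpace ℝ (Fin d)) : Integrable (fun v => (inner ℝ u v) ^ 2) η := by
  refine ((hη.integrable_cosh_inner 1 u).const_mul 2).mono'
    (Continuous.aestronglyMeasurable (by fun_prop)) (.of_forall fun v => ?_)
  rw [Real.norm_of_nonneg (sq_nonneg _), one_mul]
  linarith [sq_div_two_le_cosh_sub_one (inner ℝ u v)]

/-- Compare `z² / 2` with `cosh z - 1` at `z = t ⟪u, v⟫` and choose `t = 1 / (ρ ‖u‖)`; the factor
`2` is a convenient bound from `exp (1 / 2) ≤ 2`. -/
lemma IsSubgaussianNoise.integral_inner_sq_le (hη : IsSubgaussianNoise η ρ)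
    (u : EuclideanSpace ℝ (Fin d)) :
    ∫ v, (inner ℝ u v) ^ 2 ∂η ≤ 2 * ρ ^ 2 * ‖u‖ ^ 2 := by
  have := hη.prob
  have key : ∀ t : ℝ, t ^ 2 / 2 * ∫ v, (inner ℝ u v) ^ 2 ∂η ≤
      Real.exp (ρ ^ 2 * ‖u‖ ^ 2 * t ^ 2 / 2) - 1 := fun t => by
    have h1 := hη.integral_cosh_inner_le t u
    have h2 : ∫ v, t ^ 2 / 2 * (inner ℝ u v) ^ 2 ∂η ≤ ∫ v, (Real.cosh (t * inner ℝ u v) - 1) ∂η := by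
      refine integral_mono ((hη.integrable_inner_sq u).const_mul _)
        ((hη.integrable_cosh_inner t u).sub (integrable_const 1)) fun v => ?_
      have := sq_div_two_le_cosh_sub_one (t * inner ℝ u v)
      rw [mul_pow] at this
      simp only
      linarith
    rw [integral_const_mul, integral_sub (hη.integrable_cosh_inner t u) (integrable_const 1)] at h2
    simp only [integral_const, probReal_univ, smul_eq_mul, mul_one] at h2
    linarith
  rcases eq_or_ne ((ρ : ℝ) * ‖u‖) 0 with h0 | h0
  · have h1 := key 1
    have h2 : (ρ : ℝ) ^ 2 * ‖u‖ ^ 2 = 0 := by rw [← mul_pow, h0]; simp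
    rw [h2] at h1
    rw [mul_assoc, h2]
    simp at h1
    linarith
  · have h1 := key (1 / (ρ * ‖u‖))
    have h2 : (ρ : ℝ) ^ 2 * ‖u‖ ^ 2 * (1 / (ρ * ‖u‖)) ^ 2 = 1 := by
      rw [← mul_pow, ← mul_pow, mul_one_div_cancel h0, one_pow]
    rw [h2] at h1
    have h3 : Real.exp (1 / 2) ≤ 2 := by
      have := Real.exp_bound_div_one_sub_of_interval (x := 1 / 2) (by norm_num) (by norm_num)
      linarith
    have hp : 0 < (ρ : ℝ) * ‖u‖ := lt_of_le_of_ne (by positivity) (Ne.symm h0)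
    rw [div_pow, one_pow, div_div, div_mul_eq_mul_div, one_mul, div_le_iff₀ (by positivity)] at h1
    nlinarith [sq_nonneg ((ρ : ℝ) * ‖u‖)]

lemma apply_eq_inner (v : EuclideanSpace ℝ (Fin d)) (i : Fin d) :
    v i = inner ℝ (EuclideanSpace.single i (1 : ℝ)) v := by
  simp [EuclideanSpace.inner_single_left]

lemma IsSubgaussianNoise.integrable_apply_sq (hη : IsSubgaussianNoise η ρ) (i : Fin d) :
    Integrable (fun v => v i ^ 2) η := by
  simp_rw [apply_eq_inner]; exact hη.integrable_inner_sq _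

lemma IsSubgaussianNoise.integrable_norm_sq (hη : IsSubgaussianNoise η ρ) :
    Integrable (fun v => ‖v‖ ^ 2) η := by
  simp_rw [EuclideanSpace.norm_sq_eq, Real.norm_eq_abs, sq_abs]
  exact integrable_finsetSum _ fun i _ => hη.integrable_apply_sq i

lemma IsSubgaussianNoise.integral_norm_sq (hη : IsSubgaussianNoise η ρ) :
    ∫ v, ‖v‖ ^ 2 ∂η = ∑ i, ∫ v, v i ^ 2 ∂η := by
  simp_rw [EuclideanSpace.norm_sq_eq, Real.norm_eq_abs, sq_abs]
  exact integral_finsetSum _ fun i _ => hη.integrable_apply_sq i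

lemma IsSubgaussianNoise.integral_norm_sq_le (hη : IsSubgaussianNoise η ρ) :
    ∫ v, ‖v‖ ^ 2 ∂η ≤ 2 * d * ρ ^ 2 := by
  rw [hη.integral_norm_sq]
  calc ∑ i, ∫ v, v i ^ 2 ∂η ≤ ∑ _i : Fin d, 2 * (ρ : ℝ) ^ 2 := by
        refine Finset.sum_le_sum fun i _ => ?_
        simp_rw [apply_eq_inner]
        have := hη.integral_inner_sq_le (EuclideanSpace.single i (1 : ℝ))
        simpa using this
    _ = 2 * d * ρ ^ 2 := by simp; ring

/-- Jensen's inequality for `z ↦ 1 / √z`, by integrating its tangent line at the mean of `1 + ‖v‖ ^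
2`. -/
lemma IsSubgaussianNoise.one_div_sqrt_le_noiseConst (hη : IsSubgaussianNoise η ρ) :
    1 / √(1 + ∫ v, ‖v‖ ^ 2 ∂η) ≤ noiseConst η := by
  have := hη.prob
  set m := ∫ v, ‖v‖ ^ 2 ∂η with hm
  have hm0 : 0 ≤ m := integral_nonneg fun v => by positivity
  have hint : Integrable (fun v : EuclideanSpace ℝ (Fin d) => (1 + ‖v‖ ^ 2) / (2 * (1 + m))) η :=
    ((integrable_const 1).add hη.integrable_norm_sq).div_const _
  have h : ∫ v : EuclideanSpace ℝ (Fin d),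
      1 / √(1 + m) * (3 / 2 - (1 + ‖v‖ ^ 2) / (2 * (1 + m))) ∂η ≤ noiseConst η :=
    integral_mono (((integrable_const _).sub hint).const_mul _) integrable_noiseScale
      fun v => one_div_sqrt_tangent_le (by positivity) (by positivity)
  have hI : ∫ v : EuclideanSpace ℝ (Fin d), (1 + ‖v‖ ^ 2) / (2 * (1 + m)) ∂η =
      (1 + m) / (2 * (1 + m)) := by
    rw [integral_div, integral_add (integrable_const _) hη.integrable_norm_sq]
    simp [← hm]
  rw [integral_const_mul, integral_sub (integrable_const _) hint, hI] at h
  simp only [integral_const, probReal_univ, smul_eq_mul, one_mul] at h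
  have h2 : (3 / 2 - (1 + m) / (2 * (1 + m)) : ℝ) = 1 := by field_simp; norm_num
  rw [h2, mul_one] at h
  exact h

lemma IsSubgaussianNoise.noiseConst_pos (hη : IsSubgaussianNoise η ρ) : 0 < noiseConst η := by
  refine lt_of_lt_of_le ?_ hη.one_div_sqrt_le_noiseConst
  have hm0 : 0 ≤ ∫ v, ‖v‖ ^ 2 ∂η := integral_nonneg fun v => by positivity
  positivity

lemma IsSubgaussianNoise.one_le_noiseConst_sq_mul (hη : IsSubgaussianNoise η ρ) :
    1 ≤ noiseConst η ^ 2 * (1 + ∫ v, ‖v‖ ^ 2 ∂η) := by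
  have hm0 : 0 ≤ ∫ v, ‖v‖ ^ 2 ∂η := integral_nonneg fun v => by positivity
  have h := hη.one_div_sqrt_le_noiseConst
  rw [div_le_iff₀ (by positivity)] at h
  have h2 : (1 : ℝ) ^ 2 ≤ (noiseConst η * √(1 + ∫ v, ‖v‖ ^ 2 ∂η)) ^ 2 := by gcongr
  rwa [mul_pow, Real.sq_sqrt (by positivity), one_pow] at h2

/-- Independence factorises the left side over coordinates. Each factor is at most `exp (δ - 3 E
v_i²)`, and the hypothesis says that the `d` errors `δ` add up to at most `1`. -/
lemma IsSubgaussianNoise.integral_exp_neg_norm_sq_le (hη : IsSubgaussianNoise η ρ) {κ : ℝ}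
    (hκ : 1 ≤ κ)
    (h : 12 * d * (Real.exp (-((κ - 1) / 3)) * Real.exp (ρ ^ 2 * κ ^ 2 / 2)) ≤ 1) :
    ∫ v, Real.exp (-(4 * ‖v‖ ^ 2)) ∂η ≤ Real.exp (1 - 3 * ∫ v, ‖v‖ ^ 2 ∂η) := by
  have := hη.prob
  set δ := 12 * (Real.exp (-((κ - 1) / 3)) * Real.exp (ρ ^ 2 * κ ^ 2 / 2)) with hδ
  have hcoord : ∀ i : Fin d, ∫ v, Real.exp (-(4 * v i ^ 2)) ∂η ≤
      Real.exp (δ - 3 * ∫ v, v i ^ 2 ∂η) := fun i => by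
    have hcosh := hη.integral_cosh_inner_le κ (EuclideanSpace.single i (1 : ℝ))
    have hcosh' := hη.integrable_cosh_inner κ (EuclideanSpace.single i (1 : ℝ))
    simp_rw [← apply_eq_inner] at hcosh hcosh'
    simp only [PiLp.norm_single, norm_one, one_pow, mul_one] at hcosh
    have hi : Integrable (fun v : EuclideanSpace ℝ (Fin d) => 1 - 3 * v i ^ 2) η :=
      (integrable_const 1).sub ((hη.integrable_apply_sq i).const_mul 3)
    calc ∫ v, Real.exp (-(4 * v i ^ 2)) ∂η
        ≤ ∫ v, (1 - 3 * v i ^ 2 + 12 * Real.exp (-((κ - 1) / 3)) * Real.cosh (κ * v i)) ∂η := by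
          refine integral_mono ?_ (hi.add (hcosh'.const_mul _))
            fun v => exp_neg_four_mul_sq_le hκ (v i)
          refine Integrable.of_bound (Continuous.aestronglyMeasurable (by fun_prop)) 1
            (.of_forall fun v => ?_)
          rw [Real.norm_of_nonneg (Real.exp_pos _).le, Real.exp_le_one_iff]
          nlinarith [sq_nonneg (v i)]
      _ = 1 - 3 * ∫ v, v i ^ 2 ∂η +
            12 * Real.exp (-((κ - 1) / 3)) * ∫ v, Real.cosh (κ * v i) ∂η := by
          rw [integral_add hi (hcosh'.const_mul _), integral_const_mul,
            integral_sub (integrable_const 1) ((hη.integrable_apply_sq i).const_mul 3),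
            integral_const_mul]
          simp
      _ ≤ 1 - 3 * ∫ v, v i ^ 2 ∂η + δ := by
          rw [hδ, ← mul_assoc]
          gcongr
      _ ≤ Real.exp (δ - 3 * ∫ v, v i ^ 2 ∂η) := by
          have := Real.add_one_le_exp (δ - 3 * ∫ v, v i ^ 2 ∂η)
          linarith
  have hprod : ∫ v, Real.exp (-(4 * ‖v‖ ^ 2)) ∂η =
      ∏ i, ∫ v, Real.exp (-(4 * v i ^ 2)) ∂η := by
    have h1 := hη.indep.integral_fun_prod_comp
      (f := fun (_ : Fin d) (z : ℝ) => Real.exp (-(4 * z ^ 2)))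
      (fun i => by fun_prop) fun i => Continuous.aestronglyMeasurable (by fun_prop)
    rw [← h1]
    refine integral_congr_ae (.of_forall fun v => ?_)
    simp only
    rw [← Real.exp_sum, EuclideanSpace.norm_sq_eq]
    simp [Finset.mul_sum]
  rw [hprod]
  calc ∏ i, ∫ v, Real.exp (-(4 * v i ^ 2)) ∂η ≤ ∏ i, Real.exp (δ - 3 * ∫ v, v i ^ 2 ∂η) :=
        Finset.prod_le_prod (fun i _ => integral_nonneg fun v => (Real.exp_pos _).le)
          fun i _ => hcoord i
    _ = Real.exp (d * δ - 3 * ∫ v, ‖v‖ ^ 2 ∂η) := by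
        rw [← Real.exp_sum, hη.integral_norm_sq, Finset.sum_sub_distrib, Finset.mul_sum]
        simp
    _ ≤ _ := by
        rw [Real.exp_le_exp]
        have : d * δ = 12 * d * (Real.exp (-((κ - 1) / 3)) * Real.exp (ρ ^ 2 * κ ^ 2 / 2)) := by
          rw [hδ]; ring
        linarith

/-- The normalisation factor is rarely much larger than its mean. -/
lemma IsSubgaussianNoise.measureReal_noiseScale_gt_le (hη : IsSubgaussianNoise η ρ) {κ : ℝ}
    (hκ : 1 ≤ κ)
    (h : 12 * d * (Real.exp (-((κ - 1) / 3)) * Real.exp (ρ ^ 2 * κ ^ 2 / 2)) ≤ 1) :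
    η.real {v | 8 * noiseConst η < noiseScale v} ≤ Real.exp (-(2 * ∫ v, ‖v‖ ^ 2 ∂η)) := by
  have := hη.prob
  set m := ∫ v, ‖v‖ ^ 2 ∂η with hm
  have hm0 : 0 ≤ m := integral_nonneg fun v => by positivity
  have hC := hη.one_le_noiseConst_sq_mul
  have hC0 := hη.noiseConst_pos
  have hmeas : MeasurableSet {v : EuclideanSpace ℝ (Fin d) | 8 * noiseConst η < noiseScale v} :=
    measurableSet_lt measurable_const continuous_noiseScale.measurable
  have hint : Integrable (fun v : EuclideanSpace ℝ (Fin d) => Real.exp (-(4 * ‖v‖ ^ 2))) η := by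
    refine Integrable.of_bound (Continuous.aestronglyMeasurable (by fun_prop)) 1
      (.of_forall fun v => ?_)
    rw [Real.norm_of_nonneg (Real.exp_pos _).le, Real.exp_le_one_iff]
    nlinarith [sq_nonneg ‖v‖]
  rw [← integral_indicator_one hmeas]
  calc ∫ v, Set.indicator {v | 8 * noiseConst η < noiseScale v} 1 v ∂η
      ≤ ∫ v, Real.exp ((1 + m) / 16 - 4) * Real.exp (-(4 * ‖v‖ ^ 2)) ∂η := by
        refine integral_mono ((integrable_const 1).indicator hmeas) (hint.const_mul _) fun v => ?_
        by_cases hv : v ∈ {v | 8 * noiseConst η < noiseScale v}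
        · rw [Set.indicator_of_mem hv]
          have hv' : 8 * noiseConst η < 1 / √(1 + ‖v‖ ^ 2) := hv
          rw [lt_div_iff₀ (by positivity)] at hv'
          have h2 : (8 * noiseConst η * √(1 + ‖v‖ ^ 2)) ^ 2 < 1 ^ 2 := by gcongr
          rw [mul_pow, Real.sq_sqrt (by positivity)] at h2
          simp only [Pi.one_apply]
          rw [← Real.exp_add, Real.one_le_exp_iff]
          -- By Jensen, a normalisation factor above `8 C` means that `1 + ‖v‖²` is at most `1 / 64`
          -- of its mean; the lower tail is then controlled by the Laplace transform of `‖v‖²`.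
          have h3 : 64 * (1 + ‖v‖ ^ 2) ≤ 1 + m := by
            have h4 : noiseConst η ^ 2 * (64 * (1 + ‖v‖ ^ 2)) ≤ noiseConst η ^ 2 * (1 + m) := by
              nlinarith
            exact le_of_mul_le_mul_left h4 (by positivity)
          linarith
        · rw [Set.indicator_of_notMem hv]
          positivity
    _ = Real.exp ((1 + m) / 16 - 4) * ∫ v, Real.exp (-(4 * ‖v‖ ^ 2)) ∂η := integral_const_mul _ _
    _ ≤ Real.exp ((1 + m) / 16 - 4) * Real.exp (1 - 3 * m) := by
        gcongr
        exact hη.integral_exp_neg_norm_sq_le hκ h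
    _ ≤ Real.exp (-(2 * m)) := by
        rw [← Real.exp_add, Real.exp_le_exp]
        linarith

end Noise

/-! ### Decomposition of the signal and linearisation of the response. -/

section Signal

variable {d K S : ℕ} {Φ Ψ : Fin K → EuclideanSpace ℝ (Fin d)} {A B : ℝ}

lemma signal_eq (x : EuclideanSpace ℝ (Fin K)) (r : EuclideanSpace ℝ (Fin d)) :
    signal Φ x r = noiseScale r • (∑ i, x i • Φ i + r) := rfl

lemma inner_signal (u : EuclideanSpace ℝ (Fin d)) (x : EuclideanSpace ℝ (Fin K))
    (r : EuclideanSpace ℝ (Fin d)) : inner ℝ u (signal Φ x r) =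
      noiseScale r * (∑ k, x k * inner ℝ u (Φ k) + inner ℝ u r) := by
  rw [signal_eq, inner_smul_right, inner_add_right, inner_sum]
  simp_rw [inner_smul_right]

lemma continuous_signal : Continuous
    fun z : EuclideanSpace ℝ (Fin K) × EuclideanSpace ℝ (Fin d) => signal Φ z.1 z.2 := by
  simp_rw [signal_eq]
  exact (continuous_noiseScale.comp continuous_snd).smul (by fun_prop)

/-- The upper frame bound by duality: pair the vector with itself and apply Cauchy-Schwarz. -/
lemma IsFrame.norm_sum_smul_le (h : IsFrame Φ A B) (x : EuclideanSpace ℝ (Fin K)) :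
    ‖∑ i, x i • Φ i‖ ≤ √B * ‖x‖ := by
  set w := ∑ i, x i • Φ i with hw
  rcases (norm_nonneg w).eq_or_lt with h0 | h0
  · rw [← h0]; positivity
  have h1 : ‖w‖ ^ 2 = ∑ i, x i * inner ℝ (Φ i) w := by
    rw [← real_inner_self_eq_norm_sq]
    conv_lhs => rw [hw, sum_inner]
    simp_rw [real_inner_smul_left]
    rfl
  have h2 : ∑ i, x i * inner ℝ (Φ i) w ≤ √(∑ i, x i ^ 2) * √(∑ i, (inner ℝ (Φ i) w) ^ 2) :=
    Real.sum_mul_le_sqrt_mul_sqrt _ _ _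
  have h3 : √(∑ i, x i ^ 2) = ‖x‖ := by
    rw [EuclideanSpace.norm_eq]
    simp
  have hB : 0 ≤ B := h.lower_pos.le.trans h.le
  have h4 : √(∑ i, (inner ℝ (Φ i) w) ^ 2) ≤ √B * ‖w‖ := by
    rw [← Real.sqrt_sq h0.le, ← Real.sqrt_mul hB]
    refine Real.sqrt_le_sqrt ?_
    simpa [sq_abs, Real.sqrt_sq h0.le] using h.upper w
  rw [h3] at h2
  have h5 : ‖w‖ * ‖w‖ ≤ (√B * ‖x‖) * ‖w‖ := by
    calc ‖w‖ * ‖w‖ = ‖w‖ ^ 2 := (sq _).symm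
      _ ≤ ‖x‖ * √(∑ i, (inner ℝ (Φ i) w) ^ 2) := h1.trans_le h2
      _ ≤ ‖x‖ * (√B * ‖w‖) := by gcongr
      _ = _ := by ring
  exact le_of_mul_le_mul_right h5 h0

lemma IsFrame.one_le (h : IsFrame Φ A B) (hΦ : Φ ∈ dictionaries d K) (hK : 0 < K) : 1 ≤ B := by
  have h1 := h.upper (Φ ⟨0, hK⟩)
  rw [hΦ ⟨0, hK⟩] at h1
  have h2 : |inner ℝ (Φ ⟨0, hK⟩) (Φ ⟨0, hK⟩)| ^ 2 ≤
      ∑ i, |inner ℝ (Φ i) (Φ ⟨0, hK⟩)| ^ 2 :=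
    Finset.single_le_sum (f := fun i => |inner ℝ (Φ i) (Φ ⟨0, hK⟩)| ^ 2)
      (fun i _ => by positivity) (Finset.mem_univ _)
  rw [real_inner_self_eq_norm_sq, hΦ ⟨0, hK⟩] at h2
  norm_num at h1 h2
  linarith

lemma IsFrame.norm_signal_le (h : IsFrame Φ A B) {x : EuclideanSpace ℝ (Fin K)} (hx : ‖x‖ = 1)
    (r : EuclideanSpace ℝ (Fin d)) : ‖signal Φ x r‖ ≤ √B + 1 := by
  have h1 := h.norm_sum_smul_le x
  rw [hx, mul_one] at h1
  have h2 := noiseScale_pos r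
  have h3 := noiseScale_le_one r
  have h4 := noiseScale_mul_norm_le_one r
  rw [signal_eq, norm_smul, Real.norm_of_nonneg h2.le]
  have h5 := norm_add_le (∑ i, x i • Φ i) r
  nlinarith [norm_nonneg (∑ i, x i • Φ i), Real.sqrt_nonneg B, norm_nonneg r]

/-- The deviation of the response of an atom from the contribution of its coefficient. -/
noncomputable def crossTerm (Φ Ψ : Fin K → EuclideanSpace ℝ (Fin d)) (i : Fin K)
    (z : EuclideanSpace ℝ (Fin K) × EuclideanSpace ℝ (Fin d)) : ℝ :=
  ∑ k, (if k = i then 0 else inner ℝ (Ψ i) (Φ k)) * z.1 k + inner ℝ (Ψ i) z.2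

lemma continuous_crossTerm (i : Fin K) : Continuous (crossTerm Φ Ψ i) := by
  unfold crossTerm; fun_prop

lemma inner_signal_eq_crossTerm (i : Fin K) (x : EuclideanSpace ℝ (Fin K))
    (r : EuclideanSpace ℝ (Fin d)) : inner ℝ (Ψ i) (signal Φ x r) =
      noiseScale r * (x i * inner ℝ (Ψ i) (Φ i) + crossTerm Φ Ψ i (x, r)) := by
  rw [inner_signal, crossTerm, ← add_assoc]
  congr 2
  have : ∀ k, x k * inner ℝ (Ψ i) (Φ k) = (if k = i then x i * inner ℝ (Ψ i) (Φ i) else 0) +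
      (if k = i then 0 else inner ℝ (Ψ i) (Φ k)) * x k := fun k => by
    split_ifs with h
    · subst h; simp
    · ring
  rw [Finset.sum_congr rfl fun k _ => this k, Finset.sum_add_distrib]
  simp

/-- Up to the common noise factor, `⟪ψ_i, y⟫` is within `q + t` below and `t` above `|x i|` in
absolute value. A gap of `2 t + q` therefore keeps the `S` largest indices on top and preserves
their signs. -/
lemma response_eq_sum_topSign (hS : 1 ≤ S) (hSK : S < K) {β q t : ℝ}
    {x : EuclideanSpace ℝ (Fin K)} (hx : ‖x‖ = 1) (hgap : β ≤ amp x S - amp x (S + 1))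
    (hq : ∀ i, 1 - q ≤ inner ℝ (Ψ i) (Φ i)) (hq1 : ∀ i, inner ℝ (Ψ i) (Φ i) ≤ 1)
    (hq0 : 0 ≤ q) (hq2 : q ≤ 1) (ht : 0 < t) (hβ : 2 * t + q ≤ β)
    {r : EuclideanSpace ℝ (Fin d)} (hdev : ∀ i, |crossTerm Φ Ψ i (x, r)| < t) :
    response S Ψ (signal Φ x r) = ∑ i, topSign S x i * inner ℝ (Ψ i) (signal Φ x r) := by
  have hlt : amp x (S + 1) < amp x S := by linarith
  have hs := noiseScale_pos r
  have hx1 : ∀ i, |x i| ≤ 1 := fun i => hx ▸ abs_apply_le_norm x i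
  set a : Fin K → ℝ := fun i => x i * inner ℝ (Ψ i) (Φ i) + crossTerm Φ Ψ i (x, r) with ha
  have hin : ∀ i, inner ℝ (Ψ i) (signal Φ x r) = noiseScale r * a i := fun i =>
    inner_signal_eq_crossTerm i x r
  have hmain : ∀ i, |x i * inner ℝ (Ψ i) (Φ i)| = |x i| * inner ℝ (Ψ i) (Φ i) := fun i => by
    rw [abs_mul, abs_of_nonneg (by linarith [hq i] : 0 ≤ inner ℝ (Ψ i) (Φ i))]
  have hlow : ∀ i, |x i| - q - t < |a i| := fun i => by
    have h1 := abs_sub_abs_le_abs_sub (x i * inner ℝ (Ψ i) (Φ i)) (-crossTerm Φ Ψ i (x, r))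
    rw [sub_neg_eq_add, abs_neg, hmain] at h1
    nlinarith [hdev i, hq i, hx1 i, abs_nonneg (x i)]
  have hup : ∀ i, |a i| < |x i| + t := fun i => by
    have h1 := abs_add_le (x i * inner ℝ (Ψ i) (Φ i)) (crossTerm Φ Ψ i (x, r))
    rw [hmain] at h1
    nlinarith [hdev i, hq1 i, abs_nonneg (x i)]
  rw [response_eq_sum hSK.le (card_topSet hS hSK hlt)]
  · rw [← Finset.sum_filter_add_sum_filter_not Finset.univ (· ∈ topSet S x)]
    have hz : ∑ i ∈ Finset.univ.filter (· ∉ topSet S x),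
        topSign S x i * inner ℝ (Ψ i) (signal Φ x r) = 0 :=
      Finset.sum_eq_zero fun i hi => by
        rw [Finset.mem_filter] at hi
        rw [topSign, if_neg hi.2, zero_mul]
    rw [hz, add_zero, Finset.filter_mem_eq_inter, Finset.univ_inter]
    refine Finset.sum_congr rfl fun i hi => ?_
    have h1 := amp_le_of_mem_topSet hS hSK hlt hi
    have h2 := amp_nonneg x (S + 1)
    have h3 := abs_lt.1 (hdev i)
    rw [topSign, if_pos hi, hin, abs_mul, abs_of_pos hs]
    rcases le_total 0 (x i) with h | h
    · rw [abs_of_nonneg h] at h1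
      have hxi : 0 < x i := by linarith
      have hpos : 0 < a i := by
        have := hx1 i
        rw [abs_of_nonneg h] at this
        simp only [ha]; nlinarith [hq i]
      rw [Real.sign_of_pos hxi, abs_of_pos hpos, one_mul]
    · rw [abs_of_nonpos h] at h1
      have hxi : x i < 0 := by linarith
      have hneg : a i < 0 := by
        have := hx1 i
        rw [abs_of_nonpos h] at this
        simp only [ha]; nlinarith [hq i]
      rw [Real.sign_of_neg hxi, abs_of_neg hneg]
      ring
  · intro i hi j hj
    have h1 := amp_le_of_mem_topSet hS hSK hlt hi
    have h2 := le_amp_of_notMem_topSet hS hSK hlt hj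
    rw [hin, hin, abs_mul, abs_mul]
    refine mul_le_mul_of_nonneg_left ?_ (abs_nonneg _)
    linarith [hlow i, hup j]

variable {ν : Measure (EuclideanSpace ℝ (Fin K))} {η : Measure (EuclideanSpace ℝ (Fin d))}
  {ρ : ℝ≥0}

/-- Coefficients and noise are independent, so their variance parameters add: `b²` from the
sign-averaged linear form and `ρ²` from the unit vector `Ψ i`. -/
lemma hasSubgaussianMGF_crossTerm (hν : IsSymmetricOnSphere ν) (hη : IsSubgaussianNoise η ρ)
    {b : ℝ≥0} {i : Fin K} (hΨ : ‖Ψ i‖ = 1) (hb : ∀ k ≠ i, |inner ℝ (Ψ i) (Φ k)| ≤ b) :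
    HasSubgaussianMGF (crossTerm Φ Ψ i) (b ^ 2 + ρ ^ 2) (ν.prod η) := by
  have := hν.prob
  have := hη.prob
  set a : Fin K → ℝ := fun k => if k = i then 0 else inner ℝ (Ψ i) (Φ k) with ha
  have hexp : ∀ t : ℝ, (fun z => Real.exp (t * crossTerm Φ Ψ i z)) = fun z =>
      Real.exp (∑ k, t * a k * z.1 k) * Real.exp (t * inner ℝ (Ψ i) z.2) := fun t => by
    funext z
    rw [← Real.exp_add, crossTerm, mul_add, Finset.mul_sum]
    simp_rw [mul_assoc]
    rfl
  have hab : ∀ k, |a k| ≤ b := fun k => by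
    simp only [ha]
    split_ifs with h
    · simp
    · exact hb k h
  refine ⟨fun t => ?_, fun t => ?_⟩
  · rw [hexp]
    exact (hν.integrable_exp_sum fun k => t * a k).mul_prod (hη.integrable_exp_inner t (Ψ i))
  · rw [mgf, hexp]
    rw [integral_prod_mul (fun x : EuclideanSpace ℝ (Fin K) => Real.exp (∑ k, t * a k * x k))
      (fun v => Real.exp (t * inner ℝ (Ψ i) v))]
    have h1 := hν.integral_exp_sum_le (a := fun k => t * a k) (b := |t| * b) fun k => by
      rw [abs_mul]
      exact mul_le_mul_of_nonneg_left (hab k) (abs_nonneg _)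
    have h2 := hη.integral_exp_inner_le t (Ψ i)
    rw [hΨ] at h2
    calc _ ≤ Real.exp ((|t| * b) ^ 2 / 2) * Real.exp (ρ ^ 2 * 1 ^ 2 * t ^ 2 / 2) :=
          mul_le_mul h1 h2 (integral_nonneg fun v => (Real.exp_pos _).le) (Real.exp_pos _).le
      _ = _ := by
          rw [← Real.exp_add, mul_pow, sq_abs]
          push_cast
          congr 1
          ring

lemma measureReal_le_abs_crossTerm_le (hν : IsSymmetricOnSphere ν) (hη : IsSubgaussianNoise η ρ)
    (hΨ : Ψ ∈ dictionaries d K) {b : ℝ≥0} (hb : ∀ i, ∀ k ≠ i, |inner ℝ (Ψ i) (Φ k)| ≤ b)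
    {t : ℝ} (ht : 0 ≤ t) :
    (ν.prod η).real {z | ∃ i, t ≤ |crossTerm Φ Ψ i z|} ≤
      2 * K * Real.exp (-t ^ 2 / (2 * (b ^ 2 + ρ ^ 2))) := by
  have := hν.prob
  have := hη.prob
  have hset : {z | ∃ i, t ≤ |crossTerm Φ Ψ i z|} =
      ⋃ i ∈ (Finset.univ : Finset (Fin K)), {z | t ≤ |crossTerm Φ Ψ i z|} := by
    ext z; simp
  rw [hset]
  refine (measureReal_biUnion_finset_le _ _).trans ?_
  calc ∑ i : Fin K, (ν.prod η).real {z | t ≤ |crossTerm Φ Ψ i z|}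
      ≤ ∑ _i : Fin K, 2 * Real.exp (-t ^ 2 / (2 * (b ^ 2 + ρ ^ 2))) := by
        refine Finset.sum_le_sum fun i _ => ?_
        have h := hasSubgaussianMGF_crossTerm hν hη (hΨ i) (hb i)
        have h1 := h.measure_ge_le ht
        have h2 := h.neg.measure_ge_le ht
        push_cast at h1 h2
        have hsub : {z | t ≤ |crossTerm Φ Ψ i z|} ⊆
            {z | t ≤ crossTerm Φ Ψ i z} ∪ {z | t ≤ (-crossTerm Φ Ψ i) z} := fun z hz =>
          (le_abs.1 (show t ≤ |crossTerm Φ Ψ i z| from hz)).elim (fun h => Or.inl h)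
            fun h => Or.inr h
        calc _ ≤ (ν.prod η).real ({z | t ≤ crossTerm Φ Ψ i z} ∪
              {z | t ≤ (-crossTerm Φ Ψ i) z}) := measureReal_mono hsub
          _ ≤ _ := measureReal_union_le _ _
          _ ≤ _ := by linarith
    _ = _ := by simp; ring

/-- The linearisation of the change of the response. -/
noncomputable def linearResponse (S : ℕ) (Φ Ψ : Fin K → EuclideanSpace ℝ (Fin d))
    (z : EuclideanSpace ℝ (Fin K) × EuclideanSpace ℝ (Fin d)) : ℝ :=
  ∑ i, topSign S z.1 i * inner ℝ (Ψ i - Φ i) (signal Φ z.1 z.2)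

lemma inner_sub_self_of_norm_eq_one {u v : EuclideanSpace ℝ (Fin d)} (hu : ‖u‖ = 1)
    (hv : ‖v‖ = 1) : inner ℝ (u - v) v = -(‖u - v‖ ^ 2 / 2) := by
  rw [norm_sub_sq_real, inner_sub_left, real_inner_self_eq_norm_sq, hu, hv]
  ring

/-- Symmetry kills the terms with `k ≠ i` and the noise term. The diagonal term remains, with `⟪ψ_i
- φ_i, φ_i⟫ = -‖ψ_i - φ_i‖² / 2` for unit vectors. -/
lemma integral_linearResponse (hS : 1 ≤ S) (hSK : S < K) (hΦ : Φ ∈ dictionaries d K)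
    (hΨ : Ψ ∈ dictionaries d K) (hν : IsSymmetricOnSphere ν) (hη : IsSubgaussianNoise η ρ)
    {β : ℝ} (hβ : 0 < β) (hgap : ∀ᵐ z ∂ν, β ≤ amp z S - amp z (S + 1)) :
    Integrable (linearResponse S Φ Ψ) (ν.prod η) ∧
    ∫ z, linearResponse S Φ Ψ z ∂(ν.prod η) =
      -(noiseConst η * ampSum ν S / (2 * K) * ∑ i, ‖Ψ i - Φ i‖ ^ 2) := by
  have := hν.prob
  have := hη.prob
  have hlin : linearResponse S Φ Ψ = fun z => ∑ i, (∑ k, (topSign S z.1 i * z.1 k) *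
      (noiseScale z.2 * inner ℝ (Ψ i - Φ i) (Φ k)) +
      topSign S z.1 i * (noiseScale z.2 * inner ℝ (Ψ i - Φ i) z.2)) := by
    funext z
    unfold linearResponse
    refine Finset.sum_congr rfl fun i _ => ?_
    rw [inner_signal, mul_add, mul_add, Finset.mul_sum, Finset.mul_sum]
    congr 1
    exact Finset.sum_congr rfl fun k _ => by ring
  have hi1 : ∀ i k, Integrable (fun z : EuclideanSpace ℝ (Fin K) × EuclideanSpace ℝ (Fin d) =>
      (topSign S z.1 i * z.1 k) * (noiseScale z.2 * inner ℝ (Ψ i - Φ i) (Φ k))) (ν.prod η) :=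
    fun i k => (hν.integrable_topSign_mul i k).mul_prod (integrable_noiseScale.mul_const _)
  have hi2 : ∀ i, Integrable (fun z : EuclideanSpace ℝ (Fin K) × EuclideanSpace ℝ (Fin d) =>
      topSign S z.1 i * (noiseScale z.2 * inner ℝ (Ψ i - Φ i) z.2)) (ν.prod η) :=
    fun i => (integrable_topSign i).mul_prod (integrable_noiseScale_mul_inner _)
  have hv1 : ∀ i k, ∫ z, (topSign S z.1 i * z.1 k) *
      (noiseScale z.2 * inner ℝ (Ψ i - Φ i) (Φ k)) ∂(ν.prod η) =
      if k = i then -(noiseConst η * ampSum ν S / (2 * K) * ‖Ψ i - Φ i‖ ^ 2) else 0 := fun i k => by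
    rw [integral_prod_mul (fun x : EuclideanSpace ℝ (Fin K) => topSign S x i * x k)
      (fun v => noiseScale v * inner ℝ (Ψ i - Φ i) (Φ k))]
    split_ifs with h
    · subst h
      rw [hν.integral_topSign_mul_self hS hSK hβ hgap, integral_mul_const, ← noiseConst_eq,
        inner_sub_self_of_norm_eq_one (hΨ k) (hΦ k)]
      have hK : (K : ℝ) ≠ 0 := by
        have : 0 < K := by omega
        positivity
      field_simp
    · rw [hν.integral_topSign_mul_of_ne h, zero_mul]
  have hv2 : ∀ i, ∫ z, topSign S z.1 i * (noiseScale z.2 * inner ℝ (Ψ i - Φ i) z.2) ∂(ν.prod η) =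
      0 := fun i => by
    rw [integral_prod_mul (fun x : EuclideanSpace ℝ (Fin K) => topSign S x i)
      (fun v => noiseScale v * inner ℝ (Ψ i - Φ i) v), hν.integral_topSign, zero_mul]
  have hi3 : ∀ i, Integrable (fun z : EuclideanSpace ℝ (Fin K) × EuclideanSpace ℝ (Fin d) =>
      ∑ k, (topSign S z.1 i * z.1 k) * (noiseScale z.2 * inner ℝ (Ψ i - Φ i) (Φ k)))
      (ν.prod η) := fun i => integrable_finsetSum _ fun k _ => hi1 i k
  have hi4 : ∀ i, Integrable (fun z : EuclideanSpace ℝ (Fin K) × EuclideanSpace ℝ (Fin d) =>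
      ∑ k, (topSign S z.1 i * z.1 k) * (noiseScale z.2 * inner ℝ (Ψ i - Φ i) (Φ k)) +
      topSign S z.1 i * (noiseScale z.2 * inner ℝ (Ψ i - Φ i) z.2))
      (ν.prod η) := fun i => (hi3 i).add (hi2 i)
  rw [hlin]
  refine ⟨integrable_finsetSum _ fun i _ => hi4 i, ?_⟩
  rw [integral_finsetSum _ fun i _ => hi4 i, Finset.mul_sum, ← Finset.sum_neg_distrib]
  refine Finset.sum_congr rfl fun i _ => ?_
  rw [integral_add (hi3 i) (hi2 i), hv2, add_zero, integral_finsetSum _ fun k _ => hi1 i k,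
    Finset.sum_congr rfl fun k _ => hv1 i k]
  simp

end Signal

/-! ### Mean, Laplace transform and second moment of the change of the response. -/

section ResponseChange

variable {d K S : ℕ} {Φ Ψ : Fin K → EuclideanSpace ℝ (Fin d)} {A B : ℝ}
  {ν : Measure (EuclideanSpace ℝ (Fin K))} {η : Measure (EuclideanSpace ℝ (Fin d))} {ρ : ℝ≥0}

/-- The change of the response of a signal when the generating dictionary `Φ` is replaced. -/
noncomputable def responseChange (S : ℕ) (Φ Ψ : Fin K → EuclideanSpace ℝ (Fin d))
    (z : EuclideanSpace ℝ (Fin K) × EuclideanSpace ℝ (Fin d)) : ℝ :=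
  response S Ψ (signal Φ z.1 z.2) - response S Φ (signal Φ z.1 z.2)

lemma continuous_responseChange (hSK : S ≤ K) : Continuous (responseChange S Φ Ψ) :=
  (continuous_response hSK continuous_const continuous_signal).sub
    (continuous_response hSK continuous_const continuous_signal)

lemma ae_fst_of_ae [SFinite ν] [SFinite η] {p : EuclideanSpace ℝ (Fin K) → Prop}
    (h : ∀ᵐ x ∂ν, p x) : ∀ᵐ z ∂(ν.prod η), p z.1 :=
  Measure.quasiMeasurePreserving_fst.ae h

lemma abs_inner_signal_le (hframe : IsFrame Φ A B) {x : EuclideanSpace ℝ (Fin K)} (hx : ‖x‖ = 1)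
    (u : EuclideanSpace ℝ (Fin d)) (r : EuclideanSpace ℝ (Fin d)) :
    |inner ℝ u (signal Φ x r)| ≤ ‖u‖ * (√B + 1) :=
  (abs_real_inner_le_norm _ _).trans (by
    gcongr; exact hframe.norm_signal_le hx r)

lemma abs_inner_signal_le_noiseScale_mul (hframe : IsFrame Φ A B) {x : EuclideanSpace ℝ (Fin K)}
    (hx : ‖x‖ = 1) (u : EuclideanSpace ℝ (Fin d)) (r : EuclideanSpace ℝ (Fin d)) :
    |inner ℝ u (signal Φ x r)| ≤ noiseScale r * (‖u‖ * √B + |inner ℝ u r|) := by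
  rw [signal_eq, inner_smul_right, abs_mul, abs_of_pos (noiseScale_pos r)]
  refine mul_le_mul_of_nonneg_left ?_ (noiseScale_pos r).le
  rw [inner_add_right]
  refine (abs_add_le _ _).trans ?_
  gcongr
  refine (abs_real_inner_le_norm _ _).trans ?_
  gcongr
  simpa [hx] using hframe.norm_sum_smul_le x

lemma abs_responseChange_le (hSK : S ≤ K) (hframe : IsFrame Φ A B) {e : ℝ}
    (he : ∀ i, ‖Ψ i - Φ i‖ ≤ e) {x : EuclideanSpace ℝ (Fin K)} (hx : ‖x‖ = 1)
    (r : EuclideanSpace ℝ (Fin d)) : |responseChange S Φ Ψ (x, r)| ≤ S * e * (√B + 1) := by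
  rw [mul_assoc]
  refine abs_response_sub_le hSK fun i => (abs_inner_signal_le hframe hx _ r).trans ?_
  gcongr
  exact he i

lemma sum_abs_topSign_le (hS : 1 ≤ S) (hSK : S < K) {x : EuclideanSpace ℝ (Fin K)}
    (hgap : amp x (S + 1) < amp x S) : ∑ i, |topSign S x i| ≤ S := by
  have h : ∀ i, |topSign S x i| = if i ∈ topSet S x then 1 else 0 := fun i =>
    abs_topSign fun hi => abs_pos.1 (by
      have h1 := amp_le_of_mem_topSet hS hSK hgap hi
      have h2 := amp_nonneg x (S + 1)
      linarith)
  simp [h, card_topSet hS hSK hgap]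

lemma abs_linearResponse_le (hS : 1 ≤ S) (hSK : S < K) (hframe : IsFrame Φ A B) {e : ℝ}
    (he : ∀ i, ‖Ψ i - Φ i‖ ≤ e) {x : EuclideanSpace ℝ (Fin K)} (hx : ‖x‖ = 1)
    (hgap : amp x (S + 1) < amp x S) (r : EuclideanSpace ℝ (Fin d)) :
    |linearResponse S Φ Ψ (x, r)| ≤ S * e * (√B + 1) := by
  have he0 : 0 ≤ e := (norm_nonneg _).trans (he ⟨0, by omega⟩)
  calc |linearResponse S Φ Ψ (x, r)|
      ≤ ∑ i, |topSign S x i * inner ℝ (Ψ i - Φ i) (signal Φ x r)| :=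
        Finset.abs_sum_le_sum_abs _ _
    _ ≤ ∑ i, |topSign S x i| * (e * (√B + 1)) := by
        refine Finset.sum_le_sum fun i _ => ?_
        rw [abs_mul]
        gcongr
        refine (abs_inner_signal_le hframe hx _ r).trans ?_
        gcongr
        exact he i
    _ = (∑ i, |topSign S x i|) * (e * (√B + 1)) := by rw [Finset.sum_mul]
    _ ≤ S * (e * (√B + 1)) := by
        gcongr
        exact sum_abs_topSign_le hS hSK hgap
    _ = _ := by ring

lemma integrable_responseChange (hSK : S ≤ K) (hframe : IsFrame Φ A B)
    (hν : IsSymmetricOnSphere ν) (hη : IsSubgaussianNoise η ρ) {e : ℝ}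
    (he : ∀ i, ‖Ψ i - Φ i‖ ≤ e) : Integrable (responseChange S Φ Ψ) (ν.prod η) := by
  have := hν.prob
  have := hη.prob
  refine Integrable.of_bound (continuous_responseChange hSK).aestronglyMeasurable
    (S * e * (√B + 1)) ?_
  filter_upwards [ae_fst_of_ae hν.ae_norm_eq_one] with z hz
  exact abs_responseChange_le hSK hframe he hz z.2

/-- The mean of the change of the response is the mean of its linearisation, up to the
contribution of the exceptional set `N`. -/
lemma integral_responseChange_le (hS : 1 ≤ S) (hSK : S < K) (hΦ : Φ ∈ dictionaries d K)
    (hΨ : Ψ ∈ dictionaries d K) (hframe : IsFrame Φ A B) (hν : IsSymmetricOnSphere ν)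
    (hη : IsSubgaussianNoise η ρ) {β : ℝ} (hβ : 0 < β)
    (hgap : ∀ᵐ z ∂ν, β ≤ amp z S - amp z (S + 1)) {e : ℝ} (he : ∀ i, ‖Ψ i - Φ i‖ ≤ e)
    {N : Set (EuclideanSpace ℝ (Fin K) × EuclideanSpace ℝ (Fin d))} (hN : MeasurableSet N)
    (hlin : ∀ᵐ z ∂(ν.prod η), z ∉ N → responseChange S Φ Ψ z = linearResponse S Φ Ψ z) :
    ∫ z, responseChange S Φ Ψ z ∂(ν.prod η) ≤
      -(noiseConst η * ampSum ν S / (2 * K) * ∑ i, ‖Ψ i - Φ i‖ ^ 2) +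
        2 * (S * e * (√B + 1)) * (ν.prod η).real N := by
  have := hν.prob
  have := hη.prob
  obtain ⟨hi, hval⟩ := integral_linearResponse hS hSK hΦ hΨ hν hη hβ hgap
  have hind : Integrable (N.indicator fun _ => 2 * (S * e * (√B + 1))) (ν.prod η) :=
    (integrable_const _).indicator hN
  calc ∫ z, responseChange S Φ Ψ z ∂(ν.prod η)
      ≤ ∫ z, (linearResponse S Φ Ψ z + N.indicator (fun _ => 2 * (S * e * (√B + 1))) z)
          ∂(ν.prod η) := by
        refine integral_mono_ae (integrable_responseChange hSK.le hframe hν hη he)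
          (hi.add hind) ?_
        filter_upwards [ae_fst_of_ae hν.ae_norm_eq_one, ae_fst_of_ae hgap, hlin]
          with z hz1 hz2 hz3
        by_cases hz : z ∈ N
        · rw [Set.indicator_of_mem hz]
          have h1 := abs_le.1 (abs_responseChange_le hSK.le hframe he hz1 z.2)
          have h2 := abs_le.1 (abs_linearResponse_le hS hSK hframe he hz1
            (by linarith) z.2)
          simp only [Prod.mk.eta] at h1 h2
          linarith [h1.2, h2.1]
        · rw [Set.indicator_of_notMem hz, hz3 hz, add_zero]
    _ = _ := by
        rw [integral_add hi hind, hval, integral_indicator_const _ hN, smul_eq_mul]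
        ring

/-- The crude almost sure bound. Besides integrability, it serves where the noise is atypically
small and in the case of a noise constant at least `1 / 2`. -/
lemma integrable_sq_mul_exp_responseChange (hSK : S ≤ K) (hframe : IsFrame Φ A B)
    (hν : IsSymmetricOnSphere ν) (hη : IsSubgaussianNoise η ρ) {e : ℝ}
    (he : ∀ i, ‖Ψ i - Φ i‖ ≤ e) {s : ℝ} (hs : 0 ≤ s) :
    Integrable (fun z => responseChange S Φ Ψ z ^ 2 * Real.exp (s * |responseChange S Φ Ψ z|))
      (ν.prod η) ∧ ∀ᵐ z ∂(ν.prod η),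
        responseChange S Φ Ψ z ^ 2 * Real.exp (s * |responseChange S Φ Ψ z|) ≤
          (S * e * (√B + 1)) ^ 2 * Real.exp (s * (S * e * (√B + 1))) := by
  have := hν.prob
  have := hη.prob
  have hae : ∀ᵐ z ∂(ν.prod η),
        responseChange S Φ Ψ z ^ 2 * Real.exp (s * |responseChange S Φ Ψ z|) ≤
          (S * e * (√B + 1)) ^ 2 * Real.exp (s * (S * e * (√B + 1))) := by
    filter_upwards [ae_fst_of_ae hν.ae_norm_eq_one] with z hz
    have h := abs_responseChange_le hSK hframe he hz z.2
    simp only [Prod.mk.eta] at h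
    have h2 : responseChange S Φ Ψ z ^ 2 ≤ (S * e * (√B + 1)) ^ 2 := by
      rw [← sq_abs]; gcongr
    gcongr
  refine ⟨Integrable.of_bound (Continuous.aestronglyMeasurable ?_)
    ((S * e * (√B + 1)) ^ 2 * Real.exp (s * (S * e * (√B + 1)))) ?_, hae⟩
  · have := continuous_responseChange (Φ := Φ) (Ψ := Ψ) hSK
    fun_prop
  · filter_upwards [hae] with z hz
    rwa [Real.norm_of_nonneg (by positivity)]

/-- A Bernstein type bound for the Laplace transform of the change of the response. -/
lemma integral_exp_responseChange_le (hSK : S ≤ K) (hframe : IsFrame Φ A B)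
    (hν : IsSymmetricOnSphere ν) (hη : IsSubgaussianNoise η ρ) {e : ℝ}
    (he : ∀ i, ‖Ψ i - Φ i‖ ≤ e) {s : ℝ} (hs : 0 ≤ s) :
    Integrable (fun z => Real.exp (s * responseChange S Φ Ψ z)) (ν.prod η) ∧
    ∫ z, Real.exp (s * responseChange S Φ Ψ z) ∂(ν.prod η) ≤
      Real.exp (s * ∫ z, responseChange S Φ Ψ z ∂(ν.prod η) + s ^ 2 / 2 *
        ∫ z, responseChange S Φ Ψ z ^ 2 * Real.exp (s * |responseChange S Φ Ψ z|)
          ∂(ν.prod η)) := by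
  have := hν.prob
  have := hη.prob
  have hD := integrable_responseChange (Ψ := Ψ) hSK hframe hν hη he
  have hF := (integrable_sq_mul_exp_responseChange (Ψ := Ψ) hSK hframe hν hη he hs).1
  have hI : Integrable (fun z => Real.exp (s * responseChange S Φ Ψ z)) (ν.prod η) := by
    refine Integrable.of_bound (Continuous.aestronglyMeasurable ?_)
      (Real.exp (s * (S * e * (√B + 1)))) ?_
    · have := continuous_responseChange (Φ := Φ) (Ψ := Ψ) hSK
      fun_prop
    · filter_upwards [ae_fst_of_ae hν.ae_norm_eq_one] with z hz
      have h := (abs_le.1 (abs_responseChange_le hSK hframe he hz z.2)).2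
      rw [Real.norm_of_nonneg (Real.exp_pos _).le]
      gcongr
  refine ⟨hI, ?_⟩
  have hl : Integrable (fun z => 1 + s * responseChange S Φ Ψ z) (ν.prod η) :=
    (integrable_const 1).add (hD.const_mul s)
  calc ∫ z, Real.exp (s * responseChange S Φ Ψ z) ∂(ν.prod η)
      ≤ ∫ z, (1 + s * responseChange S Φ Ψ z + s ^ 2 / 2 * (responseChange S Φ Ψ z ^ 2 *
          Real.exp (s * |responseChange S Φ Ψ z|))) ∂(ν.prod η) := by
        refine integral_mono hI (hl.add (hF.const_mul _)) fun z => ?_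
        have h := exp_le_one_add_add_sq (s * responseChange S Φ Ψ z)
        rw [abs_mul, abs_of_nonneg hs] at h
        simp only
        linarith
    _ = 1 + s * ∫ z, responseChange S Φ Ψ z ∂(ν.prod η) + s ^ 2 / 2 *
        ∫ z, responseChange S Φ Ψ z ^ 2 * Real.exp (s * |responseChange S Φ Ψ z|)
          ∂(ν.prod η) := by
        rw [integral_add hl (hF.const_mul _), integral_add (integrable_const 1) (hD.const_mul s),
          integral_const_mul, integral_const_mul]
        simp
    _ ≤ _ := by
        refine le_trans (le_of_eq ?_) (Real.add_one_le_exp _)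
        ring

/-- Pointwise bound of the second moment integrand where the noise is not atypically small. -/
lemma sq_mul_exp_responseChange_le (hS : 1 ≤ S) (hSK : S < K) (hframe : IsFrame Φ A B)
    {e c κ s : ℝ} (he0 : 0 < e) (he : ∀ i, ‖Ψ i - Φ i‖ ≤ e) (hs : 0 ≤ s) (hκ : 3 ≤ κ)
    (hsc : s * (c * S * e * (√B + 1)) ≤ 1 / 2) {x : EuclideanSpace ℝ (Fin K)}
    (hx : ‖x‖ = 1) (hgap : amp x (S + 1) < amp x S) {r : EuclideanSpace ℝ (Fin d)}
    (hr : noiseScale r ≤ c) {N : Set (EuclideanSpace ℝ (Fin K) × EuclideanSpace ℝ (Fin d))}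
    (hlin : (x, r) ∉ N → responseChange S Φ Ψ (x, r) = linearResponse S Φ Ψ (x, r)) :
    responseChange S Φ Ψ (x, r) ^ 2 * Real.exp (s * |responseChange S Φ Ψ (x, r)|) ≤
      (c * S * e * (√B + 1)) ^ 2 *
          ∑ i, 4 * Real.exp (3 - κ) * Real.cosh (κ * inner ℝ (e⁻¹ • (Ψ i - Φ i)) r) +
        N.indicator (fun _ => 2 * (c * S * e * (√B + 1)) ^ 2) (x, r) +
        4 * S * c ^ 2 *
          ∑ i, |topSign S x i| * (‖Ψ i - Φ i‖ ^ 2 * B + (inner ℝ (Ψ i - Φ i) r) ^ 2) := by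
  set D := responseChange S Φ Ψ (x, r) with hD
  set M := √B + 1 with hM
  have hM1 : 1 ≤ M := by rw [hM]; linarith [Real.sqrt_nonneg B]
  have hB0 : 0 ≤ B := hframe.lower_pos.le.trans hframe.le
  have hc : 0 < c := (noiseScale_pos r).trans_le hr
  have hS0 : (0 : ℝ) < S := by exact_mod_cast hS
  have hu : ∀ i, inner ℝ (Ψ i - Φ i) r = e * inner ℝ (e⁻¹ • (Ψ i - Φ i)) r := fun i => by
    rw [real_inner_smul_left, ← mul_assoc, mul_inv_cancel₀ he0.ne', one_mul]
  have hin : ∀ i, |inner ℝ (Ψ i - Φ i) (signal Φ x r)| ≤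
      c * (‖Ψ i - Φ i‖ * √B + |inner ℝ (Ψ i - Φ i) r|) := fun i =>
    (abs_inner_signal_le_noiseScale_mul hframe hx _ r).trans (by gcongr)
  have hf2 : 0 ≤ (c * S * e * M) ^ 2 *
      ∑ i, 4 * Real.exp (3 - κ) * Real.cosh (κ * inner ℝ (e⁻¹ • (Ψ i - Φ i)) r) :=
    mul_nonneg (sq_nonneg _) (Finset.sum_nonneg fun i _ => by
      have := (Real.cosh_pos (κ * inner ℝ (e⁻¹ • (Ψ i - Φ i)) r)).le
      positivity)
  have hf3 : 0 ≤ N.indicator (fun _ => 2 * (c * S * e * M) ^ 2) (x, r) :=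
    Set.indicator_nonneg (fun _ _ => by positivity) _
  have hf4 : 0 ≤ 4 * S * c ^ 2 *
      ∑ i, |topSign S x i| * (‖Ψ i - Φ i‖ ^ 2 * B + (inner ℝ (Ψ i - Φ i) r) ^ 2) :=
    mul_nonneg (by positivity) (Finset.sum_nonneg fun i _ => by positivity)
  have : Nonempty (Fin K) := ⟨⟨0, by omega⟩⟩
  -- The atom with the largest noise component decides the case: if that component, rescaled by
  -- `e⁻¹`, is at least `1`, the `cosh` sum pays; otherwise `|D|` is bounded and `exp (s |D|) ≤ 2`.
  obtain ⟨i₀, hi₀⟩ := Finite.exists_max fun i => |inner ℝ (e⁻¹ • (Ψ i - Φ i)) r|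
  set z := inner ℝ (e⁻¹ • (Ψ i₀ - Φ i₀)) r with hz
  have hDz : |D| ≤ c * S * e * (√B + |z|) := by
    have h1 : |D| ≤ S * (c * (e * √B + e * |z|)) := by
      refine abs_response_sub_le hSK.le fun i => (hin i).trans ?_
      rw [hu i, abs_mul, abs_of_pos he0]
      have h2 := he i
      have h3 := hi₀ i
      gcongr
    calc |D| ≤ S * (c * (e * √B + e * |z|)) := h1
      _ = _ := by ring
  rcases le_or_gt 1 |z| with hz1 | hz1
  · have h1 : |D| ≤ c * S * e * M * |z| := by
      calc |D| ≤ c * S * e * (√B + |z|) := hDz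
        _ ≤ c * S * e * (M * |z|) := by
            gcongr
            rw [hM]
            nlinarith [Real.sqrt_nonneg B]
        _ = _ := by ring
    have h2 : D ^ 2 ≤ (c * S * e * M) ^ 2 * z ^ 2 := by
      rw [← sq_abs D, ← sq_abs z, ← mul_pow]; gcongr
    have h3 : s * |D| ≤ |z| := by
      calc s * |D| ≤ s * (c * S * e * M * |z|) := by gcongr
        _ = s * (c * S * e * M) * |z| := by ring
        _ ≤ 1 / 2 * |z| := by gcongr
        _ ≤ |z| := by linarith [abs_nonneg z]
    have h4 := sq_mul_exp_le_of_one_le hκ hz1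
    have h5 : 4 * Real.exp (3 - κ) * Real.cosh (κ * z) ≤
        ∑ i, 4 * Real.exp (3 - κ) * Real.cosh (κ * inner ℝ (e⁻¹ • (Ψ i - Φ i)) r) :=
      Finset.single_le_sum (f := fun i => 4 * Real.exp (3 - κ) *
        Real.cosh (κ * inner ℝ (e⁻¹ • (Ψ i - Φ i)) r)) (fun i _ => by
          have := (Real.cosh_pos (κ * inner ℝ (e⁻¹ • (Ψ i - Φ i)) r)).le
          positivity) (Finset.mem_univ i₀)
    have h6 : D ^ 2 * Real.exp (s * |D|) ≤ (c * S * e * M) ^ 2 *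
        ∑ i, 4 * Real.exp (3 - κ) * Real.cosh (κ * inner ℝ (e⁻¹ • (Ψ i - Φ i)) r) := by
      calc D ^ 2 * Real.exp (s * |D|) ≤ (c * S * e * M) ^ 2 * z ^ 2 * Real.exp |z| := by gcongr
        _ = (c * S * e * M) ^ 2 * (z ^ 2 * Real.exp |z|) := by ring
        _ ≤ _ := by gcongr; exact h4.trans h5
    linarith
  · have h1 : |D| ≤ c * S * e * M := by
      refine hDz.trans ?_
      have : √B + |z| ≤ M := by rw [hM]; linarith
      gcongr
    have h3 : Real.exp (s * |D|) ≤ 2 := by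
      have h2 : s * |D| ≤ 1 / 2 := le_trans (by gcongr) hsc
      have := Real.exp_bound_div_one_sub_of_interval (x := 1 / 2) (by norm_num) (by norm_num)
      have h4 := Real.exp_le_exp.2 h2
      linarith
    by_cases hzN : (x, r) ∈ N
    · rw [Set.indicator_of_mem hzN]
      have h2 : D ^ 2 ≤ (c * S * e * M) ^ 2 := by
        rw [← sq_abs D]; gcongr
      have h4 : D ^ 2 * Real.exp (s * |D|) ≤ (c * S * e * M) ^ 2 * 2 := by gcongr
      linarith
    · have h2 : D ^ 2 ≤ S * ∑ i, |topSign S x i| *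
          (2 * c ^ 2 * (‖Ψ i - Φ i‖ ^ 2 * B + (inner ℝ (Ψ i - Φ i) r) ^ 2)) := by
        rw [hlin hzN, linearResponse]
        -- Cauchy-Schwarz with weights `|topSign|`. Keeping the weights in the second factor
        -- produces the factor `S / K` after integration.
        calc (∑ i, topSign S x i * inner ℝ (Ψ i - Φ i) (signal Φ x r)) ^ 2
            ≤ (∑ i, |topSign S x i|) *
              ∑ i, |topSign S x i| * (inner ℝ (Ψ i - Φ i) (signal Φ x r)) ^ 2 := by
              refine Finset.sum_sq_le_sum_mul_sum_of_sq_le_mul _ (fun i _ => abs_nonneg _)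
                (fun i _ => by positivity) fun i _ => le_of_eq ?_
              rw [mul_pow, ← sq_abs (topSign S x i)]
              ring
          _ ≤ S * ∑ i, |topSign S x i| *
              (2 * c ^ 2 * (‖Ψ i - Φ i‖ ^ 2 * B + (inner ℝ (Ψ i - Φ i) r) ^ 2)) := by
              refine mul_le_mul (sum_abs_topSign_le hS hSK hgap)
                (Finset.sum_le_sum fun i _ => ?_)
                (Finset.sum_nonneg fun i _ => by positivity) hS0.le
              refine mul_le_mul_of_nonneg_left ?_ (abs_nonneg _)
              have h5 : (inner ℝ (Ψ i - Φ i) (signal Φ x r)) ^ 2 ≤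
                  (c * (‖Ψ i - Φ i‖ * √B + |inner ℝ (Ψ i - Φ i) r|)) ^ 2 := by
                rw [← sq_abs]
                exact pow_le_pow_left₀ (abs_nonneg _) (hin i) 2
              refine h5.trans ?_
              rw [mul_pow, mul_comm (2 : ℝ), mul_assoc]
              refine mul_le_mul_of_nonneg_left ?_ (sq_nonneg c)
              have h6 := add_sq_le (a := ‖Ψ i - Φ i‖ * √B) (b := |inner ℝ (Ψ i - Φ i) r|)
              rwa [mul_pow, Real.sq_sqrt hB0, sq_abs] at h6
      have h4 : D ^ 2 * Real.exp (s * |D|) ≤ (S * ∑ i, |topSign S x i| *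
          (2 * c ^ 2 * (‖Ψ i - Φ i‖ ^ 2 * B + (inner ℝ (Ψ i - Φ i) r) ^ 2))) * 2 := by
        gcongr
      have h5 : (S * ∑ i, |topSign S x i| *
          (2 * c ^ 2 * (‖Ψ i - Φ i‖ ^ 2 * B + (inner ℝ (Ψ i - Φ i) r) ^ 2))) * 2 =
          4 * S * c ^ 2 * ∑ i, |topSign S x i| *
            (‖Ψ i - Φ i‖ ^ 2 * B + (inner ℝ (Ψ i - Φ i) r) ^ 2) := by
        rw [Finset.mul_sum, Finset.mul_sum, Finset.sum_mul]
        exact Finset.sum_congr rfl fun i _ => by ring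
      linarith

/-- The second moment of the change of the response, when the noise is typically large. -/
lemma integral_sq_mul_exp_responseChange_le (hS : 1 ≤ S) (hSK : S < K) (hframe : IsFrame Φ A B)
    (hν : IsSymmetricOnSphere ν) (hη : IsSubgaussianNoise η ρ) {β : ℝ} (hβ : 0 < β)
    (hgap : ∀ᵐ z ∂ν, β ≤ amp z S - amp z (S + 1)) {e c κ s : ℝ} (he0 : 0 < e)
    (he : ∀ i, ‖Ψ i - Φ i‖ ≤ e) (hs : 0 ≤ s) (hκ : 3 ≤ κ)
    (hsc : s * (c * S * e * (√B + 1)) ≤ 1 / 2)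
    {N : Set (EuclideanSpace ℝ (Fin K) × EuclideanSpace ℝ (Fin d))} (hN : MeasurableSet N)
    (hlin : ∀ᵐ z ∂(ν.prod η), z ∉ N → responseChange S Φ Ψ z = linearResponse S Φ Ψ z) :
    ∫ z, responseChange S Φ Ψ z ^ 2 * Real.exp (s * |responseChange S Φ Ψ z|) ∂(ν.prod η) ≤
      (S * e * (√B + 1)) ^ 2 * Real.exp (s * (S * e * (√B + 1))) *
          η.real {v | c < noiseScale v} +
        (c * S * e * (√B + 1)) ^ 2 *
          (K * (4 * Real.exp (3 - κ) * Real.exp (ρ ^ 2 * κ ^ 2 / 2))) +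
        2 * (c * S * e * (√B + 1)) ^ 2 * (ν.prod η).real N +
        4 * S * c ^ 2 * (S / K) * (B + 2 * ρ ^ 2) * ∑ i, ‖Ψ i - Φ i‖ ^ 2 := by
  have := hν.prob
  have := hη.prob
  have hB0 : 0 ≤ B := hframe.lower_pos.le.trans hframe.le
  have hmeas : MeasurableSet {v : EuclideanSpace ℝ (Fin d) | c < noiseScale v} :=
    measurableSet_lt measurable_const continuous_noiseScale.measurable
  set H := (S * e * (√B + 1)) ^ 2 * Real.exp (s * (S * e * (√B + 1))) with hH
  have hH0 : 0 ≤ H := by positivity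
  obtain ⟨hF, hFle⟩ :=
    integrable_sq_mul_exp_responseChange (Ψ := Ψ) hSK.le hframe hν hη he hs
  -- Four contributions: atypically small noise, a large noise component, the exceptional set, and
  -- the linear regime. The factors `1 *` in `f1` and `f2` put them in the product form that
  -- `integral_prod_mul` needs.
  set f1 : EuclideanSpace ℝ (Fin K) × EuclideanSpace ℝ (Fin d) → ℝ := fun z =>
    1 * ({v | c < noiseScale v}.indicator (fun _ => H) z.2) with hf1
  set f2 : EuclideanSpace ℝ (Fin K) × EuclideanSpace ℝ (Fin d) → ℝ := fun z =>
    1 * ((c * S * e * (√B + 1)) ^ 2 *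
      ∑ i, 4 * Real.exp (3 - κ) * Real.cosh (κ * inner ℝ (e⁻¹ • (Ψ i - Φ i)) z.2)) with hf2
  set f3 : EuclideanSpace ℝ (Fin K) × EuclideanSpace ℝ (Fin d) → ℝ :=
    N.indicator (fun _ => 2 * (c * S * e * (√B + 1)) ^ 2) with hf3
  set f4 : EuclideanSpace ℝ (Fin K) × EuclideanSpace ℝ (Fin d) → ℝ := fun z =>
    4 * S * c ^ 2 * ∑ i, |topSign S z.1 i| *
      (‖Ψ i - Φ i‖ ^ 2 * B + (inner ℝ (Ψ i - Φ i) z.2) ^ 2) with hf4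
  have hcosh : ∀ i, Integrable (fun v => 4 * Real.exp (3 - κ) *
      Real.cosh (κ * inner ℝ (e⁻¹ • (Ψ i - Φ i)) v)) η := fun i =>
    (hη.integrable_cosh_inner κ _).const_mul _
  have hquad : ∀ i, Integrable (fun v => ‖Ψ i - Φ i‖ ^ 2 * B + (inner ℝ (Ψ i - Φ i) v) ^ 2) η :=
    fun i => (integrable_const _).add (hη.integrable_inner_sq _)
  have hprod : ∀ i, Integrable (fun z : EuclideanSpace ℝ (Fin K) × EuclideanSpace ℝ (Fin d) =>
      |topSign S z.1 i| * (‖Ψ i - Φ i‖ ^ 2 * B + (inner ℝ (Ψ i - Φ i) z.2) ^ 2)) (ν.prod η) :=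
    fun i => (integrable_topSign i).abs.mul_prod (hquad i)
  have h2int : Integrable (fun v => (c * S * e * (√B + 1)) ^ 2 *
      ∑ i, 4 * Real.exp (3 - κ) * Real.cosh (κ * inner ℝ (e⁻¹ • (Ψ i - Φ i)) v)) η :=
    (integrable_finsetSum _ fun i _ => hcosh i).const_mul _
  have hi1 : Integrable f1 (ν.prod η) :=
    (integrable_const (μ := ν) (1 : ℝ)).mul_prod ((integrable_const (μ := η) H).indicator hmeas)
  have hi2 : Integrable f2 (ν.prod η) :=
    (integrable_const (μ := ν) (1 : ℝ)).mul_prod h2int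
  have hi3 : Integrable f3 (ν.prod η) := (integrable_const _).indicator hN
  have hi4 : Integrable f4 (ν.prod η) :=
    (integrable_finsetSum _ fun i _ => hprod i).const_mul _
  have hle : ∫ z, responseChange S Φ Ψ z ^ 2 * Real.exp (s * |responseChange S Φ Ψ z|)
      ∂(ν.prod η) ≤ ∫ z, (f1 z + f2 z + f3 z + f4 z) ∂(ν.prod η) := by
    refine integral_mono_ae hF (((hi1.add hi2).add hi3).add hi4) ?_
    filter_upwards [ae_fst_of_ae hν.ae_norm_eq_one, ae_fst_of_ae hgap, hlin, hFle]
      with z hz1 hz2 hz3 hz4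
    have hn2 : 0 ≤ f2 z := by
      simp only [hf2]
      refine mul_nonneg zero_le_one (mul_nonneg (sq_nonneg _) (Finset.sum_nonneg fun i _ => ?_))
      have := (Real.cosh_pos (κ * inner ℝ (e⁻¹ • (Ψ i - Φ i)) z.2)).le
      positivity
    have hn3 : 0 ≤ f3 z := Set.indicator_nonneg (fun _ _ => by positivity) _
    have hn4 : 0 ≤ f4 z :=
      mul_nonneg (by positivity) (Finset.sum_nonneg fun i _ => by positivity)
    rcases lt_or_ge c (noiseScale z.2) with hc | hc
    · have : f1 z = H := by
        simp only [hf1]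
        rw [Set.indicator_of_mem (by exact hc), one_mul]
      linarith
    · have h1 : f1 z = 0 := by
        simp only [hf1]
        rw [Set.indicator_of_notMem (by simpa using hc), mul_zero]
      have h := sq_mul_exp_responseChange_le (Ψ := Ψ) hS hSK hframe he0 he hs hκ hsc hz1
        (by linarith) hc (N := N) hz3
      have h2 : f2 z + f3 z + f4 z = (c * S * e * (√B + 1)) ^ 2 *
          ∑ i, 4 * Real.exp (3 - κ) * Real.cosh (κ * inner ℝ (e⁻¹ • (Ψ i - Φ i)) z.2) +
        N.indicator (fun _ => 2 * (c * S * e * (√B + 1)) ^ 2) (z.1, z.2) +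
        4 * S * c ^ 2 *
          ∑ i, |topSign S z.1 i| * (‖Ψ i - Φ i‖ ^ 2 * B + (inner ℝ (Ψ i - Φ i) z.2) ^ 2) := by
        simp only [hf2, hf3, hf4, one_mul, Prod.mk.eta]
      rw [← h2] at h
      simp only [Prod.mk.eta] at h
      linarith
  refine hle.trans ?_
  have hi12 : Integrable (fun z => f1 z + f2 z) (ν.prod η) := hi1.add hi2
  have hi123 : Integrable (fun z => f1 z + f2 z + f3 z) (ν.prod η) := hi12.add hi3
  rw [integral_add hi123 hi4, integral_add hi12 hi3, integral_add hi1 hi2]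
  have e1 : ∫ z, f1 z ∂(ν.prod η) = H * η.real {v | c < noiseScale v} := by
    rw [hf1, integral_prod_mul (fun _ : EuclideanSpace ℝ (Fin K) => (1 : ℝ))
      ({v : EuclideanSpace ℝ (Fin d) | c < noiseScale v}.indicator fun _ => H),
      integral_indicator_const _ hmeas]
    simp [mul_comm]
  have e2 : ∫ z, f2 z ∂(ν.prod η) ≤ (c * S * e * (√B + 1)) ^ 2 *
      (K * (4 * Real.exp (3 - κ) * Real.exp (ρ ^ 2 * κ ^ 2 / 2))) := by
    rw [hf2, integral_prod_mul (fun _ : EuclideanSpace ℝ (Fin K) => (1 : ℝ))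
      (fun v => (c * S * e * (√B + 1)) ^ 2 *
        ∑ i, 4 * Real.exp (3 - κ) * Real.cosh (κ * inner ℝ (e⁻¹ • (Ψ i - Φ i)) v)),
      integral_const_mul, integral_finsetSum _ fun i _ => hcosh i]
    simp only [integral_const, probReal_univ, smul_eq_mul, mul_one, one_mul]
    refine mul_le_mul_of_nonneg_left ?_ (sq_nonneg _)
    calc _ ≤ ∑ _i : Fin K, 4 * Real.exp (3 - κ) * Real.exp (ρ ^ 2 * κ ^ 2 / 2) := by
          refine Finset.sum_le_sum fun i _ => ?_
          rw [integral_const_mul]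
          gcongr
          refine (hη.integral_cosh_inner_le κ _).trans (Real.exp_le_exp.2 ?_)
          have h1 : ‖e⁻¹ • (Ψ i - Φ i)‖ ≤ 1 := by
            rw [norm_smul, norm_inv, Real.norm_of_nonneg he0.le, inv_mul_le_iff₀ he0, mul_one]
            exact he i
          have h2 : ‖e⁻¹ • (Ψ i - Φ i)‖ ^ 2 ≤ 1 := by
            have := norm_nonneg (e⁻¹ • (Ψ i - Φ i))
            nlinarith
          have h3 : (ρ : ℝ) ^ 2 * ‖e⁻¹ • (Ψ i - Φ i)‖ ^ 2 * κ ^ 2 ≤ ρ ^ 2 * 1 * κ ^ 2 := by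
            gcongr
          linarith
      _ = _ := by simp
  have e3 : ∫ z, f3 z ∂(ν.prod η) =
      2 * (c * S * e * (√B + 1)) ^ 2 * (ν.prod η).real N := by
    rw [hf3, integral_indicator_const _ hN, smul_eq_mul, mul_comm]
  have e4 : ∫ z, f4 z ∂(ν.prod η) ≤
      4 * S * c ^ 2 * (S / K) * (B + 2 * ρ ^ 2) * ∑ i, ‖Ψ i - Φ i‖ ^ 2 := by
    rw [hf4, integral_const_mul, integral_finsetSum _ fun i _ => hprod i]
    have hterm : ∀ i, ∫ z, |topSign S z.1 i| *
        (‖Ψ i - Φ i‖ ^ 2 * B + (inner ℝ (Ψ i - Φ i) z.2) ^ 2) ∂(ν.prod η) ≤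
        S / K * ((B + 2 * ρ ^ 2) * ‖Ψ i - Φ i‖ ^ 2) := fun i => by
      rw [integral_prod_mul (fun x : EuclideanSpace ℝ (Fin K) => |topSign S x i|)
        (fun v => ‖Ψ i - Φ i‖ ^ 2 * B + (inner ℝ (Ψ i - Φ i) v) ^ 2),
        hν.integral_abs_topSign hS hSK hβ hgap,
        integral_add (integrable_const _) (hη.integrable_inner_sq _)]
      refine mul_le_mul_of_nonneg_left ?_ (by positivity)
      have := hη.integral_inner_sq_le (Ψ i - Φ i)
      simp only [integral_const, probReal_univ, smul_eq_mul, one_mul]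
      linarith
    calc _ ≤ 4 * S * c ^ 2 * ∑ i, S / K * ((B + 2 * ρ ^ 2) * ‖Ψ i - Φ i‖ ^ 2) := by
          gcongr with i
          exact hterm i
      _ = _ := by
          rw [← Finset.mul_sum, ← Finset.mul_sum]; ring
  rw [e1, e3]
  linarith

end ResponseChange

/-! ### Numerical consequences of the conditions on precision, coherence and noise level. -/

section Constants

variable {K S : ℕ} {B C β γ μ ρ ε : ℝ}

lemma logArg_bound (hS : 1 ≤ S) (hSK : S < K) (hB : 1 ≤ B) (hC : 0 < C) (hC1 : C ≤ 1)
    (hβ : 0 < β) (hβ1 : β ≤ 1) (hγ : 0 < γ) (hγS : γ ≤ S) :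
    300 * (K : ℝ) ^ 2 ≤ C * logArg K S B C β γ ∧ 7 ≤ Real.log (logArg K S B C β γ) := by
  have hM : 1 ≤ √B := Real.one_le_sqrt.2 hB
  have hK2 : (2 : ℝ) ≤ K := by exact_mod_cast (by omega : 2 ≤ K)
  have h1 : C * logArg K S B C β γ = 150 * (K : ℝ) ^ 2 * S * (√B + 1) / (β * γ) := by
    unfold logArg; field_simp
  have h2 : 300 * (K : ℝ) ^ 2 ≤ C * logArg K S B C β γ := by
    rw [h1, le_div_iff₀ (by positivity)]
    have hβγ : β * γ ≤ S := by nlinarith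
    have h3 : 300 * (K : ℝ) ^ 2 * (β * γ) ≤ 300 * (K : ℝ) ^ 2 * S := by gcongr
    have h4 : (150 * (K : ℝ) ^ 2 * S) * 2 ≤ (150 * (K : ℝ) ^ 2 * S) * (√B + 1) := by
      gcongr; linarith
    linarith
  refine ⟨h2, ?_⟩
  have ha : 0 < logArg K S B C β γ := by
    have : (0 : ℝ) < S := by exact_mod_cast hS
    unfold logArg; positivity
  -- From `K ≥ 2` and `C ≤ 1`; and `exp 7 < 1200`.
  have h3 : 1200 ≤ logArg K S B C β γ := by nlinarith
  rw [Real.le_log_iff_exp_le ha]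
  refine le_trans ?_ h3
  have h4 : Real.exp 7 = Real.exp 1 ^ 7 := by rw [← Real.exp_nat_mul]; norm_num
  rw [h4]
  have h5 := Real.exp_one_lt_d9
  calc Real.exp 1 ^ 7 ≤ 2.7182818286 ^ 7 := by gcongr
    _ ≤ 1200 := by norm_num

/-- Split `1 / 48 = 1 / 81 + 11 / 1296`. The hypothesis gives `z² / 81 ≥ L`, and the rest beats the
factor `10 z` because `z ≥ 26`. -/
lemma mul_exp_neg_sq_le {L z : ℝ} (hL : 7 ≤ L) (hz : 9 / 4 + 9 * √L ≤ z) :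
    z * Real.exp (-(z ^ 2 / 48)) ≤ 1 / 10 * Real.exp (-L) := by
  have hsq : (5 / 2 : ℝ) ≤ √L := Real.le_sqrt_of_sq_le (by norm_num; linarith)
  have hz1 : 24 ≤ z := by linarith
  have hLz : L ≤ z ^ 2 / 81 := by
    have h1 : √L ≤ z / 9 := by linarith
    have h2 : √L ^ 2 ≤ (z / 9) ^ 2 := by gcongr
    rw [Real.sq_sqrt (by linarith)] at h2
    linarith
  have hz26 : 26 ≤ z := by
    have : (2.64 : ℝ) ≤ √L := Real.le_sqrt_of_sq_le (by norm_num; linarith)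
    linarith
  have hexp : 10 * z ≤ Real.exp (z ^ 2 * (11 / 1296)) := by
    have h0 : (280 : ℝ) ≤ Real.exp (5.7) := by
      have h1 : Real.exp 5.7 = Real.exp 1 ^ 5 * Real.exp 0.7 := by
        rw [← Real.exp_nat_mul, ← Real.exp_add]; norm_num
      have h2 := Real.quadratic_le_exp_of_nonneg (x := 0.7) (by norm_num)
      have h3 : (2.7182818283 : ℝ) ^ 5 ≤ Real.exp 1 ^ 5 := by
        have := Real.exp_one_gt_d9
        gcongr
      rw [h1]
      calc (280 : ℝ) ≤ 2.7182818283 ^ 5 * (1 + 0.7 + 0.7 ^ 2 / 2) := by norm_num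
        _ ≤ _ := by gcongr
    have h1 : Real.exp (z ^ 2 * (11 / 1296)) =
        Real.exp 5.7 * Real.exp (z ^ 2 * (11 / 1296) - 5.7) := by
      rw [← Real.exp_add]; ring_nf
    have h2 := Real.add_one_le_exp (z ^ 2 * (11 / 1296) - 5.7)
    have h3 : 0 ≤ z ^ 2 * (11 / 1296) - 5.7 + 1 := by nlinarith
    rw [h1]
    calc 10 * z ≤ 280 * (z ^ 2 * (11 / 1296) - 5.7 + 1) := by nlinarith
      _ ≤ _ := by gcongr
  calc z * Real.exp (-(z ^ 2 / 48))
      ≤ 1 / 10 * Real.exp (z ^ 2 * (11 / 1296)) * Real.exp (-(z ^ 2 / 48)) := by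
        gcongr; linarith
    _ = 1 / 10 * Real.exp (-(z ^ 2 / 81)) := by
        rw [mul_assoc, ← Real.exp_add]; ring_nf
    _ ≤ _ := by gcongr

lemma max_sq_of_nonneg (hμ : 0 ≤ μ) (hρ : 0 ≤ ρ) : max (μ ^ 2) (ρ ^ 2) = max μ ρ ^ 2 := by
  rcases le_total μ ρ with h | h
  · rw [max_eq_right h, max_eq_right (by gcongr)]
  · rw [max_eq_left h, max_eq_left (by gcongr)]

lemma max_sq_mul_log_le (hμ : 0 ≤ μ) {L : ℝ} (hL : 7 ≤ L)
    (hμρ : max μ ρ ≤ β / √(72 * (L + Real.log L))) :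
    max μ ρ ^ 2 * (72 * (L + Real.log L)) ≤ β ^ 2 := by
  have hlog : 0 ≤ Real.log L := Real.log_nonneg (by linarith)
  rw [le_div_iff₀ (by positivity)] at hμρ
  have h0 : 0 ≤ max μ ρ := le_max_of_le_left hμ
  have : (max μ ρ * √(72 * (L + Real.log L))) ^ 2 ≤ β ^ 2 := by gcongr
  rwa [mul_pow, Real.sq_sqrt (by positivity)] at this

/-- The third claim says that the nonlinear event is negligible against the drift. It is what the
two conditions and the second entry of the maximum in `precision` are designed for. -/
lemma precision_spec (hS : 1 ≤ S) (hSK : S < K) (hB : 1 ≤ B) (hC : 0 < C) (hC1 : C ≤ 1)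
    (hβ : 0 < β) (hβ1 : β ≤ 1) (hγ : 0 < γ) (hγS : γ ≤ S) (hμ : 0 ≤ μ) (hρ : 0 ≤ ρ) (hε : 0 < ε)
    (hεle : ε ≤ β / (9 / 4 + 9 * √(Real.log (logArg K S B C β γ))))
    (hμρ : max μ ρ ≤ β / √(72 * (Real.log (logArg K S B C β γ) +
      Real.log (Real.log (logArg K S B C β γ))))) :
    0 < precision K S B C β γ μ ρ ε ∧
    precision K S B C β γ μ ρ ε * (9 / 4 + 9 * √(Real.log (logArg K S B C β γ))) ≤ β ∧
    4 * K * Real.exp (-(β ^ 2 / (48 * max (max μ ρ) (precision K S B C β γ μ ρ ε) ^ 2))) ≤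
      C * γ * precision K S B C β γ μ ρ ε / (256 * S * K * (√B + 1)) := by
  obtain ⟨ha1, hL⟩ := logArg_bound hS hSK hB hC hC1 hβ hβ1 hγ hγS
  have hS0 : (0 : ℝ) < S := by exact_mod_cast hS
  have hK0 : (0 : ℝ) < K := by exact_mod_cast (by omega : 0 < K)
  have hM0 : 0 < √B + 1 := by positivity
  set M := √B + 1 with hM
  set a := logArg K S B C β γ with ha
  have ha0 : 0 < a := by rw [ha]; unfold logArg; positivity
  set L := Real.log a with hLdef
  have haL : Real.exp (-L) = 1 / a := by rw [Real.exp_neg, hLdef, Real.exp_log ha0, one_div]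
  have hcoef : 16 * S * (K : ℝ) ^ 2 * M / (C * γ) = 16 * β / 150 * a := by
    rw [ha]; unfold logArg; field_simp; exact hM
  set e := precision K S B C β γ μ ρ ε with he
  have hedef : e = max ε (16 * S * (K : ℝ) ^ 2 * M / (C * γ) * expTerm β μ ρ) := rfl
  have he0 : 0 < e := by rw [hedef]; exact lt_max_of_lt_left hε
  have hmL := max_sq_mul_log_le hμ hL hμρ
  have hlogL : 7 / 5 ≤ Real.log L := by
    have h1 : Real.log (4.2 : ℝ) ≤ Real.log L := Real.log_le_log (by norm_num) (by linarith)
    have h2 : (7 / 5 : ℝ) ≤ Real.log 4.2 := by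
      rw [Real.le_log_iff_exp_le (by norm_num)]
      have h3 : Real.exp (7 / 5) = Real.exp (1) * Real.exp (2 / 5) := by
        rw [← Real.exp_add]; norm_num
      have h4 := Real.exp_one_lt_d9
      have h5 : Real.exp (2 / 5) ≤ 1.53 := by
        have h7 := Real.exp_bound_div_one_sub_of_interval (x := 1 / 10) (by norm_num)
          (by norm_num)
        have h8 : Real.exp (2 / 5) = Real.exp (1 / 10) ^ 4 := by
          rw [← Real.exp_nat_mul]; norm_num
        rw [h8]
        calc Real.exp (1 / 10) ^ 4 ≤ (1 / (1 - 1 / 10)) ^ 4 := by gcongr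
          _ ≤ _ := by norm_num
      rw [h3]
      nlinarith [Real.exp_pos (2 / 5)]
    linarith
  have hexpTerm : expTerm β μ ρ ≤ 1 / (a * L) := by
    unfold expTerm
    split_ifs with h
    · positivity
    · rw [max_sq_of_nonneg hμ hρ] at h ⊢
      have hm : 0 < max μ ρ ^ 2 := lt_of_le_of_ne (sq_nonneg _) (Ne.symm h)
      have h2 : L + Real.log L ≤ β ^ 2 / (72 * max μ ρ ^ 2) := by
        rw [le_div_iff₀ (by positivity)]; linarith
      calc Real.exp (-(β ^ 2 / (72 * max μ ρ ^ 2))) ≤ Real.exp (-(L + Real.log L)) := by gcongr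
        _ = 1 / (a * L) := by
          rw [neg_add, Real.exp_add, haL, Real.exp_neg, Real.exp_log (by linarith)]
          field_simp
  have hsq : (5 / 2 : ℝ) ≤ √L := Real.le_sqrt_of_sq_le (by norm_num; linarith)
  have heβ : e * (9 / 4 + 9 * √L) ≤ β := by
    rw [← le_div_iff₀ (by positivity), hedef]
    refine max_le hεle ?_
    rw [hcoef]
    calc 16 * β / 150 * a * expTerm β μ ρ ≤ 16 * β / 150 * a * (1 / (a * L)) := by gcongr
      _ = 16 * β / (150 * L) := by field_simp
      _ ≤ β / (9 / 4 + 9 * √L) := by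
        rw [div_le_div_iff₀ (by positivity) (by positivity)]
        have hLs : L = √L ^ 2 := (Real.sq_sqrt (by linarith)).symm
        have : 16 * (9 / 4 + 9 * √L) ≤ 150 * L := by
          rw [hLs, Real.sqrt_sq (Real.sqrt_nonneg L)]; nlinarith
        calc 16 * β * (9 / 4 + 9 * √L) = β * (16 * (9 / 4 + 9 * √L)) := by ring
          _ ≤ β * (150 * L) := by gcongr
  refine ⟨he0, heβ, ?_⟩
  -- If `e` dominates, `mul_exp_neg_sq_le` applies with `z = β / e`. Otherwise split `1 / 48 = 1 /
  -- 72 + 1 / 144`: the first exponential is bounded through the definition of `e`, the second by `1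
  -- / 64` since `β² / (144 m²) ≥ (7 + 7 / 5) / 2 = 4.2`.
  rcases le_total (max μ ρ) e with hcase | hcase
  · rw [max_eq_right hcase]
    have hz : 9 / 4 + 9 * √L ≤ β / e := by rw [le_div_iff₀ he0]; linarith
    have h1 := mul_exp_neg_sq_le hL hz
    have h2 : (β / e) ^ 2 / 48 = β ^ 2 / (48 * e ^ 2) := by field_simp
    rw [h2, haL] at h1
    have h3 : Real.exp (-(β ^ 2 / (48 * e ^ 2))) ≤ e / β * (1 / 10 * (1 / a)) := by
      calc Real.exp (-(β ^ 2 / (48 * e ^ 2)))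
          = e / β * (β / e * Real.exp (-(β ^ 2 / (48 * e ^ 2)))) := by field_simp
        _ ≤ _ := by gcongr
    calc 4 * K * Real.exp (-(β ^ 2 / (48 * e ^ 2))) ≤ 4 * K * (e / β * (1 / 10 * (1 / a))) := by
          gcongr
      _ = C * γ * e / (375 * S * K * M) := by
          rw [ha]; unfold logArg; field_simp; ring
      _ ≤ _ := by gcongr; norm_num
  · rw [max_eq_left hcase]
    set m := max μ ρ with hm
    have hm0 : 0 < m := he0.trans_le hcase
    have hexp : expTerm β μ ρ = Real.exp (-(β ^ 2 / (72 * m ^ 2))) := by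
      unfold expTerm
      rw [max_sq_of_nonneg hμ hρ, if_neg (by positivity)]
    have h1 : 16 * S * (K : ℝ) ^ 2 * M / (C * γ) * Real.exp (-(β ^ 2 / (72 * m ^ 2))) ≤ e := by
      rw [hedef, ← hexp]; exact le_max_right _ _
    have h2 : Real.exp (-(β ^ 2 / (72 * m ^ 2))) ≤ C * γ * e / (16 * S * (K : ℝ) ^ 2 * M) := by
      rw [le_div_iff₀ (by positivity)]
      rw [div_mul_eq_mul_div, div_le_iff₀ (by positivity)] at h1
      linarith
    have h3 : Real.exp (-(β ^ 2 / (144 * m ^ 2))) ≤ 1 / 64 := by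
      have h4 : 4.2 ≤ β ^ 2 / (144 * m ^ 2) := by
        rw [le_div_iff₀ (by positivity)]
        nlinarith [sq_nonneg m]
      have h5 : Real.exp (-(4.2)) ≤ 1 / 64 := by
        rw [Real.exp_neg, ← one_div]
        refine one_div_le_one_div_of_le (by norm_num) ?_
        have h6 : Real.exp 4.2 = Real.exp 1 ^ 4 * Real.exp 0.2 := by
          rw [← Real.exp_nat_mul, ← Real.exp_add]; norm_num
        have h7 := Real.add_one_le_exp (0.2 : ℝ)
        have h8 : (2.7182818283 : ℝ) ^ 4 ≤ Real.exp 1 ^ 4 := by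
          have := Real.exp_one_gt_d9
          gcongr
        rw [h6]
        calc (64 : ℝ) ≤ 2.7182818283 ^ 4 * (0.2 + 1) := by norm_num
          _ ≤ _ := by gcongr
      exact (Real.exp_le_exp.2 (by linarith)).trans h5
    have h4 : Real.exp (-(β ^ 2 / (48 * m ^ 2))) =
        Real.exp (-(β ^ 2 / (72 * m ^ 2))) * Real.exp (-(β ^ 2 / (144 * m ^ 2))) := by
      rw [← Real.exp_add]
      congr 1
      field_simp
      norm_num
    rw [h4]
    calc 4 * K * (Real.exp (-(β ^ 2 / (72 * m ^ 2))) * Real.exp (-(β ^ 2 / (144 * m ^ 2))))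
        ≤ 4 * K * (C * γ * e / (16 * S * (K : ℝ) ^ 2 * M) * (1 / 64)) := by gcongr
      _ = _ := by field_simp; norm_num

/-- Converts the cross-term tail into the exponent of `precision_spec`: `0.49² / 10 ≥ 1 / 48`. -/
lemma sub_sq_div_le {e m b : ℝ} (hβ : 0 < β) (hβ1 : β ≤ 1) (he : 0 < e) (heβ : 24 * e ≤ β)
    (hm : 0 < m) (hb : b ≤ 5 * m ^ 2) (hb0 : 0 < b) :
    -((β / 2 - e ^ 2 / 4) ^ 2) / (2 * b) ≤ -(β ^ 2 / (48 * m ^ 2)) := by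
  have h1 : 0.49 * β ≤ β / 2 - e ^ 2 / 4 := by nlinarith
  have h2 : (0.49 * β) ^ 2 ≤ (β / 2 - e ^ 2 / 4) ^ 2 := by gcongr
  rw [neg_div, neg_le_neg_iff]
  rw [div_le_div_iff₀ (by positivity) (by positivity)]
  have h3 : β ^ 2 * (2 * b) ≤ β ^ 2 * (2 * (5 * m ^ 2)) := by gcongr
  have h4 : (0.49 * β) ^ 2 * (48 * m ^ 2) ≤ (β / 2 - e ^ 2 / 4) ^ 2 * (48 * m ^ 2) := by gcongr
  nlinarith [mul_pos (pow_pos hβ 2) (pow_pos hm 2)]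

end Constants

/-! ### Strong noise: the four second moment contributions when the noise constant is below `1 / 2`.
-/

section SmallNoiseConst

variable {K S d : ℕ} {B C γ ρ e m L a M s : ℝ}

/-- A small `C` forces a large mean square `m` by Jensen. Since `m ≤ 2 d ρ²` with `d ≤ K` and `ρ² ≤
1 / 504`, this is possible only for large `K`, quantitatively `C² K ≥ 64`. -/
lemma small_noiseConst_facts (hC : 0 < C) (hC2 : C < 1 / 2) (hm : 1 ≤ C ^ 2 * (1 + m))
    (hmd : m ≤ 2 * d * ρ ^ 2) (hdK : d ≤ K) (hL : 7 ≤ L) (hρL : 72 * ρ ^ 2 * L ≤ 1) :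
    0 < ρ ^ 2 ∧ 504 * ρ ^ 2 ≤ 1 ∧ 3 < m ∧ 64 ≤ C ^ 2 * K := by
  have hm3 : 3 < m := by nlinarith
  have hd : (d : ℝ) ≤ K := by exact_mod_cast hdK
  have hρ0 : 0 < ρ ^ 2 := by
    rcases (sq_nonneg ρ).eq_or_lt with h | h
    · rw [← h] at hmd; linarith
    · exact h
  have hρ1 : 504 * ρ ^ 2 ≤ 1 := by nlinarith
  refine ⟨hρ0, hρ1, hm3, ?_⟩
  have h1 : m ≤ 2 * K * ρ ^ 2 := hmd.trans (by gcongr)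
  have h2 : C ^ 2 * (1 + m) ≤ C ^ 2 * (4 / 3 * (2 * K * ρ ^ 2)) := by
    gcongr; linarith
  have h3 : 504 * (C ^ 2 * (4 / 3 * (2 * K * ρ ^ 2))) = (C ^ 2 * K) * (8 / 3) * (504 * ρ ^ 2) := by
    ring
  have h4 : 0 ≤ C ^ 2 * (K : ℝ) := by positivity
  nlinarith

/-- The value `κ = 1 / (3 ρ²)` minimises the exponent and turns it into `1 / 3 - 1 / (18 ρ²) ≤ -L`.
-/
lemma small_noiseConst_tail (hC : 0 < C) (hC1 : C ≤ 1) (hdK : d ≤ K) (hK : 1 ≤ K) (hρ0 : 0 < ρ ^ 2)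
    (hρ1 : 504 * ρ ^ 2 ≤ 1) (hρL : 72 * ρ ^ 2 * L ≤ 1) (hL : 7 ≤ L)
    (ha : 300 * (K : ℝ) ^ 2 ≤ C * Real.exp L) :
    12 * d * (Real.exp (-((1 / (3 * ρ ^ 2) - 1) / 3)) *
      Real.exp (ρ ^ 2 * (1 / (3 * ρ ^ 2)) ^ 2 / 2)) ≤ 1 := by
  have hd : (d : ℝ) ≤ K := by exact_mod_cast hdK
  have hK1 : (1 : ℝ) ≤ K := by exact_mod_cast hK
  rw [← Real.exp_add]
  have h1 : -((1 / (3 * ρ ^ 2) - 1) / 3) + ρ ^ 2 * (1 / (3 * ρ ^ 2)) ^ 2 / 2 =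
      1 / 3 - 1 / (18 * ρ ^ 2) := by
    field_simp; ring
  rw [h1]
  have h2 : 4 * L ≤ 1 / (18 * ρ ^ 2) := by
    rw [le_div_iff₀ (by positivity)]; linarith
  have h3 : 1 / 3 - 1 / (18 * ρ ^ 2) ≤ -L := by linarith
  have h4 : 300 * (K : ℝ) ^ 2 ≤ Real.exp L := ha.trans (by nlinarith [Real.exp_pos L])
  calc 12 * d * Real.exp (1 / 3 - 1 / (18 * ρ ^ 2)) ≤ 12 * K * Real.exp (-L) := by gcongr
    _ ≤ Real.exp L * Real.exp (-L) := by gcongr; nlinarith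
    _ = 1 := by rw [← Real.exp_add]; simp

/-- Atypically small noise: Jensen gives `1 ≤ C⁴ (1 + m)²`, so `exp (-m)` is itself of order `C⁴`,
and the weight `exp t` costs at most `exp (m / 2)`. -/
lemma small_noiseConst_typical_le {t tail : ℝ} (hC : 0 < C) (hC1 : C ≤ 1)
    (hm : 1 ≤ C ^ 2 * (1 + m)) (hm3 : 3 < m) (ht : t ≤ 1 / (8192 * C))
    (htail : tail ≤ Real.exp (-(2 * m))) : Real.exp t * tail ≤ 5 * C ^ 4 := by
  have hC2 : C ^ 2 ≤ C := by nlinarith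
  have hinv : 1 / C ≤ 1 + m := by
    rw [div_le_iff₀ hC]
    have : C ^ 2 * (1 + m) ≤ C * (1 + m) := by gcongr
    linarith
  have h3 : t ≤ m / 2 := by
    have : 1 / (8192 * C) = 1 / C / 8192 := by field_simp
    rw [this] at ht
    linarith
  have h5 : 1 ≤ C ^ 4 * (1 + m) ^ 2 := by
    have : 1 ^ 2 ≤ (C ^ 2 * (1 + m)) ^ 2 := by gcongr
    calc (1 : ℝ) = 1 ^ 2 := by norm_num
      _ ≤ _ := this
      _ = _ := by ring
  have h6 : (1 + m) ^ 2 ≤ 4 * Real.exp m := by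
    have := Real.quadratic_le_exp_of_nonneg (x := m) (by linarith)
    nlinarith
  calc Real.exp t * tail ≤ Real.exp (m / 2) * Real.exp (-(2 * m)) := by
        refine (mul_le_mul_of_nonneg_left htail (Real.exp_pos _).le).trans ?_
        gcongr
    _ ≤ Real.exp (-m) := by
        rw [← Real.exp_add, Real.exp_le_exp]; linarith
    _ = Real.exp (-m) * 1 := (mul_one _).symm
    _ ≤ Real.exp (-m) * (C ^ 4 * (1 + m) ^ 2) := by gcongr
    _ ≤ Real.exp (-m) * (C ^ 4 * (4 * Real.exp m)) := by gcongr
    _ = 4 * C ^ 4 * (Real.exp (-m) * Real.exp m) := by ring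
    _ = 4 * C ^ 4 := by rw [← Real.exp_add]; simp
    _ ≤ 5 * C ^ 4 := by gcongr; norm_num

/-- Large noise components: `κ = 1 / ρ²` minimises the exponent, leaving `3 - 1 / (2 ρ²) ≤ -2 L`,
and `exp (-2 L)` is at most a multiple of `C² / K⁴`. -/
lemma small_noiseConst_cosh_le (hL : 7 ≤ L) (hρ0 : 0 < ρ ^ 2) (hρL : 72 * ρ ^ 2 * L ≤ 1)
    (hK1 : (1 : ℝ) ≤ K) (ha : 300 * (K : ℝ) ^ 2 ≤ C * Real.exp L) :
    256 * (K : ℝ) *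
      (Real.exp (3 - 1 / ρ ^ 2) * Real.exp (ρ ^ 2 * (1 / ρ ^ 2) ^ 2 / 2)) ≤ 5 * C ^ 2 := by
  have h3 : Real.exp (3 - 1 / ρ ^ 2) * Real.exp (ρ ^ 2 * (1 / ρ ^ 2) ^ 2 / 2) ≤
      Real.exp (-L) ^ 2 := by
    rw [← Real.exp_add, ← Real.exp_nat_mul, Real.exp_le_exp]
    have h4 : 3 - 1 / ρ ^ 2 + ρ ^ 2 * (1 / ρ ^ 2) ^ 2 / 2 = 3 - 1 / (2 * ρ ^ 2) := by
      field_simp; ring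
    have h5 : 36 * L ≤ 1 / (2 * ρ ^ 2) := by
      rw [le_div_iff₀ (by positivity)]; linarith
    rw [h4]
    push_cast
    linarith
  have h4 : Real.exp (-L) * (300 * (K : ℝ) ^ 2) ≤ C := by
    calc Real.exp (-L) * (300 * (K : ℝ) ^ 2) ≤ Real.exp (-L) * (C * Real.exp L) := by gcongr
      _ = C * (Real.exp (-L) * Real.exp L) := by ring
      _ = C := by rw [← Real.exp_add]; simp
  have h5 : Real.exp (-L) ^ 2 * (90000 * (K : ℝ) ^ 4) ≤ C ^ 2 := by
    have h6 : (Real.exp (-L) * (300 * (K : ℝ) ^ 2)) ^ 2 ≤ C ^ 2 := by gcongr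
    calc _ = (Real.exp (-L) * (300 * (K : ℝ) ^ 2)) ^ 2 := by ring
      _ ≤ _ := h6
  have h7 : (K : ℝ) ≤ K ^ 4 := le_self_pow₀ hK1 (by norm_num)
  calc 256 * (K : ℝ) * (Real.exp (3 - 1 / ρ ^ 2) * Real.exp (ρ ^ 2 * (1 / ρ ^ 2) ^ 2 / 2))
      ≤ 256 * (K : ℝ) ^ 4 * Real.exp (-L) ^ 2 := by gcongr
    _ ≤ Real.exp (-L) ^ 2 * (90000 * (K : ℝ) ^ 4) := by
        have : 0 ≤ (K : ℝ) ^ 4 * Real.exp (-L) ^ 2 := by positivity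
        linarith
    _ ≤ 5 * C ^ 2 := by linarith [sq_nonneg C]

/-- The sum of the four contributions to the second moment is small enough. -/
lemma small_noiseConst_sum_le {p tail : ℝ} (hS : 1 ≤ S) (hC : 0 < C)
    (hC1 : C ≤ 1) (hm : 1 ≤ C ^ 2 * (1 + m)) (hm3 : 3 < m) (hL : 7 ≤ L) (hρ0 : 0 < ρ ^ 2)
    (hρL : 72 * ρ ^ 2 * L ≤ 1) (hCK : 64 ≤ C ^ 2 * K) (ha : 300 * (K : ℝ) ^ 2 ≤ C * Real.exp L)
    (he : 0 < e) (he1 : e ≤ 1) (hγ : 0 < γ) (hγS : γ ≤ S) (hM : 2 ≤ M)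
    (hs : s = γ / (64 * C ^ 3 * S ^ 2 * K * M ^ 2)) (hBM : B + 2 * ρ ^ 2 ≤ M ^ 2)
    (hp : p ≤ C * γ * e / (256 * S * K * M)) (htail : tail ≤ Real.exp (-(2 * m))) :
    s * (8 * C * S * e * M) ≤ 1 / 2 ∧
    (S * e * M) ^ 2 * Real.exp (s * (S * e * M)) * tail +
      (8 * C * S * e * M) ^ 2 *
        (K * (4 * Real.exp (3 - 1 / ρ ^ 2) * Real.exp (ρ ^ 2 * (1 / ρ ^ 2) ^ 2 / 2))) +
      2 * (8 * C * S * e * M) ^ 2 * p +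
      4 * S * (8 * C) ^ 2 * (S / K) * (B + 2 * ρ ^ 2) * e ^ 2 ≤
      20 * C ^ 4 * S ^ 2 * M ^ 2 * e ^ 2 := by
  have hS1 : (1 : ℝ) ≤ S := by exact_mod_cast hS
  have hC2 : C ^ 2 ≤ 1 := pow_le_one₀ hC.le hC1
  have hK64 : (64 : ℝ) ≤ K := by
    have : C ^ 2 * (K : ℝ) ≤ 1 * K := by gcongr
    linarith
  have hK0 : (0 : ℝ) < K := by linarith
  have hM0 : 0 < M := by linarith
  have hS0 : (0 : ℝ) < S := by linarith
  have hse : s * (S * e * M) = (γ / S) * e / M * (1 / (64 * C * (C ^ 2 * K))) := by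
    rw [hs]; field_simp
  have hγS1 : γ / S ≤ 1 := by rw [div_le_one hS0]; exact hγS
  have h1 : (γ / S) * e / M ≤ 1 / 2 := by
    rw [div_le_iff₀ hM0]
    have : (γ / S) * e ≤ 1 * 1 := mul_le_mul hγS1 he1 he.le (by norm_num)
    linarith
  have h2 : s * (S * e * M) ≤ 1 / (8192 * C) := by
    rw [hse]
    have h3 : 1 / (64 * C * (C ^ 2 * K)) ≤ 1 / (64 * C * 64) := by gcongr
    calc _ ≤ 1 / 2 * (1 / (64 * C * 64)) := by gcongr
      _ = _ := by field_simp; norm_num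
  refine ⟨?_, ?_⟩
  · calc s * (8 * C * S * e * M) = 8 * C * (s * (S * e * M)) := by ring
      _ ≤ 8 * C * (1 / (8192 * C)) := by gcongr
      _ ≤ 1 / 2 := by field_simp; norm_num
  have q1 := small_noiseConst_typical_le hC hC1 hm hm3 h2 htail
  have q2 := small_noiseConst_cosh_le hL hρ0 hρL (by linarith) ha
  have q3 : 128 * p ≤ 5 * C ^ 2 := by
    have h4 : C * γ * e / (256 * S * K * M) = C * ((γ / S) * e / M) / (256 * K) := by
      field_simp
    have h5 : C * ((γ / S) * e / M) / (256 * K) ≤ 1 * (1 / 2) / (256 * K) := by gcongr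
    have h6 : 1 / (K : ℝ) ≤ C ^ 2 := by rw [div_le_iff₀ hK0]; linarith
    have h7 : (1 : ℝ) * (1 / 2) / (256 * K) = 1 / 512 * (1 / K) := by field_simp; norm_num
    rw [h7] at h5
    have h8 : 128 * p ≤ 1 / 4 * (1 / K) := by
      have := hp.trans (h4.le.trans h5)
      linarith
    have h9 : 0 ≤ C ^ 2 := sq_nonneg C
    linarith
  have q4 : 64 / (K : ℝ) ≤ C ^ 2 := by rw [div_le_iff₀ hK0]; linarith
  -- The linear regime: `C² K ≥ 64` trades `64 / K` for `C²`. The contributions amount to `5 + 5 + 5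
  -- + 4 ≤ 20` in units of `C⁴ S² M² e²`.
  have q4' : 4 * S * (8 * C) ^ 2 * (S / K) * (B + 2 * ρ ^ 2) * e ^ 2 ≤
      4 * C ^ 2 * S ^ 2 * C ^ 2 * M ^ 2 * e ^ 2 := by
    calc _ = 4 * C ^ 2 * S ^ 2 * (64 / K) * (B + 2 * ρ ^ 2) * e ^ 2 := by ring
      _ ≤ 4 * C ^ 2 * S ^ 2 * (64 / K) * M ^ 2 * e ^ 2 := by gcongr
      _ ≤ 4 * C ^ 2 * S ^ 2 * C ^ 2 * M ^ 2 * e ^ 2 := by gcongr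
  have w1 := mul_le_mul_of_nonneg_left q1 (sq_nonneg (S * e * M))
  have w2 := mul_le_mul_of_nonneg_left q2 (sq_nonneg (C * S * e * M))
  have w3 := mul_le_mul_of_nonneg_left q3 (sq_nonneg (C * S * e * M))
  have hX : 0 ≤ C ^ 4 * S ^ 2 * M ^ 2 * e ^ 2 := by positivity
  generalize Real.exp (3 - 1 / ρ ^ 2) = E1 at w2 ⊢
  generalize Real.exp (ρ ^ 2 * (1 / ρ ^ 2) ^ 2 / 2) = E2 at w2 ⊢
  generalize Real.exp (s * (S * e * M)) = E3 at w1 ⊢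
  linarith

end SmallNoiseConst

/-! ### Estimates for a fixed dictionary on the sphere. -/

section Sample

variable {d K S : ℕ} {Φ Ψ : Fin K → EuclideanSpace ℝ (Fin d)} {A B : ℝ}
  {ν : Measure (EuclideanSpace ℝ (Fin K))} {η : Measure (EuclideanSpace ℝ (Fin d))} {ρ : ℝ≥0}

lemma abs_inner_le_coherence (Φ : Fin K → EuclideanSpace ℝ (Fin d)) {i k : Fin K} (h : i ≠ k) :
    |inner ℝ (Φ i) (Φ k)| ≤ coherence Φ :=
  le_ciSup (f := fun p : {p : Fin K × Fin K // p.1 ≠ p.2} => |inner ℝ (Φ p.1.1) (Φ p.1.2)|)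
    (Set.finite_range _).bddAbove ⟨(i, k), h⟩

lemma coherence_nonneg (Φ : Fin K → EuclideanSpace ℝ (Fin d)) : 0 ≤ coherence Φ :=
  Real.iSup_nonneg fun _ => abs_nonneg _

lemma inner_of_mem_dictionaries (hΦ : Φ ∈ dictionaries d K) (hΨ : Ψ ∈ dictionaries d K)
    (i : Fin K) : inner ℝ (Ψ i) (Φ i) = 1 - ‖Ψ i - Φ i‖ ^ 2 / 2 := by
  have h := inner_sub_self_of_norm_eq_one (hΨ i) (hΦ i)
  rw [inner_sub_left, real_inner_self_eq_norm_sq, hΦ i] at h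
  linarith

lemma abs_inner_le_coherence_add (hΦ : Φ ∈ dictionaries d K) {e : ℝ} (he : ∀ i, ‖Ψ i - Φ i‖ ≤ e)
    {i k : Fin K} (h : k ≠ i) : |inner ℝ (Ψ i) (Φ k)| ≤ coherence Φ + e := by
  have h1 : inner ℝ (Ψ i) (Φ k) = inner ℝ (Φ i) (Φ k) + inner ℝ (Ψ i - Φ i) (Φ k) := by
    rw [inner_sub_left]; ring
  rw [h1]
  refine (abs_add_le _ _).trans (add_le_add (abs_inner_le_coherence Φ h.symm) ?_)
  refine (abs_real_inner_le_norm _ _).trans ?_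
  rw [hΦ k, mul_one]
  exact he i

/-- Outside an event of small probability the change of the response is linear. -/
lemma exists_responseChange_eq_linearResponse (hS : 1 ≤ S) (hSK : S < K)
    (hΦ : Φ ∈ dictionaries d K) (hΨ : Ψ ∈ dictionaries d K)
    (hν : IsSymmetricOnSphere ν) (hη : IsSubgaussianNoise η ρ) {β : ℝ} (hβ : 0 < β) (hβ1 : β ≤ 1)
    (hgap : ∀ᵐ z ∂ν, β ≤ amp z S - amp z (S + 1)) {e : ℝ} (he0 : 0 < e) (heβ : 24 * e ≤ β)
    (he : ∀ i, ‖Ψ i - Φ i‖ ≤ e) :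
    ∃ N : Set (EuclideanSpace ℝ (Fin K) × EuclideanSpace ℝ (Fin d)), MeasurableSet N ∧
      (ν.prod η).real N ≤
        4 * K * Real.exp (-(β ^ 2 / (48 * max (max (coherence Φ) ρ) e ^ 2))) ∧
      ∀ᵐ z ∂(ν.prod η), z ∉ N → responseChange S Φ Ψ z = linearResponse S Φ Ψ z := by
  have := hν.prob
  have := hη.prob
  have hμ := coherence_nonneg Φ
  -- With `q = e² / 2`, the largest loss in `⟪ψ_i, φ_i⟫`, this makes `2 t + q` equal to `β`.
  set t := β / 2 - e ^ 2 / 4 with ht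
  set m := max (max (coherence Φ) (ρ : ℝ)) e with hm
  have hme : e ≤ m := le_max_right _ _
  have hmμ : coherence Φ ≤ m := (le_max_left _ _).trans (le_max_left _ _)
  have hmρ : (ρ : ℝ) ≤ m := (le_max_right _ _).trans (le_max_left _ _)
  have hm0 : 0 < m := he0.trans_le hme
  have ht0 : 0 < t := by rw [ht]; nlinarith
  set b : ℝ≥0 := ⟨coherence Φ + e, by positivity⟩ with hb
  have hbv : (b : ℝ) = coherence Φ + e := rfl
  have hb0 : 0 < (b : ℝ) ^ 2 + (ρ : ℝ) ^ 2 := by rw [hbv]; positivity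
  -- The off-diagonal products are at most `μ + e ≤ 2 m`, whence `4 m² + m²`.
  have hb5 : (b : ℝ) ^ 2 + (ρ : ℝ) ^ 2 ≤ 5 * m ^ 2 := by
    have h1 : (b : ℝ) ^ 2 ≤ (2 * m) ^ 2 := by
      rw [hbv]
      gcongr
      linarith
    have h2 : (ρ : ℝ) ^ 2 ≤ m ^ 2 := by gcongr
    linarith
  have hexp := Real.exp_le_exp.2 (sub_sq_div_le hβ hβ1 he0 heβ hm0 hb5 hb0)
  have hself : ∀ i, ‖Φ i - Φ i‖ ≤ e := fun i => by simpa using he0.le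
  have hbad : ∀ Ψ' ∈ dictionaries d K, (∀ i, ‖Ψ' i - Φ i‖ ≤ e) →
      (ν.prod η).real {z | ∃ i, t ≤ |crossTerm Φ Ψ' i z|} ≤
        2 * K * Real.exp (-(β ^ 2 / (48 * m ^ 2))) := fun Ψ' hΨ' he' => by
    refine (measureReal_le_abs_crossTerm_le hν hη hΨ' (b := b)
      (fun i k hk => abs_inner_le_coherence_add hΦ he' hk) ht0.le).trans ?_
    gcongr
  have hmeas : ∀ Ψ' : Fin K → EuclideanSpace ℝ (Fin d),
      MeasurableSet {z | ∃ i, t ≤ |crossTerm Φ Ψ' i z|} := fun Ψ' => by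
    rw [Set.ofPred_exists]
    exact MeasurableSet.iUnion fun i =>
      measurableSet_le measurable_const (continuous_crossTerm i).abs.measurable
  refine ⟨{z | ∃ i, t ≤ |crossTerm Φ Ψ i z|} ∪ {z | ∃ i, t ≤ |crossTerm Φ Φ i z|},
    (hmeas Ψ).union (hmeas Φ), ?_, ?_⟩
  · refine (measureReal_union_le _ _).trans ?_
    linarith [hbad Ψ hΨ he, hbad Φ hΦ hself]
  · filter_upwards [ae_fst_of_ae hν.ae_norm_eq_one, ae_fst_of_ae hgap] with z hz1 hz2 hz
    have hlin : ∀ Ψ' ∈ dictionaries d K, (∀ i, ‖Ψ' i - Φ i‖ ≤ e) →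
        z ∉ {z | ∃ i, t ≤ |crossTerm Φ Ψ' i z|} → response S Ψ' (signal Φ z.1 z.2) =
          ∑ i, topSign S z.1 i * inner ℝ (Ψ' i) (signal Φ z.1 z.2) := fun Ψ' hΨ' he' hz' => by
      refine response_eq_sum_topSign hS hSK (q := e ^ 2 / 2) (t := t) hz1 hz2 (fun i => ?_)
        (fun i => ?_) (by positivity) (by nlinarith) ht0 (by rw [ht]; linarith) fun i => ?_
      · rw [inner_of_mem_dictionaries hΦ hΨ' i]
        have : ‖Ψ' i - Φ i‖ ^ 2 ≤ e ^ 2 := by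
          have := he' i
          gcongr
        linarith
      · rw [inner_of_mem_dictionaries hΦ hΨ' i]
        linarith [sq_nonneg ‖Ψ' i - Φ i‖]
      · by_contra hcon
        exact hz' ⟨i, not_lt.1 hcon⟩
    rw [responseChange, hlin Ψ hΨ he fun h => hz (Or.inl h),
      hlin Φ hΦ hself fun h => hz (Or.inr h), linearResponse, ← Finset.sum_sub_distrib]
    refine Finset.sum_congr rfl fun i _ => ?_
    rw [inner_sub_left]
    ring

/-- The second moment of the change of the response is at most of the order of the fourth power
of the noise constant. -/
lemma integral_sq_mul_exp_responseChange_le_noiseConst (hS : 1 ≤ S) (hSK : S < K)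
    (hB : 1 ≤ B) (hframe : IsFrame Φ A B)
    (hν : IsSymmetricOnSphere ν) (hη : IsSubgaussianNoise η ρ) {β : ℝ} (hβ : 0 < β)
    (hgap : ∀ᵐ z ∂ν, β ≤ amp z S - amp z (S + 1)) {e L γ s : ℝ} (he0 : 0 < e)
    (he1 : 24 * e ≤ 1) (he : ∀ i, ‖Ψ i - Φ i‖ ≤ e) (hsum : ∑ i, ‖Ψ i - Φ i‖ ^ 2 = e ^ 2)
    (hL : 7 ≤ L) (hρL : 72 * (ρ : ℝ) ^ 2 * L ≤ 1)
    (ha : 300 * (K : ℝ) ^ 2 ≤ noiseConst η * Real.exp L) (hγ : 0 < γ) (hγS : γ ≤ S)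
    (hs : s = γ / (64 * noiseConst η ^ 3 * S ^ 2 * K * (√B + 1) ^ 2))
    {N : Set (EuclideanSpace ℝ (Fin K) × EuclideanSpace ℝ (Fin d))} (hN : MeasurableSet N)
    (hp : (ν.prod η).real N ≤ noiseConst η * γ * e / (256 * S * K * (√B + 1)))
    (hlin : ∀ᵐ z ∂(ν.prod η), z ∉ N → responseChange S Φ Ψ z = linearResponse S Φ Ψ z) :
    ∫ z, responseChange S Φ Ψ z ^ 2 * Real.exp (s * |responseChange S Φ Ψ z|) ∂(ν.prod η) ≤
      20 * noiseConst η ^ 4 * S ^ 2 * (√B + 1) ^ 2 * e ^ 2 := by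
  have := hν.prob
  have := hη.prob
  have hC := hη.noiseConst_pos
  have hC1 := noiseConst_le_one (η := η)
  have hm := hη.one_le_noiseConst_sq_mul
  have hmd := hη.integral_norm_sq_le
  have hS0 : (0 : ℝ) < S := by exact_mod_cast hS
  have hK2 : (2 : ℝ) ≤ K := by exact_mod_cast (by omega : 2 ≤ K)
  have hM2 : 2 ≤ √B + 1 := by linarith [Real.one_le_sqrt.2 hB]
  have hBM : B + 2 * (ρ : ℝ) ^ 2 ≤ (√B + 1) ^ 2 := by
    have h1 : √B ^ 2 = B := Real.sq_sqrt (by linarith)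
    have h2 : 2 * (ρ : ℝ) ^ 2 ≤ 1 := by nlinarith [sq_nonneg (ρ : ℝ)]
    nlinarith
  set C := noiseConst η with hCdef
  set M := √B + 1 with hMdef
  have hs0 : 0 ≤ s := by rw [hs]; positivity
  -- For `C ≥ 1 / 2` the crude bound suffices, because `20 C⁴ ≥ 5 / 4` dominates the exponential
  -- weight.
  rcases lt_or_ge C (1 / 2) with hC2 | hC2
  · obtain ⟨hρ0, hρ1, hm3, hCK⟩ :=
      small_noiseConst_facts hC hC2 hm hmd hframe.card_le hL hρL
    have hκ : 3 ≤ 1 / (ρ : ℝ) ^ 2 := by rw [le_div_iff₀ hρ0]; linarith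
    have htail := hη.measureReal_noiseScale_gt_le (κ := 1 / (3 * (ρ : ℝ) ^ 2))
      (by rw [le_div_iff₀ (by positivity)]; linarith)
      (small_noiseConst_tail hC hC1 hframe.card_le (by omega) hρ0 hρ1 hρL hL ha)
    obtain ⟨h1, h2⟩ := small_noiseConst_sum_le hS hC hC1 hm hm3 hL hρ0 hρL hCK ha he0
      (by linarith) hγ hγS hM2 hs hBM hp htail
    refine (integral_sq_mul_exp_responseChange_le hS hSK hframe hν hη hβ hgap he0 he hs0 hκ h1
      hN hlin).trans ?_
    rw [hsum]
    exact h2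
  · obtain ⟨hF, hFle⟩ :=
      integrable_sq_mul_exp_responseChange (Ψ := Ψ) hSK.le hframe hν hη he hs0
    have h1 : s * (S * e * M) ≤ 1 / 10 := by
      have h2 : s * (S * e * M) = (γ / S) * (e / M / K) / (64 * C ^ 3) := by
        rw [hs]; field_simp
      have h3 : γ / S ≤ 1 := by rw [div_le_one hS0]; exact hγS
      have h4 : e / M / K ≤ 1 / 2 / 2 := by
        have : e ≤ 1 := by linarith
        gcongr
      have h5 : 64 * (1 / 2) ^ 3 ≤ 64 * C ^ 3 := by gcongr
      rw [h2]
      calc (γ / S) * (e / M / K) / (64 * C ^ 3) ≤ 1 * (1 / 2 / 2) / (64 * (1 / 2) ^ 3) := by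
            gcongr
        _ ≤ _ := by norm_num
    have h2 : Real.exp (s * (S * e * M)) ≤ 5 / 4 := by
      have h3 := Real.exp_bound_div_one_sub_of_interval (x := 1 / 10) (by norm_num) (by norm_num)
      have h4 := Real.exp_le_exp.2 h1
      norm_num at h3
      linarith
    have h3 : (1 / 2) ^ 4 ≤ C ^ 4 := by gcongr
    calc _ ≤ ∫ _z, (S * e * M) ^ 2 * Real.exp (s * (S * e * M)) ∂(ν.prod η) :=
          integral_mono_ae hF (integrable_const _) hFle
      _ = (S * e * M) ^ 2 * Real.exp (s * (S * e * M)) := by simp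
      _ ≤ (S * e * M) ^ 2 * (20 * C ^ 4) := by
          gcongr
          linarith
      _ = _ := by ring

/-- In units of `s C γ e² / K`, the drift contributes `-1 / 2`, the exceptional set at most `1 /
128` and the second moment at most `5 / 32`; together at most `-5 / 16`. -/
lemma integral_exp_responseChange_le_of_sum_eq (hS : 1 ≤ S) (hSK : S < K) (hB : 1 ≤ B)
    (hΦ : Φ ∈ dictionaries d K) (hΨ : Ψ ∈ dictionaries d K) (hframe : IsFrame Φ A B)
    (hν : IsSymmetricOnSphere ν) (hη : IsSubgaussianNoise η ρ) {β : ℝ} (hβ : 0 < β) (hβ1 : β ≤ 1)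
    (hgap : ∀ᵐ z ∂ν, β ≤ amp z S - amp z (S + 1)) {e L s : ℝ} (he0 : 0 < e)
    (heβ : 24 * e ≤ β) (hsum : ∑ i, ‖Ψ i - Φ i‖ ^ 2 = e ^ 2)
    (hL : 7 ≤ L) (hρL : 72 * (ρ : ℝ) ^ 2 * L ≤ 1)
    (ha : 300 * (K : ℝ) ^ 2 ≤ noiseConst η * Real.exp L) (hγ : 0 < ampSum ν S)
    (hγS : ampSum ν S ≤ S)
    (hs : s = ampSum ν S / (64 * noiseConst η ^ 3 * S ^ 2 * K * (√B + 1) ^ 2))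
    (hp : 4 * K * Real.exp (-(β ^ 2 / (48 * max (max (coherence Φ) ρ) e ^ 2))) ≤
      noiseConst η * ampSum ν S * e / (256 * S * K * (√B + 1))) :
    Integrable (fun z => Real.exp (s * responseChange S Φ Ψ z)) (ν.prod η) ∧
    ∫ z, Real.exp (s * responseChange S Φ Ψ z) ∂(ν.prod η) ≤
      Real.exp (-(5 / 16 * s * (noiseConst η * ampSum ν S * e ^ 2 / K))) := by
  have hC := hη.noiseConst_pos
  have hS0 : (0 : ℝ) < S := by exact_mod_cast hS
  have hK0 : (0 : ℝ) < K := by exact_mod_cast (by omega : 0 < K)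
  have he : ∀ i, ‖Ψ i - Φ i‖ ≤ e := fun i => by
    refine le_of_sq_le_sq ?_ he0.le
    rw [← hsum]
    exact Finset.single_le_sum (f := fun i => ‖Ψ i - Φ i‖ ^ 2) (fun i _ => sq_nonneg _)
      (Finset.mem_univ i)
  obtain ⟨N, hN, hpN, hlin⟩ := exists_responseChange_eq_linearResponse hS hSK hΦ hΨ hν hη hβ hβ1
    hgap he0 heβ he
  have hmean := integral_responseChange_le hS hSK hΦ hΨ hframe hν hη hβ hgap he hN hlin
  have hV := integral_sq_mul_exp_responseChange_le_noiseConst hS hSK hB hframe hν hη hβ hgap he0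
    (heβ.trans hβ1) he hsum hL hρL ha hγ hγS hs hN (hpN.trans hp) hlin
  set C := noiseConst η with hCdef
  set M := √B + 1 with hMdef
  have hM0 : 0 < M := by positivity
  set γ := ampSum ν S with hγdef
  have hs0 : 0 ≤ s := by rw [hs]; positivity
  obtain ⟨hi, hle⟩ := integral_exp_responseChange_le (Ψ := Ψ) hSK.le hframe hν hη he hs0
  refine ⟨hi, hle.trans (Real.exp_le_exp.2 ?_)⟩
  have h1 : ∫ z, responseChange S Φ Ψ z ∂(ν.prod η) ≤ -(1 / 2 - 1 / 128) * (C * γ * e ^ 2 / K) := by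
    refine hmean.trans ?_
    rw [hsum]
    have h2 : 2 * (S * e * M) * (ν.prod η).real N ≤
        2 * (S * e * M) * (C * γ * e / (256 * S * K * M)) := by
      gcongr
      exact hpN.trans hp
    have h3 : 2 * (S * e * M) * (C * γ * e / (256 * S * K * M)) =
        1 / 128 * (C * γ * e ^ 2 / K) := by
      field_simp; norm_num
    have h4 : C * γ / (2 * K) * e ^ 2 = 1 / 2 * (C * γ * e ^ 2 / K) := by field_simp
    rw [h4]
    linarith
  have h2 : s ^ 2 / 2 * (20 * C ^ 4 * S ^ 2 * M ^ 2 * e ^ 2) =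
      5 / 32 * (s * (C * γ * e ^ 2 / K)) := by
    rw [sq s]
    nth_rewrite 2 [hs]
    field_simp
    ring
  have h3 := mul_le_mul_of_nonneg_left h1 hs0
  have h4 := mul_le_mul_of_nonneg_left hV (by positivity : 0 ≤ s ^ 2 / 2)
  have h5 : 0 ≤ s * (C * γ * e ^ 2 / K) := by positivity
  linarith

end Sample

/-! ### Chernoff's bound for i.i.d. samples. -/

section Chernoff

lemma measureReal_le_sum_le_of_hasLaw {Ω E : Type*} [MeasurableSpace Ω] [MeasurableSpace E]
    {P : Measure Ω} [IsProbabilityMeasure P] {π : Measure E} {N : ℕ} {Z : Fin N → Ω → E}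
    (hZ : ∀ n, HasLaw (Z n) π P) (hind : iIndepFun Z P) {f : E → ℝ} (hf : Measurable f) {s b : ℝ}
    (hs : 0 ≤ s) (hint : Integrable (fun z => Real.exp (s * f z)) π)
    (hb : ∫ z, Real.exp (s * f z) ∂π ≤ Real.exp b) (a : ℝ) :
    P.real {ω | a ≤ ∑ n, f (Z n ω)} ≤ Real.exp (-(s * a) + N * b) := by
  have hfZ : iIndepFun (fun n => f ∘ Z n) P := hind.comp (fun _ => f) fun _ => hf
  have hm : ∀ n, AEMeasurable (f ∘ Z n) P := fun n => hf.comp_aemeasurable (hZ n).aemeasurable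
  have hexp : AEStronglyMeasurable (fun z => Real.exp (s * f z)) π := hint.aestronglyMeasurable
  have hin : ∀ n, Integrable (fun ω => Real.exp (s * (f ∘ Z n) ω)) P := fun n => by
    have h := hint
    rw [← (hZ n).map_eq] at h
    exact h.comp_aemeasurable (hZ n).aemeasurable
  have hmgf : ∀ n, mgf (f ∘ Z n) P s ≤ Real.exp b := fun n => by
    refine le_trans (le_of_eq ?_) hb
    rw [mgf, ← (hZ n).map_eq, integral_map (hZ n).aemeasurable]
    · rfl
    · rw [(hZ n).map_eq]; exact hexp
  -- Integrability is read off from positivity of the moment generating function, which factorises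
  -- by independence.
  have hsumint : Integrable (fun ω => Real.exp (s * (∑ n, f ∘ Z n) ω)) P := by
    rw [← mgf_pos_iff, hfZ.mgf_sum₀ hm]
    exact Finset.prod_pos fun n _ => mgf_pos (hin n)
  have h := measure_ge_le_exp_mul_mgf a hs hsumint
  simp only [Finset.sum_apply, Function.comp_apply] at h
  refine h.trans ?_
  rw [hfZ.mgf_sum₀ hm, Real.exp_add]
  calc Real.exp (-s * a) * ∏ n, mgf (f ∘ Z n) P s
      ≤ Real.exp (-s * a) * ∏ _n : Fin N, Real.exp b := by
        gcongr with n
        · exact fun n _ => mgf_nonneg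
        · exact hmgf n
    _ = _ := by
        rw [Finset.prod_const, Finset.card_univ, Fintype.card_fin, ← Real.exp_nat_mul, neg_mul]

end Chernoff

/-! ### From smaller values on a sphere to a local maximum inside. -/

section LocalMax

variable {d K S N : ℕ}

lemma continuous_criterion (hSK : S ≤ K) (y : Fin N → EuclideanSpace ℝ (Fin d)) :
    Continuous (criterion (K := K) S y) :=
  continuous_finsetSum _ fun _ _ => continuous_response hSK continuous_id continuous_const

lemma meanCriterion_eq (y : Fin N → EuclideanSpace ℝ (Fin d))
    (Ψ : Fin K → EuclideanSpace ℝ (Fin d)) :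
    meanCriterion S y Ψ = 1 / (N : ℝ) * criterion S y Ψ := rfl

/-- A continuous function of the dictionary that is smaller on a sphere around `Φ` than at `Φ`
has a local maximum inside this sphere. -/
lemma exists_isLocalMaxOn_dictionaries (hK : 0 < K) {Φ : Fin K → EuclideanSpace ℝ (Fin d)}
    (hΦ : Φ ∈ dictionaries d K) {F : (Fin K → EuclideanSpace ℝ (Fin d)) → ℝ} (hF : Continuous F)
    {e : ℝ} (he : 0 ≤ e) (hlt : ∀ Ψ ∈ dictionaries d K, ∑ i, ‖Ψ i - Φ i‖ ^ 2 = e ^ 2 → F Ψ < F Φ) :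
    ∃ Ψ ∈ dictionaries d K, IsLocalMaxOn F (dictionaries d K) Ψ ∧ dictDist Ψ Φ ≤ e := by
  have hcont : Continuous fun Ψ : Fin K → EuclideanSpace ℝ (Fin d) => ∑ i, ‖Ψ i - Φ i‖ ^ 2 := by
    fun_prop
  set Q : Set (Fin K → EuclideanSpace ℝ (Fin d)) :=
    dictionaries d K ∩ {Ψ | ∑ i, ‖Ψ i - Φ i‖ ^ 2 ≤ e ^ 2} with hQ
  have hclosed : IsClosed (dictionaries d K) := by
    have : dictionaries d K = ⋂ i, {Ψ | ‖Ψ i‖ = 1} := by ext; simp [dictionaries]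
    rw [this]
    exact isClosed_iInter fun i => isClosed_eq (by fun_prop) continuous_const
  have hcompact : IsCompact Q := by
    refine (isCompact_closedBall (0 : Fin K → EuclideanSpace ℝ (Fin d)) 1).of_isClosed_subset
      (hclosed.inter (isClosed_le hcont continuous_const)) fun Ψ hΨ => ?_
    rw [mem_closedBall_zero_iff, pi_norm_le_iff_of_nonneg zero_le_one]
    exact fun i => (hΨ.1 i).le
  have hΦQ : Φ ∈ Q := ⟨hΦ, by simpa using sq_nonneg e⟩
  obtain ⟨Ψ, hΨQ, hmax⟩ := hcompact.exists_isMaxOn ⟨Φ, hΦQ⟩ hF.continuousOn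
  -- A maximiser over the closed ball cannot lie on its boundary, where the value is below the one
  -- at `Φ`; so it is a local maximum within the dictionaries.
  have hin : ∑ i, ‖Ψ i - Φ i‖ ^ 2 < e ^ 2 := by
    refine lt_of_le_of_ne hΨQ.2 fun h => ?_
    exact (hlt Ψ hΨQ.1 h).not_ge (hmax hΦQ)
  refine ⟨Ψ, hΨQ.1, ?_, ?_⟩
  · have hnhds : {Ψ' | ∑ i, ‖Ψ' i - Φ i‖ ^ 2 < e ^ 2} ∈ nhds Ψ :=
      (isOpen_lt hcont continuous_const).mem_nhds hin
    filter_upwards [mem_nhdsWithin_of_mem_nhds hnhds, self_mem_nhdsWithin] with Ψ' h1 h2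
    exact hmax ⟨h2, le_of_lt (show ∑ i, ‖Ψ' i - Φ i‖ ^ 2 < e ^ 2 from h1)⟩
  · have : Nonempty (Fin K) := ⟨⟨0, hK⟩⟩
    refine ciSup_le fun i => le_of_sq_le_sq ?_ he
    exact (Finset.single_le_sum (f := fun i => ‖Ψ i - Φ i‖ ^ 2) (fun i _ => sq_nonneg _)
      (Finset.mem_univ i)).trans hin.le

end LocalMax

/-! ### The net argument and the comparison of probabilities. -/

section Probability

variable {d K S N : ℕ} {Φ : Fin K → EuclideanSpace ℝ (Fin d)} {A B : ℝ}

/-- If the criterion is clearly smaller on a net of a sphere around `Φ` than at `Φ`, it has a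
local maximum inside this sphere. -/
lemma exists_isLocalMaxOn_criterion_of_net (hSK : S < K) (hΦ : Φ ∈ dictionaries d K)
    (hframe : IsFrame Φ A B) {e δ : ℝ} (he : 0 ≤ e) {T : Finset (Fin K → EuclideanSpace ℝ (Fin d))}
    (hT : ∀ Ψ ∈ dictionaries d K, ∑ i, ‖Ψ i - Φ i‖ ^ 2 = e ^ 2 → ∃ c ∈ T, ‖Ψ - c‖ < δ)
    {z : Fin N → EuclideanSpace ℝ (Fin K) × EuclideanSpace ℝ (Fin d)} (hz : ∀ n, ‖(z n).1‖ = 1)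
    (hneg : ∀ c ∈ T, ∑ n, responseChange S Φ c (z n) < -(N * (S * (δ * (√B + 1))))) :
    ∃ Ψ ∈ dictionaries d K,
      IsLocalMaxOn (meanCriterion S fun n => signal Φ (z n).1 (z n).2) (dictionaries d K) Ψ ∧
      IsLocalMaxOn (criterion S fun n => signal Φ (z n).1 (z n).2) (dictionaries d K) Ψ ∧
      dictDist Ψ Φ ≤ e := by
  obtain ⟨Ψ, hΨ, hmax, hdist⟩ := exists_isLocalMaxOn_dictionaries (by omega) hΦ
    (continuous_criterion hSK.le fun n => signal Φ (z n).1 (z n).2) he fun Ψ hΨ hsum => by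
      obtain ⟨c, hc, hcδ⟩ := hT Ψ hΨ hsum
      have h1 := hneg c hc
      have h2 : ∀ n, response S Ψ (signal Φ (z n).1 (z n).2) ≤
          response S c (signal Φ (z n).1 (z n).2) + S * (δ * (√B + 1)) := fun n => by
        have h3 := abs_response_sub_le hSK.le (Ψ := Ψ) (Ψ' := c)
          (y := signal Φ (z n).1 (z n).2) (b := δ * (√B + 1)) fun i => by
            refine (abs_inner_signal_le hframe (hz n) _ _).trans ?_
            gcongr
            exact (norm_le_pi_norm (Ψ - c) i).trans hcδ.le
        linarith [(abs_le.1 h3).2]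
      have h3 := Finset.sum_le_sum fun n (_ : n ∈ Finset.univ) => h2 n
      rw [Finset.sum_add_distrib] at h3
      simp only [responseChange, Finset.sum_sub_distrib, Finset.sum_const, Finset.card_univ,
        Fintype.card_fin, nsmul_eq_mul] at h1 h3
      unfold criterion
      linarith
  refine ⟨Ψ, hΨ, ?_, hmax, hdist⟩
  filter_upwards [hmax] with Ψ' h
  rw [meanCriterion_eq, meanCriterion_eq]
  gcongr

/-- Lets the cardinality bound absorb the factor `1 / C` of the net, as the logarithm in the stated
probability contains no `C`. -/
lemma one_le_noiseConst_mul {η : Measure (EuclideanSpace ℝ (Fin d))} {ρ : ℝ≥0}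
    (hη : IsSubgaussianNoise η ρ) (hdK : d ≤ K) (hK : 2 ≤ K) (hρ : (ρ : ℝ) ^ 2 ≤ 1 / 4) :
    1 ≤ noiseConst η * K := by
  have hK2 : (2 : ℝ) ≤ K := by exact_mod_cast hK
  have hd : (d : ℝ) ≤ K := by exact_mod_cast hdK
  have hm : 1 + ∫ v, ‖v‖ ^ 2 ∂η ≤ (K : ℝ) ^ 2 := by
    have h1 : 2 * (d : ℝ) * ρ ^ 2 ≤ 2 * K * (1 / 4) := by gcongr
    nlinarith [hη.integral_norm_sq_le]
  refine le_of_sq_le_sq ?_ (mul_nonneg hη.noiseConst_pos.le (by linarith))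
  calc (1 : ℝ) ^ 2 ≤ noiseConst η ^ 2 * (1 + ∫ v, ‖v‖ ^ 2 ∂η) := by
        rw [one_pow]; exact hη.one_le_noiseConst_sq_mul
    _ ≤ noiseConst η ^ 2 * K ^ 2 := by gcongr
    _ = _ := (mul_pow _ _ _).symm

/-- The union bound over a net is dominated by the exceptional probability. -/
lemma le_failureProb {C γ e p m : ℝ} (hS : 1 ≤ S) (hSK : S < K) (hB : 1 ≤ B) (hC : 0 < C)
    (hCK : 1 ≤ C * K) (hγ : 0 < γ) (hγS : γ ≤ S) (he : 0 < e) (he1 : e ≤ 1) (hp1 : p ≤ 1)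
    (hm : m ≤ (1 + 2 * e / (C * γ * e ^ 2 / (16 * K * S * (√B + 1)))) ^ (K * d))
    (hp : p ≤ m * Real.exp (-(N * e ^ 2 * γ ^ 2 /
      (256 * C ^ 2 * (S : ℝ) ^ 2 * (K : ℝ) ^ 2 * (√B + 1) ^ 2)))) :
    p ≤ failureProb d K S N B C γ e := by
  have hS0 : (0 : ℝ) < S := by exact_mod_cast hS
  have hK1 : (1 : ℝ) ≤ K := by exact_mod_cast (by omega : 1 ≤ K)
  have hK0 : (0 : ℝ) < K := by linarith
  have hM2 : 2 ≤ √B + 1 := by linarith [Real.one_le_sqrt.2 hB]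
  unfold failureProb
  set M := √B + 1 with hM
  have hM0 : 0 < M := by linarith
  set Q := S * K * M / (e * γ) with hQ
  have hQ49 : 49 * S * K * M / (e * γ) = 49 * Q := by rw [hQ]; ring
  have hQK : (K : ℝ) ≤ Q := by
    rw [hQ, le_div_iff₀ (by positivity)]
    have h1 : e * γ ≤ 1 * S := by gcongr
    calc K * (e * γ) ≤ K * (1 * S) := by gcongr
      _ = S * K * 1 := by ring
      _ ≤ S * K * M := by gcongr; linarith
  have hQ1 : 1 ≤ Q := hK1.trans hQK
  have hbase : 1 + 2 * e / (C * γ * e ^ 2 / (16 * K * S * M)) ≤ (49 * Q) ^ 2 := by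
    have h1 : 2 * e / (C * γ * e ^ 2 / (16 * K * S * M)) = 32 * Q * (1 / C) := by
      rw [hQ]; field_simp; ring
    have h2 : 1 / C ≤ K := by rw [div_le_iff₀ hC]; linarith
    rw [h1]
    calc 1 + 32 * Q * (1 / C) ≤ Q * Q + 32 * Q * Q := by
          gcongr
          · nlinarith
          · exact h2.trans hQK
      _ ≤ _ := by nlinarith
  set X := N * e ^ 2 * γ ^ 2 / (513 * C ^ 2 * (S : ℝ) ^ 2 * (K : ℝ) ^ 2 * M ^ 2) with hX
  set L := K * d * Real.log (49 * S * K * M / (e * γ)) with hL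
  have hqX : 2 * X ≤ N * e ^ 2 * γ ^ 2 / (256 * C ^ 2 * (S : ℝ) ^ 2 * (K : ℝ) ^ 2 * M ^ 2) := by
    rw [hX]
    have h1 : 2 * (N * e ^ 2 * γ ^ 2 / (513 * C ^ 2 * (S : ℝ) ^ 2 * (K : ℝ) ^ 2 * M ^ 2)) =
        2 / 513 * (N * e ^ 2 * γ ^ 2 / (C ^ 2 * (S : ℝ) ^ 2 * (K : ℝ) ^ 2 * M ^ 2)) := by
      field_simp
    have h2 : N * e ^ 2 * γ ^ 2 / (256 * C ^ 2 * (S : ℝ) ^ 2 * (K : ℝ) ^ 2 * M ^ 2) =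
        1 / 256 * (N * e ^ 2 * γ ^ 2 / (C ^ 2 * (S : ℝ) ^ 2 * (K : ℝ) ^ 2 * M ^ 2)) := by
      field_simp
    rw [h1, h2]
    exact mul_le_mul_of_nonneg_right (by norm_num) (by positivity)
  have hmL : m ≤ Real.exp (2 * L) := by
    have h1 : Real.exp (2 * L) = ((49 * Q) ^ 2) ^ (K * d) := by
      rw [← Real.exp_log (by positivity : 0 < ((49 * Q) ^ 2) ^ (K * d)), Real.log_pow,
        Real.log_pow, hL, hQ49]
      push_cast
      ring_nf
    rw [h1]
    refine hm.trans ?_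
    gcongr
  -- The union bound is at most `exp (2 (L - X))`, since `1 / 256 ≥ 2 / 513`. For `X ≤ L` the claim
  -- is trivial; for `X ≥ L` the square of `exp (L - X)` is below `exp (L - X)`.
  rcases le_total X L with h | h
  · have : 1 ≤ Real.exp (-X + L) := Real.one_le_exp (by linarith)
    linarith
  · have h1 : p ≤ Real.exp (2 * L) * Real.exp (-(2 * X)) := by
      refine hp.trans ?_
      gcongr
    rw [← Real.exp_add] at h1
    have h2 : Real.exp (2 * L + -(2 * X)) ≤ Real.exp (-X + L) := by
      rw [Real.exp_le_exp]; linarith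
    linarith [Real.exp_pos (-X + L)]

end Probability

end DictId

/-! ### Assembly of the theorem. -/

theorem theorem4 {d K S N : ℕ} (hS : 1 ≤ S) (hSK : S < K)
    -- the generating dictionary: a unit norm frame
    (Φ : Fin K → EuclideanSpace ℝ (Fin d)) (hΦ : Φ ∈ dictionaries d K)
    (A B : ℝ) (hframe : IsFrame Φ A B)
    -- the laws of the coefficients and of the noise
    (ν : Measure (EuclideanSpace ℝ (Fin K))) (hν : IsSymmetricOnSphere ν)
    (ρ : ℝ≥0) (η : Measure (EuclideanSpace ℝ (Fin d))) (hη : IsSubgaussianNoise η ρ)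
    -- the coefficients and noise vectors of the `N` i.i.d. signals
    {Ω : Type*} [MeasurableSpace Ω] (P : Measure Ω) [IsProbabilityMeasure P]
    (x : Fin N → Ω → EuclideanSpace ℝ (Fin K)) (r : Fin N → Ω → EuclideanSpace ℝ (Fin d))
    (hx : ∀ n, HasLaw (x n) ν P) (hr : ∀ n, HasLaw (r n) η P)
    (hxr : ∀ n, IndepFun (x n) (r n) P)
    (hindep : iIndepFun (fun n ω => (x n ω, r n ω)) P)
    -- the gap
    (β : ℝ) (hβ : 0 < β) (hgap : ∀ᵐ z ∂ν, β ≤ amp z S - amp z (S + 1))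
    -- the conditions on target precision, coherence and noise level
    (ε : ℝ) (hε : 0 < ε)
    (hεle : ε ≤ β / (9 / 4 + 9 * √(Real.log (logArg K S B (noiseConst η) β (ampSum ν S)))))
    (hμρ : max (coherence Φ) (ρ : ℝ) ≤
      β / √(72 * (Real.log (logArg K S B (noiseConst η) β (ampSum ν S)) +
        Real.log (Real.log (logArg K S B (noiseConst η) β (ampSum ν S)))))) :
    let e := precision K S B (noiseConst η) β (ampSum ν S) (coherence Φ) ρ ε
    P {ω | ¬ ∃ Ψ ∈ dictionaries d K,
        IsLocalMaxOn (meanCriterion S fun n => signal Φ (x n ω) (r n ω)) (dictionaries d K) Ψ ∧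
        IsLocalMaxOn (criterion S fun n => signal Φ (x n ω) (r n ω)) (dictionaries d K) Ψ ∧
        dictDist Ψ Φ ≤ e + e ^ 2 / (16 * K)} ≤
      ENNReal.ofReal (failureProb d K S N B (noiseConst η) (ampSum ν S) e) := by
  intro e
  have := hν.prob
  have := hη.prob
  have hB := hframe.one_le hΦ (by omega)
  have hC := hη.noiseConst_pos
  have hC1 := noiseConst_le_one (η := η)
  have hβ1 := hν.gap_le_one hgap
  have hS0 : (0 : ℝ) < S := by exact_mod_cast hS
  have hK2 : (2 : ℝ) ≤ K := by exact_mod_cast (by omega : 2 ≤ K)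
  have hγS := hν.ampSum_le (S := S)
  have hγ : 0 < ampSum ν S := (mul_pos hS0 hβ).trans_le (hν.mul_le_ampSum hgap)
  obtain ⟨ha, hL⟩ := logArg_bound hS hSK hB hC hC1 hβ hβ1 hγ hγS
  obtain ⟨he0, heβ, hp⟩ := precision_spec hS hSK hB hC hC1 hβ hβ1 hγ hγS (coherence_nonneg Φ)
    ρ.2 hε hεle hμρ
  have hmL := max_sq_mul_log_le (coherence_nonneg Φ) hL hμρ
  have haL : 0 < logArg K S B (noiseConst η) β (ampSum ν S) := by unfold logArg; positivity
  set L := Real.log (logArg K S B (noiseConst η) β (ampSum ν S)) with hLdef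
  rw [← Real.exp_log haL, ← hLdef] at ha
  have hρL : 72 * (ρ : ℝ) ^ 2 * L ≤ 1 := by
    have h1 : (ρ : ℝ) ^ 2 ≤ max (coherence Φ) ρ ^ 2 := by
      gcongr
      exact le_max_right _ _
    have h2 : 0 ≤ Real.log L := Real.log_nonneg (by linarith)
    calc 72 * (ρ : ℝ) ^ 2 * L = (ρ : ℝ) ^ 2 * (72 * L) := by ring
      _ ≤ max (coherence Φ) ρ ^ 2 * (72 * (L + Real.log L)) := by
        gcongr
        linarith
      _ ≤ β ^ 2 := hmL
      _ ≤ 1 := pow_le_one₀ hβ.le hβ1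
  have hCK := one_le_noiseConst_mul hη hframe.card_le (by omega : 2 ≤ K) (by nlinarith)
  have he24 : 24 * e ≤ β := by
    have h1 : (5 / 2 : ℝ) ≤ √L := Real.le_sqrt_of_sq_le (by norm_num; linarith)
    refine le_trans ?_ heβ
    rw [mul_comm]
    exact mul_le_mul_of_nonneg_left (by linarith) he0.le
  change 0 < e at he0
  have hM0 : 0 < √B + 1 := by positivity
  -- Chosen so that passing from a net point to a nearby dictionary costs `C γ e² / (16 K)` per
  -- signal. Against the rate `5 / 16` this leaves `1 / 4`, and `s / 4` times `C γ e² / K` is the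
  -- exponent with constant `256`.
  set δ := noiseConst η * ampSum ν S * e ^ 2 / (16 * K * S * (√B + 1)) with hδ
  obtain ⟨T, hT, hTcard, hTnet⟩ := exists_finset_net he0.le (by positivity : 0 < δ)
    (T := {Ψ | Ψ ∈ dictionaries d K ∧ ∑ i, ‖Ψ i - Φ i‖ ^ 2 = e ^ 2}) (x := Φ)
    fun c hc => (pi_norm_le_iff_of_nonneg he0.le).2 fun i => le_of_sq_le_sq
      ((Finset.single_le_sum (f := fun i => ‖c i - Φ i‖ ^ 2) (fun i _ => sq_nonneg _)
        (Finset.mem_univ i)).trans hc.2.le) he0.le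
  have hfin : Module.finrank ℝ (Fin K → EuclideanSpace ℝ (Fin d)) = K * d := by
    simp [Module.finrank_pi_fintype]
  rw [hfin] at hTcard
  have hlaw : ∀ n, HasLaw (fun ω => (x n ω, r n ω)) (ν.prod η) P := fun n =>
    (indepFun_iff_hasLaw_prodMk_prod (hx n) (hr n)).1 (hxr n)
  set s := ampSum ν S / (64 * noiseConst η ^ 3 * S ^ 2 * K * (√B + 1) ^ 2) with hs
  have hs0 : 0 ≤ s := by positivity
  have hδS : S * (δ * (√B + 1)) = noiseConst η * ampSum ν S * e ^ 2 / K / 16 := by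
    rw [hδ]; field_simp
  have hchernoff : ∀ c ∈ T, P.real {ω | -(N * (S * (δ * (√B + 1)))) ≤
      ∑ n, responseChange S Φ c (x n ω, r n ω)} ≤ Real.exp (-(N * e ^ 2 * ampSum ν S ^ 2 /
        (256 * noiseConst η ^ 2 * (S : ℝ) ^ 2 * (K : ℝ) ^ 2 * (√B + 1) ^ 2))) := fun c hc => by
    obtain ⟨hi, hle⟩ := integral_exp_responseChange_le_of_sum_eq hS hSK hB hΦ (hT c hc).1 hframe
      hν hη hβ hβ1 hgap he0 he24 (hT c hc).2 hL hρL ha hγ hγS hs hp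
    refine (measureReal_le_sum_le_of_hasLaw hlaw hindep
      (continuous_responseChange hSK.le).measurable hs0 hi hle _).trans (le_of_eq ?_)
    rw [hδS, hs]
    congr 1
    field_simp
    ring
  have hbad : P.real {ω | ¬ ∃ Ψ ∈ dictionaries d K,
        IsLocalMaxOn (meanCriterion S fun n => signal Φ (x n ω) (r n ω)) (dictionaries d K) Ψ ∧
        IsLocalMaxOn (criterion S fun n => signal Φ (x n ω) (r n ω)) (dictionaries d K) Ψ ∧
        dictDist Ψ Φ ≤ e + e ^ 2 / (16 * K)} ≤ T.card *
      Real.exp (-(N * e ^ 2 * ampSum ν S ^ 2 /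
        (256 * noiseConst η ^ 2 * (S : ℝ) ^ 2 * (K : ℝ) ^ 2 * (√B + 1) ^ 2))) := by
    have hnorm : ∀ᵐ ω ∂P, ∀ n, ‖x n ω‖ = 1 := ae_all_iff.2 fun n =>
      ae_of_ae_map (hx n).aemeasurable ((hx n).map_eq.symm ▸ hν.ae_norm_eq_one)
    have hnull : P.real {ω | ¬ ∀ n, ‖x n ω‖ = 1} = 0 := by
      rw [measureReal_def, ae_iff.1 hnorm, ENNReal.toReal_zero]
    calc _ ≤ P.real ({ω | ¬ ∀ n, ‖x n ω‖ = 1} ∪ ⋃ c ∈ T, {ω | -(N * (S * (δ * (√B + 1)))) ≤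
          ∑ n, responseChange S Φ c (x n ω, r n ω)}) := by
          refine measureReal_mono fun ω hω => ?_
          by_contra hcon
          rw [Set.mem_union, not_or] at hcon
          obtain ⟨h1, h2⟩ := hcon
          refine hω ?_
          obtain ⟨Ψ, hΨ, hm1, hm2, hdist⟩ := exists_isLocalMaxOn_criterion_of_net hSK hΦ hframe
            he0.le (T := T) (fun Ψ hΨ hsum => hTnet Ψ ⟨hΨ, hsum⟩) (z := fun n => (x n ω, r n ω))
            (not_not.1 h1) fun c hc => not_le.1 fun h => h2 (Set.mem_biUnion hc h)
          -- The argument yields distance at most `e`; the quadratic term is only slack.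
          exact ⟨Ψ, hΨ, hm1, hm2, hdist.trans (le_add_of_nonneg_right (by positivity))⟩
      _ ≤ 0 + ∑ c ∈ T, P.real {ω | -(N * (S * (δ * (√B + 1)))) ≤
          ∑ n, responseChange S Φ c (x n ω, r n ω)} := by
          rw [← hnull]
          exact (measureReal_union_le _ _).trans
            (add_le_add_right (measureReal_biUnion_finset_le _ _) _)
      _ ≤ _ := by
          rw [zero_add]
          exact (Finset.sum_le_card_nsmul _ _ _ hchernoff).trans_eq (nsmul_eq_mul _ _)
  rw [← ofReal_measureReal]
  exact ENNReal.ofReal_le_ofReal (le_failureProb hS hSK hB hC hCK hγ hγS he0 (by linarith)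
    measureReal_le_one hTcard hbad)
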